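/- Let $z_1,\dots,z_n\in\mathbb C$ be distinct, let $\chi_1,\dots,\chi_n\in\mathbb R$ satisfy $\chi_k<2$ for all $k$ and $\sum_{k}\chi_k>4$, and let $\Lambda>0$. Write $g(x)=\frac{4}{(1+|x|^2)^2}$, $\kappa=\ln 2-\frac12$, $$G(x,y)=\ln\frac1{|x-y|}-\tfrac14\big(\ln g(x)+\ln g(y)\big)+\kappa,\qquad w(x)=e^{\sum_{k=1}^n\chi_kG(z_k,x)}.$$ Let $H^1(\hat{\mathbb C})$ be the space of locally integrable $h:\mathbb C\to\mathbb R$ with a weak gradient such that $\int_{\mathbb C}(|\nabla h|^2+|h|^2g)\,d^2x<\infty$. For a function $\phi$ on $\mathbb C$ with a locally integrable weak gradient and for $\varepsilon>0$ set $$S_\varepsilon(\phi)=\frac1{4\pi}\Big[\int_{\mathbb C_\varepsilon}\big(|\nabla\phi|^2+4\pi\Lambda e^{\phi}\big)\,d^2x+R(\varepsilon,\phi)\Big],\qquad \mathbb C_\varepsilon=\mathbb C\setminus\Big(\bigcup_{k=1}^nB(z_k,\varepsilon)\cup\{|x|>1/\varepsilon\}\Big),$$ $$R(\varepsilon,\phi)=-2i\sum_{k=1}^n\chi_k\oint_{|x-z_k|=\varepsilon}\phi(x)\frac{d\bar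 x}{\bar x-\bar z_k}+8i\oint_{|x|=1/\varepsilon}\phi(x)\frac{d\bar x}{\bar x}+2\pi\sum_{k=1}^n\chi_k^2\ln\frac1\varepsilon+32\pi\ln\frac1\varepsilon,$$ where the contours are oriented counterclockwise and $\phi$ is taken on them in the sense of traces. The Liouville action is $S_{(\chi_k,z_k)}(\phi)=\lim_{\varepsilon\to0^+}S_\varepsilon(\phi)$. The centered Liouville action of $h\in H^1(\hat{\mathbb C})$ is $$S_{L,(\chi_k,z_k)}(h)=\frac1{4\pi}\int_{\mathbb C}\big(|\nabla h|^2+4\pi\Lambda e^{h}w\,g\big)\,d^2x+\frac1{4\pi}\Big(4-\sum_{k=1}^n\chi_k\Big)\int_{\mathbb C}h\,g\,d^2x.$$ Then for every $h\in H^1(\hat{\mathbb C})$ and $\phi=h+\ln(gw)$, the integrals in $S_{L,(\chi_k,z_k)}(h)$ converge absolutely; for all sufficiently small $\varepsilon>0$ the traces and integrals in $S_\varepsilon(\phi)$ exist; the limit $S_{(\chi_k,z_k)}(\phi)$ exists; and $$S_{(\chi_k,z_k)}(\phi)=S_{L,(\chi_k,z_k)}(h)+l((\chi_k,z_k))+C_\star((\chi_k)),$$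 where $$l((\chi_k,z_k))=-\sum_{k=1}^n\chi_k\Big(1-\frac{\chi_k}4\Big)\ln g(z_k)-\frac12\sum_{k\ne j}\chi_k\chi_jG(z_j,z_k),$$ the last sum being over ordered pairs, and $$C_\star((\chi_k))=2\ln4+2\sum_{k=1}^n\chi_k\Big(\kappa-\tfrac12\ln2\Big)-\frac\kappa2\sum_{k=1}^n\chi_k^2+\frac1{8\pi}\Big(4-\sum_{k=1}^n\chi_k\Big)\int_{\mathbb C}g\ln g\,d^2x.$$ -/

import Mathlib

open scoped Topology

noncomputable section

namespace SphereLiouville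

open MeasureTheory Filter

/-- Density of the round metric on the Riemann sphere. -/
def g (x : ℂ) : ℝ := 4 / (1 + ‖x‖ ^ 2) ^ 2

def κ : ℝ := Real.log 2 - 1 / 2

/-- Green kernel of the round metric with vanishing mean. (Off the diagonal.) -/
def G (x y : ℂ) : ℝ :=
  Real.log (1 / ‖x - y‖) - 1 / 4 * (Real.log (g x) + Real.log (g y)) + κ

/-- `w(x) = exp (∑ₖ χₖ G(zₖ, x))`. -/
def w {n : ℕ} (χ : Fin n → ℝ) (z : Fin n → ℂ) (x : ℂ) : ℝ :=
  Real.exp (∑ k, χ k * G (z k) x)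

/-! ### Weak gradients and `H¹` of the sphere -/

/-- `v` is the weak gradient of `f` on `ℂ = ℝ²`; the vector `(a, b)` is written `a + b i`, and
`inner ℝ (v x) e` is the Euclidean inner product. -/
structure IsWeakGrad (f : ℂ → ℝ) (v : ℂ → ℂ) : Prop where
  locallyIntegrable : LocallyIntegrable f volume
  locallyIntegrable_grad : LocallyIntegrable v volume
  integral_eq : ∀ ψ : ℂ → ℝ, ContDiff ℝ ((⊤ : ℕ∞) : WithTop ℕ∞) ψ → HasCompactSupport ψ →
    ∀ e : ℂ, ∫ x, f x * fderiv ℝ ψ x e = - ∫ x, inner ℝ (v x) e * ψ x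

def HasWeakGrad (f : ℂ → ℝ) : Prop := ∃ v, IsWeakGrad f v

open Classical in
/-- The weak gradient (unique up to null sets; `0` if there is none). -/
def weakGrad (f : ℂ → ℝ) : ℂ → ℂ :=
  if hf : HasWeakGrad f then hf.choose else 0

/-- `h ∈ H¹` of the Riemann sphere: `∫ (|∇h|² + |h|² g) < ∞`. -/
def MemH1 (h : ℂ → ℝ) : Prop :=
  HasWeakGrad h ∧ Integrable (fun x => ‖weakGrad h x‖ ^ 2 + |h x| ^ 2 * g x) volume

/-! ### Traces on circles and contour integrals -/

/-- `T` (only its values on the circle matter) is the trace of `f` on the circle with centre `c`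
and radius `r`, i.e. the Gauss–Green formula holds on the disc for `f` and all test functions:
`∫_B (f ∂ₑψ + ψ ∂ₑf) = ∮_{∂B} T ψ ⟨ν, e⟩ ds`, where `ν` is the outer unit normal. -/
def IsCircleTrace (f : ℂ → ℝ) (c : ℂ) (r : ℝ) (T : ℂ → ℝ) : Prop :=
  CircleIntegrable T c r ∧
  ∀ ψ : ℂ → ℝ, ContDiff ℝ ((⊤ : ℕ∞) : WithTop ℕ∞) ψ → HasCompactSupport ψ → ∀ e : ℂ,
    ∫ x in Metric.ball c r, (f x * fderiv ℝ ψ x e + inner ℝ (weakGrad f x) e * ψ x) =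
      ∫ θ in (0 : ℝ)..(2 * Real.pi), T (circleMap c r θ) * ψ (circleMap c r θ) *
        inner ℝ (circleMap 0 1 θ) e * r

def HasCircleTrace (f : ℂ → ℝ) (c : ℂ) (r : ℝ) : Prop :=
  HasWeakGrad f ∧ ∃ T, IsCircleTrace f c r T

open Classical in
/-- The trace of `f` on a circle (unique up to null sets of the circle; `0` if there is none). -/
def circleTrace (f : ℂ → ℝ) (c : ℂ) (r : ℝ) : ℂ → ℝ :=
  if hf : HasCircleTrace f c r then hf.2.choose else 0

/-- `∮ F(ζ) d(conj ζ)` over the circle `|ζ - c| = r`, oriented counterclockwise. -/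
def conjCircleIntegral (F : ℂ → ℂ) (c : ℂ) (r : ℝ) : ℂ :=
  ∫ θ in (0 : ℝ)..(2 * Real.pi),
    F (circleMap c r θ) * (starRingEnd ℂ) (deriv (circleMap c r) θ)

/-- `∮_{|ζ - c| = r} f(ζ) d(conj ζ) / (conj ζ - conj c)`, with `f` taken in the sense of traces. -/
def boundaryTerm (f : ℂ → ℝ) (c : ℂ) (r : ℝ) : ℂ :=
  conjCircleIntegral
    (fun ζ => (circleTrace f c r ζ : ℂ) / ((starRingEnd ℂ) ζ - (starRingEnd ℂ) c)) c r

/-! ### The Liouville action -/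

/-- The plane without the discs `B(zₖ, ε)` and without `|x| > 1/ε`. -/
def perforated {n : ℕ} (z : Fin n → ℂ) (ε : ℝ) : Set ℂ :=
  ((⋃ k, Metric.ball (z k) ε) ∪ {x : ℂ | 1 / ε < ‖x‖})ᶜ

/-- The boundary and counter terms `R(ε, φ)`. -/
def R {n : ℕ} (χ : Fin n → ℝ) (z : Fin n → ℂ) (ε : ℝ) (φ : ℂ → ℝ) : ℂ :=
  -2 * Complex.I * ∑ k, (χ k : ℂ) * boundaryTerm φ (z k) ε
    + 8 * Complex.I * boundaryTerm φ 0 (1 / ε)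
    + ((2 * Real.pi * (∑ k, χ k ^ 2) * Real.log (1 / ε) : ℝ) : ℂ)
    + ((32 * Real.pi * Real.log (1 / ε) : ℝ) : ℂ)

/-- The regularized action `S_ε(φ)`. -/
def regularizedAction {n : ℕ} (χ : Fin n → ℝ) (z : Fin n → ℂ) (Λ : ℝ) (φ : ℂ → ℝ) (ε : ℝ) : ℂ :=
  1 / (4 * (Real.pi : ℂ)) *
    (((∫ x in perforated z ε, (‖weakGrad φ x‖ ^ 2 + 4 * Real.pi * Λ * Real.exp (φ x))) : ℝ)
      + R χ z ε φ)

/-- Every integral in `S_ε(φ)` makes sense. -/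
def RegularizedActionDefined {n : ℕ} (z : Fin n → ℂ) (Λ : ℝ) (φ : ℂ → ℝ) (ε : ℝ) : Prop :=
  HasWeakGrad φ ∧
  IntegrableOn (fun x => ‖weakGrad φ x‖ ^ 2 + 4 * Real.pi * Λ * Real.exp (φ x))
    (perforated z ε) volume ∧
  (∀ k, HasCircleTrace φ (z k) ε) ∧ HasCircleTrace φ 0 (1 / ε)

/-- The Liouville action `S(φ) = lim_{ε → 0+} S_ε(φ)` with conical singularities `(χₖ, zₖ)`. -/
def liouvilleAction {n : ℕ} (χ : Fin n → ℝ) (z : Fin n → ℂ) (Λ : ℝ) (φ : ℂ → ℝ) : ℂ :=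
  limUnder (𝓝[>] (0 : ℝ)) (regularizedAction χ z Λ φ)

/-- The centered Liouville action `S_L(h)`. -/
def centeredAction {n : ℕ} (χ : Fin n → ℝ) (z : Fin n → ℂ) (Λ : ℝ) (h : ℂ → ℝ) : ℝ :=
  1 / (4 * Real.pi) *
      (∫ x, (‖weakGrad h x‖ ^ 2 + 4 * Real.pi * Λ * Real.exp (h x) * w χ z x * g x))
    + 1 / (4 * Real.pi) * (4 - ∑ k, χ k) * (∫ x, h x * g x)

def l {n : ℕ} (χ : Fin n → ℝ) (z : Fin n → ℂ) : ℝ :=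
  -∑ k, χ k * (1 - χ k / 4) * Real.log (g (z k))
    - 1 / 2 * ∑ k, ∑ j, if k ≠ j then χ k * χ j * G (z j) (z k) else 0

def Cstar {n : ℕ} (χ : Fin n → ℝ) : ℝ :=
  2 * Real.log 4 + 2 * ∑ k, χ k * (κ - 1 / 2 * Real.log 2) - 1 / 2 * κ * ∑ k, χ k ^ 2
    + 1 / (8 * Real.pi) * (4 - ∑ k, χ k) * (∫ x, g x * Real.log (g x))

end SphereLiouville

end

noncomputable section

namespace SphereLiouville

open MeasureTheory Filter
open scoped ContDiff

/-! Write U = ln(gw), which is `bg`. Since e^φ = e^h w g, only the gradient term has to be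
renormalized: |∇φ|² = |∇h|² + 2 ∇h·∇U + |∇U|². Both singular terms have the form ∇f·∇U, with f = h
or f = U, so one flux identity treats them both.

The gradient of U is a combination of poles (x - z_k)/|x - z_k|² and of the field x/(1+|x|²), whose
divergence is g/2. A pole switched off inside a disc, minus this round field, decays like |x|⁻² and
has divergence (arc-angle measure on the circle) - g/2. Hence its pairing with ∇f is half of ∫ f g
minus the angular integral of f over the circle (`Tame.integral_flux`). With weights -χ_k at z_k
(radius ε) and +4 at 0 (radius 1/ε) these fields add up to ∇U on the perforated plane
(`fluxField_eq`), and off it their sum is O((1+|x|²)⁻¹) uniformly in ε (`exists_bound_fluxField`).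
So the integral of ∇f·∇U over the perforated plane, minus the circle terms `fluxTerm`, tends to (4 -
∑χ)/2 · ∫ f g (`Tame.tendsto_integral_inner_bgGrad`).

The boundary terms of R are exactly -2 `fluxTerm` of φ, because d(conj x)/(conj x - conj z) = -i dθ
on a circle (`R_eq`). Of these, two copies for h compensate the cross term and one copy for U
compensates |∇U|². The remaining copy for U diverges logarithmically, which the counterterms cancel,
and leaves the regular parts of U at the z_k and at infinity (`tendsto_fluxTerm_bg`). Since G has
vanishing mean, ∫ U g = ∫ g ln g (`integral_bg_mul_g`), and the rest is algebra (`constants_eq`).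

Three analytic facts support this. A function with a weak gradient has a trace on every circle: the
Gauss–Green flux depends only on the normal component on the circle, so a test field may be replaced
by one constant along rays, and integrating out the radius produces the trace
(`HasWeakGrad.hasCircleTrace`). The angular integral of a trace is a volume integral, `circleMass`,
which makes all circle terms linear and easy to pass to the limit. Finally e^h w g is integrable:
all powers of e^|h| are integrable against g by a Trudinger inequality, obtained by applying the
Gagliardo–Nirenberg–Sobolev inequality to powers and carried to infinity by the inversion
(`Tame.integrable_exp`), while w^(1+δ) g is integrable for small δ because χ_k < 2.

The class `Tame` is wide enough to contain both H¹ functions and logarithms, whose gradients are not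
square integrable. -/

/-- Divergence of a planar vector field. -/
def dvg (F : ℂ → ℂ) (x : ℂ) : ℝ := (fderiv ℝ F x 1).re + (fderiv ℝ F x Complex.I).im

/-! ### Calculus of the divergence -/

lemma dvg_congr {F H : ℂ → ℂ} {x : ℂ} (hFH : F =ᶠ[𝓝 x] H) : dvg F x = dvg H x := by
  rw [dvg, dvg, hFH.fderiv_eq]

lemma dvg_sub {F H : ℂ → ℂ} {x : ℂ} (hF : DifferentiableAt ℝ F x) (hH : DifferentiableAt ℝ H x) :
    dvg (fun y => F y - H y) x = dvg F x - dvg H x := by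
  simp only [dvg, fderiv_fun_sub hF hH, _root_.sub_apply, Complex.sub_re,
    Complex.sub_im]
  ring

lemma fderiv_apply_eq_re_im (L : ℂ →L[ℝ] ℝ) (v : ℂ) : L v = v.re * L 1 + v.im * L Complex.I := by
  have : v = v.re • (1 : ℂ) + v.im • Complex.I := by
    simp [Complex.re_add_im]
  conv_lhs => rw [this]
  simp only [map_add, map_smul, smul_eq_mul]

lemma dvg_smul {a : ℂ → ℝ} {F : ℂ → ℂ} {x : ℂ} (ha : DifferentiableAt ℝ a x)
    (hF : DifferentiableAt ℝ F x) :
    dvg (fun y => a y • F y) x = a x * dvg F x + fderiv ℝ a x (F x) := by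
  rw [fderiv_apply_eq_re_im, dvg, dvg, fderiv_fun_smul ha hF]
  simp
  ring

lemma dvg_sub_const (c x : ℂ) : dvg (fun y => y - c) x = 2 := by
  rw [dvg, fderiv_sub_const, fderiv_fun_id]
  simp; norm_num

lemma dvg_const (e x : ℂ) : dvg (fun _ => e) x = 0 := by
  simp [dvg]

lemma dvg_radial {a : ℂ → ℝ} {c x : ℂ} (ha : DifferentiableAt ℝ a x) :
    dvg (fun y => a y • (y - c)) x = 2 * a x + fderiv ℝ a x (x - c) := by
  rw [dvg_smul ha (by fun_prop), dvg_sub_const]; ring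

lemma continuous_dvg {F : ℂ → ℂ} (hF : ContDiff ℝ ∞ F) : Continuous (dvg F) := by
  have := hF.continuous_fderiv (by simp)
  unfold dvg
  fun_prop

lemma inner_eq (a b : ℂ) : inner ℝ a b = a.re * b.re + a.im * b.im := by
  simp [Complex.inner, mul_comm]

lemma dvg_eq_zero_of_notMem_tsupport {F : ℂ → ℂ} {x : ℂ} (hx : x ∉ tsupport F) : dvg F x = 0 := by
  rw [dvg, fderiv_of_notMem_tsupport ℝ hx]; simp

lemma hasCompactSupport_dvg {F : ℂ → ℂ} (hF : HasCompactSupport F) : HasCompactSupport (dvg F) :=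
  HasCompactSupport.intro hF fun _ hx => dvg_eq_zero_of_notMem_tsupport hx

/-! ### Weak gradients tested with vector fields -/

lemma integrable_mul_of_compactSupport {f a : ℂ → ℝ} (hf : LocallyIntegrable f volume)
    (ha : Continuous a) (hs : HasCompactSupport a) : Integrable (fun x => f x * a x) := by
  have := hf.integrable_smul_left_of_hasCompactSupport ha hs
  refine this.congr (ae_of_all _ fun x => ?_)
  simp [mul_comm]

lemma LocallyIntegrable.re {v : ℂ → ℂ} (hv : LocallyIntegrable v volume) :
    LocallyIntegrable (fun x => (v x).re) volume := fun x => by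
  obtain ⟨s, hs, h⟩ := hv x
  exact ⟨s, hs, h.re⟩

lemma LocallyIntegrable.im {v : ℂ → ℂ} (hv : LocallyIntegrable v volume) :
    LocallyIntegrable (fun x => (v x).im) volume := fun x => by
  obtain ⟨s, hs, h⟩ := hv x
  exact ⟨s, hs, h.im⟩

lemma integrable_inner_of_compactSupport {v F : ℂ → ℂ} (hv : LocallyIntegrable v volume)
    (hF : Continuous F) (hs : HasCompactSupport F) : Integrable (fun x => inner ℝ (v x) (F x)) := by
  simp only [inner_eq]
  exact (integrable_mul_of_compactSupport (LocallyIntegrable.re hv) (by fun_prop)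
      (hs.comp_left (g := Complex.re) rfl)).add
    (integrable_mul_of_compactSupport (LocallyIntegrable.im hv) (by fun_prop)
      (hs.comp_left (g := Complex.im) rfl))

lemma IsWeakGrad.integrable_field {f : ℂ → ℝ} {v F : ℂ → ℂ} (hf : IsWeakGrad f v)
    (hF : ContDiff ℝ ∞ F) (hs : HasCompactSupport F) :
    Integrable (fun x => f x * dvg F x + inner ℝ (v x) (F x)) :=
  (integrable_mul_of_compactSupport hf.locallyIntegrable (continuous_dvg hF)
    (hasCompactSupport_dvg hs)).add
    (integrable_inner_of_compactSupport hf.locallyIntegrable_grad hF.continuous hs)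

/-- The weak gradient tested with a smooth compactly supported vector field. -/
lemma IsWeakGrad.integral_field {f : ℂ → ℝ} {v F : ℂ → ℂ} (hf : IsWeakGrad f v)
    (hF : ContDiff ℝ ∞ F) (hs : HasCompactSupport F) :
    ∫ x, (f x * dvg F x + inner ℝ (v x) (F x)) = 0 := by
  have hre : ContDiff ℝ ∞ (fun x => (F x).re) := Complex.reCLM.contDiff.comp hF
  have him : ContDiff ℝ ∞ (fun x => (F x).im) := Complex.imCLM.contDiff.comp hF
  have hsre : HasCompactSupport (fun x => (F x).re) := hs.comp_left (g := Complex.re) rfl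
  have hsim : HasCompactSupport (fun x => (F x).im) := hs.comp_left (g := Complex.im) rfl
  have dF : ∀ x, DifferentiableAt ℝ F x := fun x => hF.differentiable (by simp) x
  have e1 : ∀ x e, fderiv ℝ (fun x => (F x).re) x e = (fderiv ℝ F x e).re := fun x e => by
    have := (Complex.reCLM.hasFDerivAt.comp x (dF x).hasFDerivAt).fderiv
    simp only [Function.comp_def, Complex.reCLM_apply] at this
    rw [this]; simp
  have e2 : ∀ x e, fderiv ℝ (fun x => (F x).im) x e = (fderiv ℝ F x e).im := fun x e => by
    have := (Complex.imCLM.hasFDerivAt.comp x (dF x).hasFDerivAt).fderiv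
    simp only [Function.comp_def, Complex.imCLM_apply] at this
    rw [this]; simp
  have h1 := hf.integral_eq _ hre hsre 1
  have h2 := hf.integral_eq _ him hsim Complex.I
  have c1 : ∀ e, Continuous (fun x => fderiv ℝ F x e) := fun e =>
    (hF.continuous_fderiv (by simp)).clm_apply continuous_const
  have s1 : ∀ e, HasCompactSupport (fun x => fderiv ℝ F x e) := fun e =>
    (hs.fderiv ℝ).comp_left (g := fun L : ℂ →L[ℝ] ℂ => L e) (by simp)
  have i1 : Integrable (fun x => f x * (fderiv ℝ F x 1).re) :=
    integrable_mul_of_compactSupport hf.locallyIntegrable (Complex.continuous_re.comp (c1 1))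
      ((s1 1).comp_left (g := Complex.re) rfl)
  have i2 : Integrable (fun x => f x * (fderiv ℝ F x Complex.I).im) :=
    integrable_mul_of_compactSupport hf.locallyIntegrable (Complex.continuous_im.comp (c1 _))
      ((s1 _).comp_left (g := Complex.im) rfl)
  have i3 : Integrable (fun x => (v x).re * (F x).re) :=
    integrable_mul_of_compactSupport (LocallyIntegrable.re hf.locallyIntegrable_grad)
      (Complex.continuous_re.comp hF.continuous) hsre
  have i4 : Integrable (fun x => (v x).im * (F x).im) :=
    integrable_mul_of_compactSupport (LocallyIntegrable.im hf.locallyIntegrable_grad)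
      (Complex.continuous_im.comp hF.continuous) hsim
  simp only [e1, e2, inner_eq, Complex.one_re, Complex.one_im, Complex.I_re, Complex.I_im,
    mul_one, mul_zero, add_zero, zero_add] at h1 h2
  simp only [dvg, inner_eq, mul_add]
  have a1 := integral_add (i1.add i2) (i3.add i4)
  have a2 := integral_add i1 i2
  have a3 := integral_add i3 i4
  simp only [Pi.add_apply] at a1 a2 a3
  linarith

lemma integrable_mul_continuous_on_ball {f a : ℂ → ℝ} (hf : LocallyIntegrable f volume)
    (ha : Continuous a) (c : ℂ) (r : ℝ) : IntegrableOn (fun x => f x * a x) (Metric.ball c r) := by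
  have := (hf.integrableOn_isCompact (isCompact_closedBall c r)).continuousOn_mul
    (g' := f) (g := a) ha.continuousOn (isCompact_closedBall c r)
  refine (this.mono_set Metric.ball_subset_closedBall).congr_fun (fun x _ => ?_)
    Metric.isOpen_ball.measurableSet
  simp [mul_comm]

lemma integrable_inner_continuous_on_ball {v F : ℂ → ℂ} (hv : LocallyIntegrable v volume)
    (hF : Continuous F) (c : ℂ) (r : ℝ) :
    IntegrableOn (fun x => inner ℝ (v x) (F x)) (Metric.ball c r) := by
  simp only [inner_eq]
  exact (integrable_mul_continuous_on_ball (LocallyIntegrable.re hv) (by fun_prop) c r).add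
    (integrable_mul_continuous_on_ball (LocallyIntegrable.im hv) (by fun_prop) c r)

lemma IsWeakGrad.integrableOn_field {f : ℂ → ℝ} {v F : ℂ → ℂ} (hf : IsWeakGrad f v)
    (hF : ContDiff ℝ ∞ F) (c : ℂ) (r : ℝ) :
    IntegrableOn (fun x => f x * dvg F x + inner ℝ (v x) (F x)) (Metric.ball c r) :=
  (integrable_mul_continuous_on_ball hf.locallyIntegrable (continuous_dvg hF) c r).add
    (integrable_inner_continuous_on_ball hf.locallyIntegrable_grad hF.continuous c r)

/-! ### Gauss–Green on a disc -/

lemma hasFDerivAt_radial {k : ℝ → ℝ} {k' : ℝ} {c x : ℂ} (hk : HasDerivAt k k' (‖x - c‖ ^ 2)) :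
    HasFDerivAt (fun y => k (‖y - c‖ ^ 2)) (k' • (2 • innerSL ℝ (x - c))) x := by
  have h1 : HasFDerivAt (fun y : ℂ => ‖y - c‖ ^ 2) (2 • innerSL ℝ (x - c)) x := by
    have := (hasStrictFDerivAt_norm_sq (x - c)).hasFDerivAt.comp x ((hasFDerivAt_id x).sub_const c)
    simpa [Function.comp_def] using this
  exact hk.comp_hasFDerivAt x h1

lemma fderiv_radial {k : ℝ → ℝ} {k' : ℝ} {c x : ℂ} (hk : HasDerivAt k k' (‖x - c‖ ^ 2)) (y : ℂ) :
    fderiv ℝ (fun y => k (‖y - c‖ ^ 2)) x y = 2 * k' * inner ℝ (x - c) y := by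
  rw [(hasFDerivAt_radial hk).fderiv]
  simp; ring

lemma contDiff_normSq_sub (c : ℂ) : ContDiff ℝ ∞ (fun y : ℂ => ‖y - c‖ ^ 2) :=
  (contDiff_id.sub contDiff_const).norm_sq ℝ

/-- At such points the global minimum 0 or maximum 1 is attained, which settles the endpoints 0 and
1 together with the flat parts. -/
lemma deriv_smoothTransition_eq_zero {t : ℝ} (ht : t ≤ 0 ∨ 1 ≤ t) :
    deriv Real.smoothTransition t = 0 := by
  rcases ht with ht | ht
  · refine IsLocalMin.deriv_eq_zero (Eventually.of_forall fun y => ?_)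
    rw [Real.smoothTransition.zero_of_nonpos ht]
    exact Real.smoothTransition.nonneg y
  · refine IsLocalMax.deriv_eq_zero (Eventually.of_forall fun y => ?_)
    rw [Real.smoothTransition.one_of_one_le ht]
    exact Real.smoothTransition.le_one y

lemma hasDerivAt_smoothTransition (t : ℝ) :
    HasDerivAt Real.smoothTransition (deriv Real.smoothTransition t) t :=
  ((Real.smoothTransition.contDiff (n := 1)).differentiable (by simp) t).hasDerivAt

lemma exists_bound_deriv_smoothTransition :
    ∃ S, 0 < S ∧ ∀ t, |deriv Real.smoothTransition t| ≤ S := by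
  have hc : Continuous (deriv Real.smoothTransition) :=
    (Real.smoothTransition.contDiff (n := 1)).continuous_deriv (by simp)
  obtain ⟨S, hS⟩ := (isCompact_Icc (a := (0 : ℝ)) (b := 1)).exists_bound_of_continuousOn
    hc.continuousOn
  refine ⟨max S 1, by positivity, fun t => ?_⟩
  by_cases ht : t ∈ Set.Icc (0 : ℝ) 1
  · exact (hS t ht).trans (le_max_left _ _)
  · rw [deriv_smoothTransition_eq_zero]
    · simp
    · by_contra! h
      exact ht ⟨h.1.le, h.2.le⟩

/-- The radial component is Lipschitz on the closed disc and vanishes on the circle, so it is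
controlled by the distance to the radial projection onto the circle. The distance is expressed
through r² - |x - c|² because the cut-offs used below are functions of that quantity. -/
lemma exists_inner_le_of_tangent {F : ℂ → ℂ} {c : ℂ} {r : ℝ} (hF : ContDiff ℝ ∞ F) (hr : 0 < r)
    (hT : ∀ x, ‖x - c‖ = r → inner ℝ (x - c) (F x) = 0) :
    ∃ C, 0 ≤ C ∧ ∀ x ∈ Metric.ball c r, |inner ℝ (x - c) (F x)| ≤ C * (r ^ 2 - ‖x - c‖ ^ 2) := by
  have hG : ContDiff ℝ ∞ (fun x => inner ℝ (x - c) (F x)) :=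
    (contDiff_id.sub contDiff_const).inner ℝ hF
  obtain ⟨L, hL⟩ := (isCompact_closedBall c r).exists_bound_of_continuousOn
    (hG.continuous_fderiv (by simp)).continuousOn
  have hL0 : 0 ≤ L := (norm_nonneg _).trans (hL c (Metric.mem_closedBall_self hr.le))
  refine ⟨L / r, by positivity, fun x hx => ?_⟩
  rw [Metric.mem_ball, dist_eq_norm] at hx
  rcases eq_or_ne x c with rfl | hxc
  · simp; positivity
  have hpos : 0 < ‖x - c‖ := norm_pos_iff.2 (sub_ne_zero.2 hxc)
  set y : ℂ := c + (r / ‖x - c‖) • (x - c) with hy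
  have hyc : ‖y - c‖ = r := by
    rw [hy, add_sub_cancel_left, norm_smul, Real.norm_of_nonneg (by positivity)]
    field_simp
  have hxy : ‖x - y‖ = r - ‖x - c‖ := by
    have : x - y = (1 - r / ‖x - c‖) • (x - c) := by
      rw [hy, sub_smul, one_smul]; ring
    rw [this, norm_smul, Real.norm_of_nonpos]
    · field_simp; ring
    · rw [sub_nonpos, le_div_iff₀ hpos]; linarith
  have key := (convex_closedBall c r).norm_image_sub_le_of_norm_fderiv_le (𝕜 := ℝ)
    (f := fun x => inner ℝ (x - c) (F x)) (C := L) (x := y) (y := x)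
    (fun z _ => hG.differentiable (by simp) z) hL
    (by rw [Metric.mem_closedBall, dist_eq_norm, hyc])
    (by rw [Metric.mem_closedBall, dist_eq_norm]; exact hx.le)
  rw [hT y hyc, sub_zero, Real.norm_eq_abs, hxy] at key
  refine key.trans ?_
  have : L / r * (r ^ 2 - ‖x - c‖ ^ 2) = L * (r - ‖x - c‖) * ((r + ‖x - c‖) / r) := by
    field_simp; ring
  rw [this]
  refine le_mul_of_one_le_right (mul_nonneg hL0 (by linarith)) ?_
  rw [le_div_iff₀ hr]; linarith

/-- The Gauss–Green formula on a disc for a field tangent to its boundary. -/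
lemma IsWeakGrad.integral_ball_eq_zero_of_tangent {f : ℂ → ℝ} {v F : ℂ → ℂ} {c : ℂ} {r : ℝ}
    (hf : IsWeakGrad f v) (hF : ContDiff ℝ ∞ F) (hr : 0 < r)
    (hT : ∀ x, ‖x - c‖ = r → inner ℝ (x - c) (F x) = 0) :
    ∫ x in Metric.ball c r, (f x * dvg F x + inner ℝ (v x) (F x)) = 0 := by
  obtain ⟨C, hC0, hC⟩ := exists_inner_le_of_tangent hF hr hT
  obtain ⟨S, hS0, hS⟩ := exists_bound_deriv_smoothTransition
  -- The cut-off vanishes off the disc and equals 1 once n(r² - |x - c|²) ≥ 1. Its gradient has size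
  -- n, but only on the shell where that product is below 1. There tangency gains a factor 1/n, so
  -- the derivative along F stays bounded (`hdb`) and dominated convergence removes it.
  set k : ℕ → ℝ → ℝ := fun n t => Real.smoothTransition (n * (r ^ 2 - t)) with hk
  have hkd : ∀ n t, HasDerivAt (k n) (-(n * deriv Real.smoothTransition (n * (r ^ 2 - t)))) t := by
    intro n t
    have h1 : HasDerivAt (fun t : ℝ => (n : ℝ) * (r ^ 2 - t)) (-n) t := by
      simpa using ((hasDerivAt_id t).const_sub (r ^ 2)).const_mul (n : ℝ)
    have := (hasDerivAt_smoothTransition _).comp t h1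
    simpa [mul_comm, Function.comp_def] using this
  set η : ℕ → ℂ → ℝ := fun n x => k n (‖x - c‖ ^ 2) with hη
  have hηs : ∀ n, ContDiff ℝ ∞ (η n) := fun n =>
    Real.smoothTransition.contDiff.comp (contDiff_const.mul
      (contDiff_const.sub (contDiff_normSq_sub c)))
  have hη0 : ∀ n x, x ∉ Metric.ball c r → η n x = 0 := by
    intro n x hx
    rw [Metric.mem_ball, dist_eq_norm, not_lt] at hx
    refine Real.smoothTransition.zero_of_nonpos ?_
    exact mul_nonpos_of_nonneg_of_nonpos (Nat.cast_nonneg n)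
      (sub_nonpos.2 (pow_le_pow_left₀ hr.le hx 2))
  have hηc : ∀ n, HasCompactSupport (η n) := fun n =>
    HasCompactSupport.intro (isCompact_closedBall c r) fun x hx =>
      hη0 n x fun h => hx (Metric.ball_subset_closedBall h)
  have hd : ∀ n x, fderiv ℝ (η n) x (F x) =
      -2 * (n * deriv Real.smoothTransition (n * (r ^ 2 - ‖x - c‖ ^ 2))) *
        inner ℝ (x - c) (F x) := by
    intro n x
    rw [hη, fderiv_radial (hkd n _)]; ring
  have hd0 : ∀ (n : ℕ) (x : ℂ), (x ∉ Metric.ball c r ∨ 1 ≤ n * (r ^ 2 - ‖x - c‖ ^ 2)) →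
      fderiv ℝ (η n) x (F x) = 0 := by
    intro n x hx
    rw [hd, deriv_smoothTransition_eq_zero]
    · simp
    · refine hx.imp (fun hx => ?_) id
      rw [Metric.mem_ball, dist_eq_norm, not_lt] at hx
      exact mul_nonpos_of_nonneg_of_nonpos (Nat.cast_nonneg n)
        (sub_nonpos.2 (pow_le_pow_left₀ hr.le hx 2))
  have hdb : ∀ n, ∀ x ∈ Metric.ball c r, |fderiv ℝ (η n) x (F x)| ≤ 2 * S * C := by
    intro n x hx
    by_cases h1 : 1 ≤ n * (r ^ 2 - ‖x - c‖ ^ 2)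
    · rw [hd0 n x (Or.inr h1)]; simp; positivity
    push Not at h1
    rw [hd, abs_mul, abs_mul, abs_mul, abs_neg, Nat.abs_cast, Nat.abs_ofNat]
    have hx' : 0 ≤ r ^ 2 - ‖x - c‖ ^ 2 := by
      rw [Metric.mem_ball, dist_eq_norm] at hx
      nlinarith [norm_nonneg (x - c)]
    calc 2 * (n * |deriv Real.smoothTransition (n * (r ^ 2 - ‖x - c‖ ^ 2))|) *
          |inner ℝ (x - c) (F x)|
        ≤ 2 * (n * S) * (C * (r ^ 2 - ‖x - c‖ ^ 2)) := by
          gcongr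
          · exact hS _
          · exact hC x hx
      _ = 2 * S * C * (n * (r ^ 2 - ‖x - c‖ ^ 2)) := by ring
      _ ≤ 2 * S * C * 1 := by gcongr
      _ = _ := by ring
  have hpt : ∀ n x, f x * dvg (fun y => η n y • F y) x + inner ℝ (v x) (η n x • F x) =
      η n x * (f x * dvg F x + inner ℝ (v x) (F x)) + f x * fderiv ℝ (η n) x (F x) := by
    intro n x
    rw [dvg_smul ((hηs n).differentiable (by simp) x) (hF.differentiable (by simp) x),
      real_inner_smul_right]
    ring
  have hzero : ∀ n, ∫ x, (f x * dvg (fun y => η n y • F y) x +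
      inner ℝ (v x) (η n x • F x)) = 0 := fun n =>
    hf.integral_field ((hηs n).smul hF) ((hηc n).smul_right)
  have hball : MeasurableSet (Metric.ball c r) := Metric.isOpen_ball.measurableSet
  have hlim : Tendsto (fun n => ∫ x, (f x * dvg (fun y => η n y • F y) x +
      inner ℝ (v x) (η n x • F x))) atTop
      (𝓝 (∫ x, (Metric.ball c r).indicator
        (fun x => f x * dvg F x + inner ℝ (v x) (F x)) x)) := by
    refine tendsto_integral_of_dominated_convergence
      ((Metric.ball c r).indicator (fun x => |f x * dvg F x + inner ℝ (v x) (F x)| +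
        |f x| * (2 * S * C))) (fun n => ?_) ?_ (fun n => ?_) ?_
    · exact (hf.integrable_field ((hηs n).smul hF) ((hηc n).smul_right)).aestronglyMeasurable
    · rw [integrable_indicator_iff hball]
      refine (hf.integrableOn_field hF c r).abs.add (Integrable.mul_const ?_ _)
      exact ((hf.locallyIntegrable.integrableOn_isCompact (isCompact_closedBall c r)).mono_set
        Metric.ball_subset_closedBall).abs
    · refine ae_of_all _ fun x => ?_
      rw [hpt]
      by_cases hx : x ∈ Metric.ball c r
      · rw [Set.indicator_of_mem hx]
        refine (norm_add_le _ _).trans (add_le_add ?_ ?_)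
        · rw [norm_mul, Real.norm_eq_abs, Real.norm_eq_abs]
          refine mul_le_of_le_one_left (abs_nonneg _) ?_
          rw [abs_of_nonneg (Real.smoothTransition.nonneg _)]
          exact Real.smoothTransition.le_one _
        · rw [norm_mul, Real.norm_eq_abs, Real.norm_eq_abs]
          exact mul_le_mul_of_nonneg_left (hdb n x hx) (abs_nonneg _)
      · rw [Set.indicator_of_notMem hx, hη0 n x hx, hd0 n x (Or.inl hx)]
        simp
    · refine ae_of_all _ fun x => ?_
      by_cases hx : x ∈ Metric.ball c r
      · rw [Set.indicator_of_mem hx]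
        have hx' : 0 < r ^ 2 - ‖x - c‖ ^ 2 := by
          rw [Metric.mem_ball, dist_eq_norm] at hx
          nlinarith [norm_nonneg (x - c)]
        refine tendsto_const_nhds.congr' ?_
        have := (tendsto_natCast_atTop_atTop (R := ℝ)).atTop_mul_const hx'
        filter_upwards [this.eventually_ge_atTop 1] with n hn
        rw [hpt, hd0 n x (Or.inr hn)]
        have : η n x = 1 := Real.smoothTransition.one_of_one_le hn
        rw [this]; ring
      · rw [Set.indicator_of_notMem hx]
        refine tendsto_const_nhds.congr fun n => ?_
        rw [hpt, hη0 n x hx, hd0 n x (Or.inl hx)]; ring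
  rw [← integral_indicator hball]
  refine tendsto_nhds_unique hlim ?_
  simp only [hzero]
  exact tendsto_const_nhds

/-- Two smooth fields with the same normal component on a circle give the same flux. -/
lemma IsWeakGrad.integral_ball_congr {f : ℂ → ℝ} {v F H : ℂ → ℂ} {c : ℂ} {r : ℝ}
    (hf : IsWeakGrad f v) (hF : ContDiff ℝ ∞ F) (hH : ContDiff ℝ ∞ H) (hr : 0 < r)
    (hT : ∀ x, ‖x - c‖ = r → inner ℝ (x - c) (F x) = inner ℝ (x - c) (H x)) :
    ∫ x in Metric.ball c r, (f x * dvg F x + inner ℝ (v x) (F x)) =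
      ∫ x in Metric.ball c r, (f x * dvg H x + inner ℝ (v x) (H x)) := by
  have h := hf.integral_ball_eq_zero_of_tangent (F := fun x => F x - H x) (c := c) (hF.sub hH) hr
    (fun x hx => by rw [inner_sub_right, hT x hx, sub_self])
  rw [← sub_eq_zero, ← integral_sub (hf.integrableOn_field hF c r) (hf.integrableOn_field hH c r),
    ← h]
  congr 1; ext x
  rw [dvg_sub (hF.differentiable (by simp) x) (hH.differentiable (by simp) x), inner_sub_right]
  ring

/-! ### Smooth fields that agree with a pole near a circle -/

lemma contDiff_cutoff_mul {a b : ℝ} (ha : 0 < a) (hb : 0 < b) {q : ℝ → ℝ}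
    (hq : ∀ t, 0 < t → ContDiffAt ℝ ∞ q t) :
    ContDiff ℝ ∞ (fun t => Real.smoothTransition (a * t - b) * q t) := by
  rw [contDiff_iff_contDiffAt]
  intro t
  rcases lt_or_ge 0 t with ht | ht
  · exact (Real.smoothTransition.contDiffAt.comp t
      ((contDiffAt_const.mul contDiffAt_id).sub contDiffAt_const)).mul (hq t ht)
  · have : (fun t => Real.smoothTransition (a * t - b) * q t) =ᶠ[𝓝 t] fun _ => 0 := by
      -- The cut-off vanishes below b/a, hence on a neighbourhood of every t ≤ 0, where nothing is
      -- known about q.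
      have : t < b / a := ht.trans_lt (by positivity)
      filter_upwards [eventually_lt_nhds this] with s hs
      rw [lt_div_iff₀ ha] at hs
      rw [Real.smoothTransition.zero_of_nonpos (by linarith), zero_mul]
    exact contDiffAt_const.congr_of_eventuallyEq this

/-- Radial profile of `pointField`. -/
def pointProfile (r t : ℝ) : ℝ := Real.smoothTransition (4 / r ^ 2 * t - 2) * t⁻¹

lemma contDiff_pointProfile {r : ℝ} (hr : 0 < r) : ContDiff ℝ ∞ (pointProfile r) :=
  contDiff_cutoff_mul (by positivity) two_pos fun _ ht => contDiffAt_inv _ ht.ne'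

lemma pointProfile_eq_zero {r t : ℝ} (hr : 0 < r) (ht : t ≤ r ^ 2 / 2) : pointProfile r t = 0 := by
  rw [pointProfile, Real.smoothTransition.zero_of_nonpos, zero_mul]
  have : 4 / r ^ 2 * t ≤ 4 / r ^ 2 * (r ^ 2 / 2) := by gcongr
  have h2 : 4 / r ^ 2 * (r ^ 2 / 2) = 2 := by field_simp; norm_num
  linarith

lemma pointProfile_eq_inv {r t : ℝ} (hr : 0 < r) (ht : 3 / 4 * r ^ 2 ≤ t) :
    pointProfile r t = t⁻¹ := by
  rw [pointProfile, Real.smoothTransition.one_of_one_le, one_mul]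
  have : 4 / r ^ 2 * (3 / 4 * r ^ 2) ≤ 4 / r ^ 2 * t := by gcongr
  have h2 : 4 / r ^ 2 * (3 / 4 * r ^ 2) = 3 := by field_simp
  linarith

/-- A smooth field that agrees with `(x - c) / |x - c|²` for `|x - c| ≥ r`. -/
def pointField (c : ℂ) (r : ℝ) (x : ℂ) : ℂ := pointProfile r (‖x - c‖ ^ 2) • (x - c)

lemma contDiff_pointField (c : ℂ) {r : ℝ} (hr : 0 < r) : ContDiff ℝ ∞ (pointField c r) :=
  ((contDiff_pointProfile hr).comp (contDiff_normSq_sub c)).smul (contDiff_id.sub contDiff_const)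

lemma pointField_eq {c x : ℂ} {r : ℝ} (hr : 0 < r) (hx : r ≤ ‖x - c‖) :
    pointField c r x = (‖x - c‖ ^ 2)⁻¹ • (x - c) := by
  have := pow_le_pow_left₀ hr.le hx 2
  have := sq_nonneg r
  rw [pointField, pointProfile_eq_inv hr (by linarith)]

lemma inner_pointField {c x : ℂ} {r : ℝ} (hr : 0 < r) (hx : ‖x - c‖ = r) :
    inner ℝ (x - c) (pointField c r x) = 1 := by
  rw [pointField_eq hr hx.ge, real_inner_smul_right, real_inner_self_eq_norm_sq, hx]
  field_simp

lemma dvg_radial_profile {k : ℝ → ℝ} {k' : ℝ} {c x : ℂ} (hk : HasDerivAt k k' (‖x - c‖ ^ 2)) :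
    dvg (fun y => k (‖y - c‖ ^ 2) • (y - c)) x =
      2 * k (‖x - c‖ ^ 2) + 2 * k' * ‖x - c‖ ^ 2 := by
  rw [dvg_radial (hasFDerivAt_radial hk).differentiableAt, fderiv_radial hk,
    real_inner_self_eq_norm_sq]

lemma dvg_inv_radial {c x : ℂ} (hx : x ≠ c) :
    dvg (fun y => (‖y - c‖ ^ 2)⁻¹ • (y - c)) x = 0 := by
  have h0 : ‖x - c‖ ^ 2 ≠ 0 := by
    have := norm_ne_zero_iff.2 (sub_ne_zero.2 hx)
    positivity
  rw [dvg_radial_profile (hasDerivAt_inv h0)]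
  field_simp
  ring

/-- The profile is already 1/t from t = 3r²/4 on, so the field coincides with the divergence-free
pole in a neighbourhood of the circle, and the identity can be differentiated on the circle itself.
-/
lemma dvg_pointField {c x : ℂ} {r : ℝ} (hr : 0 < r) (hx : r ≤ ‖x - c‖) :
    dvg (pointField c r) x = 0 := by
  have hxc : x ≠ c := by
    rintro rfl
    simp at hx; linarith
  rw [← dvg_inv_radial hxc]
  apply dvg_congr
  have h1 : 3 / 4 * r ^ 2 < ‖x - c‖ ^ 2 := by
    have := pow_le_pow_left₀ hr.le hx 2
    have : 0 < r ^ 2 := by positivity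
    linarith
  have h2 : Continuous fun y : ℂ => ‖y - c‖ ^ 2 := by fun_prop
  filter_upwards [h2.continuousAt.eventually_const_lt h1] with y hy
  rw [pointField, pointProfile_eq_inv hr hy.le]

/-! ### Polar coordinates and traces on circles -/

lemma integrableOn_polar {q : ℂ → ℝ} {c : ℂ} {r : ℝ} (hq : IntegrableOn q (Metric.ball c r)) :
    IntegrableOn (fun p : ℝ × ℝ => p.1 * q (circleMap c p.1 p.2))
      (Set.Ioo 0 r ×ˢ Set.Ioo (-Real.pi) Real.pi) ∧
    ∫ x in Metric.ball c r, q x = ∫ p in Set.Ioo 0 r ×ˢ Set.Ioo (-Real.pi) Real.pi,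
      p.1 * q (circleMap c p.1 p.2) := by
  have hb : MeasurableSet (Metric.ball c r) := Metric.isOpen_ball.measurableSet
  set q1 : ℂ → ℝ := fun y => (Metric.ball c r).indicator q (c + y) with hq1
  have i1 : Integrable q1 := by
    have := (integrable_indicator_iff hb).2 hq
    exact this.comp_add_left c
  have e1 : ∫ x in Metric.ball c r, q x = ∫ y, q1 y := by
    rw [← integral_indicator hb, hq1, integral_add_left_eq_self]
  have hsub : Set.Ioo 0 r ×ˢ Set.Ioo (-Real.pi) Real.pi ⊆ polarCoord.target := by
    rintro ⟨s, θ⟩ ⟨hs, hθ⟩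
    exact ⟨hs.1, hθ⟩
  have hS : MeasurableSet (Set.Ioo 0 r ×ˢ Set.Ioo (-Real.pi) Real.pi) :=
    measurableSet_Ioo.prod measurableSet_Ioo
  have hcm : ∀ p : ℝ × ℝ, c + Complex.polarCoord.symm p = circleMap c p.1 p.2 := by
    intro p
    rw [Complex.polarCoord_symm_apply, circleMap, Complex.exp_mul_I]
    simp
  have hpt : ∀ p ∈ polarCoord.target, p.1 * q1 (Complex.polarCoord.symm p) =
      (Set.Ioo 0 r ×ˢ Set.Ioo (-Real.pi) Real.pi).indicator
        (fun p : ℝ × ℝ => p.1 * q (circleMap c p.1 p.2)) p := by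
    rintro p ⟨hp1, hp2⟩
    have hp1' : 0 < p.1 := hp1
    have hmem : circleMap c p.1 p.2 ∈ Metric.ball c r ↔ p.1 < r := by
      rw [Metric.mem_ball, dist_eq_norm, circleMap_sub_center, norm_circleMap_zero,
        abs_of_pos hp1']
    simp only [hq1, hcm]
    by_cases h : p.1 < r
    · rw [Set.indicator_of_mem (hmem.2 h), Set.indicator_of_mem]
      exact ⟨⟨hp1, h⟩, hp2⟩
    · rw [Set.indicator_of_notMem (fun h' => h (hmem.1 h')), Set.indicator_of_notMem, mul_zero]
      exact fun h' => h h'.1.2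
  have hT : MeasurableSet polarCoord.target := polarCoord.open_target.measurableSet
  -- Integrability is transferred separately: Fubini in the angle needs it when the trace is defined
  -- by a radial integral.
  constructor
  · have i2 : Integrable (fun p : ℝ × ℝ => q1 (Complex.measurableEquivRealProd.symm p)) :=
      (Complex.volume_preserving_equiv_real_prod.symm).integrable_comp_emb
        Complex.measurableEquivRealProd.symm.measurableEmbedding |>.2 i1
    have i3 := (integrableOn_image_iff_integrableOn_abs_det_fderiv_smul volume hT
      (fun p _ => (hasFDerivAt_polarCoord_symm p).hasFDerivWithinAt) polarCoord.symm.injOn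
      (fun p : ℝ × ℝ => q1 (Complex.measurableEquivRealProd.symm p))).1 i2.integrableOn
    have i4 : IntegrableOn ((Set.Ioo 0 r ×ˢ Set.Ioo (-Real.pi) Real.pi).indicator
        (fun p : ℝ × ℝ => p.1 * q (circleMap c p.1 p.2))) polarCoord.target := by
      refine i3.congr_fun (fun p hp => ?_) hT
      simp only [det_fderivPolarCoordSymm, Complex.measurableEquivRealProd_symm_polarCoord_symm_apply,
        smul_eq_mul]
      rw [← hpt p hp, abs_of_pos hp.1]
    rw [← integrable_indicator_iff hT, Set.indicator_indicator, Set.inter_eq_right.2 hsub,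
      integrable_indicator_iff hS] at i4
    exact i4
  · rw [e1, ← Complex.integral_comp_polarCoord_symm]
    simp only [smul_eq_mul]
    rw [setIntegral_congr_fun hT hpt, setIntegral_indicator hS, Set.inter_eq_right.2 hsub]

lemma fderiv_eq_zero_of_ray {b : ℂ → ℝ} {x d : ℂ} (hb : DifferentiableAt ℝ b x)
    (h : ∀ᶠ t : ℝ in 𝓝 0, b (x + t • d) = b x) : fderiv ℝ b x d = 0 := by
  have h1 : HasDerivAt (fun t : ℝ => x + t • d) d 0 := by
    simpa using ((hasDerivAt_id (0 : ℝ)).smul_const d).const_add x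
  have hb' : HasFDerivAt b (fderiv ℝ b x) (x + (0 : ℝ) • d) := by simpa using hb.hasFDerivAt
  have h2 := hb'.comp_hasDerivAt (0 : ℝ) h1
  have h3 : HasDerivAt (b ∘ fun t : ℝ => x + t • d) 0 0 :=
    (hasDerivAt_const (0 : ℝ) (b x)).congr_of_eventuallyEq h
  exact h2.unique h3

/-- Smooth fields that are a given function times `pointField`, constant along rays. -/
lemma exists_ray_field {Φ : ℂ → ℝ} (hΦ : ContDiff ℝ ∞ Φ) (c : ℂ) {r : ℝ} (hr : 0 < r) :
    ∃ Z : ℂ → ℂ, ContDiff ℝ ∞ Z ∧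
      (∀ x, Z x = Φ (c + (r / ‖x - c‖) • (x - c)) • pointField c r x) ∧
      ∀ x, dvg Z x = Φ (c + (r / ‖x - c‖) • (x - c)) * dvg (pointField c r) x := by
  -- A smooth function of the squared distance equal to 1/|x - c| as soon as |x - c|² ≥ r²/2. Below
  -- that threshold `pointField` vanishes, so `b` may be any smooth function there.
  set ρ : ℝ → ℝ := fun t => Real.smoothTransition (4 / r ^ 2 * t - 1) * (√t)⁻¹ with hρ
  have hρs : ContDiff ℝ ∞ ρ := contDiff_cutoff_mul (by positivity) one_pos fun t ht =>
    (Real.contDiffAt_sqrt ht.ne').inv (Real.sqrt_ne_zero'.2 ht)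
  have hρ1 : ∀ x : ℂ, r ^ 2 / 2 ≤ ‖x - c‖ ^ 2 → ρ (‖x - c‖ ^ 2) = ‖x - c‖⁻¹ := by
    intro x hx
    have : 4 / r ^ 2 * (r ^ 2 / 2) ≤ 4 / r ^ 2 * ‖x - c‖ ^ 2 := by gcongr
    have h2 : 4 / r ^ 2 * (r ^ 2 / 2) = 2 := by field_simp; norm_num
    rw [hρ]
    simp only
    rw [Real.smoothTransition.one_of_one_le (by linarith), one_mul, Real.sqrt_sq (norm_nonneg _)]
  set b : ℂ → ℝ := fun x => Φ (c + (r * ρ (‖x - c‖ ^ 2)) • (x - c)) with hb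
  have hbs : ContDiff ℝ ∞ b := hΦ.comp (contDiff_const.add
    ((contDiff_const.mul (hρs.comp (contDiff_normSq_sub c))).smul
      (contDiff_id.sub contDiff_const)))
  have hb1 : ∀ x : ℂ, r ^ 2 / 2 ≤ ‖x - c‖ ^ 2 → b x = Φ (c + (r / ‖x - c‖) • (x - c)) := by
    intro x hx
    simp only [hb, hρ1 x hx, div_eq_mul_inv]
  have hK0 : ∀ x : ℂ, ‖x - c‖ ^ 2 ≤ r ^ 2 / 2 → pointField c r x = 0 := by
    intro x hx
    rw [pointField, pointProfile_eq_zero hr hx, zero_smul]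
  have hnear : ∀ x : ℂ, Continuous fun y : ℂ => ‖y - c‖ ^ 2 := fun _ => by fun_prop
  refine ⟨fun x => b x • pointField c r x, hbs.smul (contDiff_pointField c hr), ?_, ?_⟩
  · intro x
    rcases le_total (r ^ 2 / 2) (‖x - c‖ ^ 2) with hx | hx
    · simp only [hb1 x hx]
    · simp only [hK0 x hx, smul_zero]
  · intro x
    rw [dvg_smul (hbs.differentiable (by simp) x)
      ((contDiff_pointField c hr).differentiable (by simp) x)]
    -- Beyond radius r/√2 the factor is constant along rays and the field is radial, so the extra
    -- term of the product rule vanishes. On that circle the field itself is zero. Inside, the field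
    -- vanishes on an open set and so does its divergence.
    rcases lt_trichotomy (r ^ 2 / 2) (‖x - c‖ ^ 2) with hx | hx | hx
    · have hx0 : ‖x - c‖ ≠ 0 := by
        intro h; rw [h] at hx; have : 0 < r ^ 2 := by positivity
        linarith
      have hd : fderiv ℝ b x (x - c) = 0 := by
        refine fderiv_eq_zero_of_ray (hbs.differentiable (by simp) x) ?_
        have c1 : Continuous fun t : ℝ => ‖x + t • (x - c) - c‖ ^ 2 := by fun_prop
        have h1 : ∀ᶠ t : ℝ in 𝓝 0, r ^ 2 / 2 < ‖x + t • (x - c) - c‖ ^ 2 := by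
          refine c1.continuousAt.eventually_const_lt ?_
          simpa using hx
        filter_upwards [h1, eventually_gt_nhds (show (-1 : ℝ) < 0 by norm_num)] with t ht ht'
        rw [hb1 _ ht.le, hb1 _ hx.le]
        have e : x + t • (x - c) - c = (1 + t) • (x - c) := by
          rw [add_smul, one_smul]; ring
        have hp : 0 < 1 + t := by linarith
        rw [e, norm_smul, Real.norm_of_nonneg hp.le, smul_smul]
        congr 3
        field_simp
      have : fderiv ℝ b x (pointField c r x) = 0 := by
        rw [pointField, map_smul, hd, smul_zero]
      rw [this, hb1 x hx.le, add_zero]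
    · rw [hK0 x hx.ge, map_zero, hb1 x hx.le, add_zero]
    · have h0 : dvg (pointField c r) x = 0 := by
        rw [← dvg_const 0 x]
        apply dvg_congr
        filter_upwards [(hnear x).continuousAt.eventually_lt_const hx] with y hy
        exact hK0 y hy.le
      rw [hK0 x hx.le, map_zero, h0]
      ring

/-- A function with a weak gradient has a trace on every circle. -/
lemma HasWeakGrad.hasCircleTrace {f : ℂ → ℝ} (hw : HasWeakGrad f) (c : ℂ) {r : ℝ} (hr : 0 < r) :
    HasCircleTrace f c r := by
  refine ⟨hw, ?_⟩
  have hf : IsWeakGrad f (weakGrad f) := by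
    rw [weakGrad, dif_pos hw]; exact hw.choose_spec
  set v := weakGrad f
  -- On the circle the field ψe has the same normal component as Φ · `pointField`, where Φ = ψ⟨x -
  -- c, e⟩ is extended constantly along rays. The flux density of the latter is H times a function
  -- of the angle alone, so the radial integral of H is the trace.
  set H : ℂ → ℝ := fun x => f x * dvg (pointField c r) x + inner ℝ (v x) (pointField c r x) with hH
  have iH : IntegrableOn H (Metric.ball c r) := hf.integrableOn_field (contDiff_pointField c hr) c r
  set T : ℂ → ℝ := fun ζ => ∫ s in Set.Ioo 0 r, s * H (c + (s / r) • (ζ - c)) with hT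
  have hTc : ∀ θ, T (circleMap c r θ) = ∫ s in Set.Ioo 0 r, s * H (circleMap c s θ) := by
    intro θ
    simp only [hT]
    refine setIntegral_congr_fun measurableSet_Ioo fun s _ => ?_
    congr 2
    rw [circleMap_sub_center, circleMap, circleMap]
    simp only [zero_add, Complex.real_smul, Complex.ofReal_div]
    have : (r : ℂ) ≠ 0 := by exact_mod_cast hr.ne'
    field_simp
  have hper : Function.Periodic (fun θ => T (circleMap c r θ)) (2 * Real.pi) :=
    (periodic_circleMap c r).comp T
  have hvol : (volume : Measure (ℝ × ℝ)).restrict (Set.Ioo 0 r ×ˢ Set.Ioo (-Real.pi) Real.pi) =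
      (volume.restrict (Set.Ioo 0 r)).prod (volume.restrict (Set.Ioo (-Real.pi) Real.pi)) := by
    rw [Measure.prod_restrict]; rfl
  have hpi : -Real.pi ≤ Real.pi := by linarith [Real.pi_pos]
  refine ⟨T, ?_, ?_⟩
  · have h1 := (integrableOn_polar iH).1
    rw [IntegrableOn, hvol] at h1
    have h2 := h1.integral_prod_right
    have h3 : IntervalIntegrable (fun θ => T (circleMap c r θ)) volume (-Real.pi) Real.pi := by
      rw [intervalIntegrable_iff_integrableOn_Ioo_of_le hpi]
      refine h2.congr (ae_of_all _ fun θ => ?_)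
      simp only [hTc]
    rw [CircleIntegrable]
    refine Function.Periodic.intervalIntegrable hper (by positivity) (t := -Real.pi) ?_ 0 _
    convert h3 using 1; ring
  · intro ψ hψ hψs e
    set Φ : ℂ → ℝ := fun y => ψ y * inner ℝ (y - c) e with hΦ
    have hΦs : ContDiff ℝ ∞ Φ :=
      hψ.mul ((contDiff_id.sub contDiff_const).inner ℝ contDiff_const)
    obtain ⟨Z, hZs, hZ, hdZ⟩ := exists_ray_field hΦs c hr
    have hconst : ContDiff ℝ ∞ (fun x => ψ x • e) := hψ.smul contDiff_const
    have key := hf.integral_ball_congr hconst hZs hr (c := c) (fun x hx => by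
      rw [hZ, real_inner_smul_right, real_inner_smul_right, inner_pointField hr hx, hx,
        div_self hr.ne', one_smul, hΦ]
      simp)
    have e1 : ∀ x, dvg (fun x => ψ x • e) x = fderiv ℝ ψ x e := by
      intro x
      rw [dvg_smul (hψ.differentiable (by simp) x) (by fun_prop), dvg_const]
      ring
    simp only [e1, real_inner_smul_right] at key
    have e2 : ∀ x, f x * dvg Z x + inner ℝ (v x) (Z x) =
        H x * Φ (c + (r / ‖x - c‖) • (x - c)) := by
      intro x
      rw [hZ, hdZ, real_inner_smul_right, hH]; ring
    have iZ := hf.integrableOn_field hZs c r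
    simp only [e2] at key iZ
    obtain ⟨j1, j2⟩ := integrableOn_polar iZ
    have e3 : ∀ s ∈ Set.Ioo 0 r, ∀ θ, c + (r / ‖circleMap c s θ - c‖) • (circleMap c s θ - c) =
        circleMap c r θ := by
      intro s hs θ
      rw [circleMap_sub_center, norm_circleMap_zero, abs_of_pos hs.1, circleMap, circleMap]
      simp only [zero_add, Complex.real_smul, Complex.ofReal_div]
      have : (s : ℂ) ≠ 0 := by exact_mod_cast hs.1.ne'
      field_simp
    calc ∫ x in Metric.ball c r, (f x * fderiv ℝ ψ x e + inner ℝ (v x) e * ψ x)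
        = ∫ x in Metric.ball c r, (f x * fderiv ℝ ψ x e + ψ x * inner ℝ (v x) e) := by
          simp only [mul_comm]
      _ = _ := key
      _ = _ := j2
      _ = ∫ θ in Set.Ioo (-Real.pi) Real.pi, ∫ s in Set.Ioo 0 r,
            s * (H (circleMap c s θ) *
              Φ (c + (r / ‖circleMap c s θ - c‖) • (circleMap c s θ - c))) := by
          rw [IntegrableOn, hvol] at j1
          rw [hvol, integral_prod_symm _ j1]
      _ = ∫ θ in Set.Ioo (-Real.pi) Real.pi, T (circleMap c r θ) * Φ (circleMap c r θ) := by
          refine setIntegral_congr_fun measurableSet_Ioo fun θ _ => ?_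
          rw [hTc, ← integral_mul_const]
          refine setIntegral_congr_fun measurableSet_Ioo fun s hs => ?_
          rw [e3 s hs]; ring
      _ = ∫ θ in (-Real.pi)..(-Real.pi + 2 * Real.pi),
            T (circleMap c r θ) * Φ (circleMap c r θ) := by
          rw [← integral_Ioc_eq_integral_Ioo, ← intervalIntegral.integral_of_le hpi]
          congr 1; ring
      _ = ∫ θ in (0 : ℝ)..(0 + 2 * Real.pi), T (circleMap c r θ) * Φ (circleMap c r θ) := by
          refine Function.Periodic.intervalIntegral_add_eq ?_ _ _
          exact (periodic_circleMap c r).comp fun ζ => T ζ * Φ ζ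
      _ = _ := by
          rw [zero_add]
          congr 1; ext θ
          have : inner ℝ (circleMap c r θ - c) e = inner ℝ (circleMap 0 1 θ) e * r := by
            rw [circleMap_sub_center]
            have : circleMap 0 r θ = r • circleMap 0 1 θ := by simp [circleMap]
            rw [this, real_inner_smul_left]; ring
          simp only [hΦ, this]; ring

/-! ### Uniqueness of weak gradients and circle integrals -/

lemma HasWeakGrad.isWeakGrad {f : ℂ → ℝ} (hw : HasWeakGrad f) : IsWeakGrad f (weakGrad f) := by
  rw [weakGrad, dif_pos hw]; exact hw.choose_spec

/-- Weak gradients are unique up to null sets. -/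
lemma IsWeakGrad.ae_eq {f : ℂ → ℝ} {v v' : ℂ → ℂ} (h : IsWeakGrad f v) (h' : IsWeakGrad f v') :
    v =ᵐ[volume] v' := by
  have key : ∀ e : ℂ, ∀ᵐ x, inner ℝ (v x) e - inner ℝ (v' x) e = 0 := by
    intro e
    have hl : ∀ {w : ℂ → ℂ}, LocallyIntegrable w volume →
        LocallyIntegrable (fun x => inner ℝ (w x) e) volume := by
      intro w hw x
      obtain ⟨s, hs, hi⟩ := hw x
      exact ⟨s, hs, hi.inner_const e⟩
    refine ae_eq_zero_of_integral_contDiff_smul_eq_zero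
      ((hl h.locallyIntegrable_grad).sub (hl h'.locallyIntegrable_grad)) fun ψ hψ hψs => ?_
    have h1 := h.integral_eq ψ hψ hψs e
    rw [h'.integral_eq ψ hψ hψs e] at h1
    have i1 := integrable_mul_of_compactSupport (hl h.locallyIntegrable_grad) hψ.continuous hψs
    have i2 := integrable_mul_of_compactSupport (hl h'.locallyIntegrable_grad) hψ.continuous hψs
    have := integral_sub i1 i2
    calc ∫ x, ψ x • (inner ℝ (v x) e - inner ℝ (v' x) e)
        = ∫ x, (inner ℝ (v x) e * ψ x - inner ℝ (v' x) e * ψ x) := by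
          congr 1; ext x; simp only [smul_eq_mul]; ring
      _ = 0 := by rw [this]; linarith
  filter_upwards [key 1, key Complex.I] with x h1 h2
  simp only [inner_eq, Complex.one_re, Complex.one_im, Complex.I_re, Complex.I_im] at h1 h2
  apply Complex.ext <;> linarith

lemma IsWeakGrad.weakGrad_ae_eq {f : ℂ → ℝ} {v : ℂ → ℂ} (h : IsWeakGrad f v) :
    weakGrad f =ᵐ[volume] v :=
  HasWeakGrad.isWeakGrad ⟨v, h⟩ |>.ae_eq h

/-- The integral `∮ f dθ` over a circle, as a volume integral. -/
def circleMass (f : ℂ → ℝ) (v : ℂ → ℂ) (c : ℂ) (r : ℝ) : ℝ :=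
  (r ^ 2)⁻¹ * ∫ x in Metric.ball c r, (2 * f x + inner ℝ (v x) (x - c))

lemma circleMass_congr_grad {f : ℂ → ℝ} {v v' : ℂ → ℂ} (h : v =ᵐ[volume] v') (c : ℂ) (r : ℝ) :
    circleMass f v c r = circleMass f v' c r := by
  unfold circleMass
  congr 1
  refine integral_congr_ae ?_
  filter_upwards [ae_restrict_of_ae h] with x hx
  rw [hx]

/-- The trace identity is tested with the two coordinates of x - c in their own directions, and the
results are added: inside, the divergence of x - c is 2, and on the circle ν₁² + ν₂² = 1. The bump
function, equal to 1 near the closed disc, only serves to make the coordinates compactly supported.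
-/
lemma IsCircleTrace.integral_eq {f T : ℂ → ℝ} {c : ℂ} {r : ℝ} (hw : HasWeakGrad f)
    (hT : IsCircleTrace f c r T) (hr : 0 < r) :
    ∫ θ in (0 : ℝ)..(2 * Real.pi), T (circleMap c r θ) = circleMass f (weakGrad f) c r := by
  have hf := hw.isWeakGrad
  obtain ⟨hi, hT⟩ := hT
  let b : ContDiffBump c := ⟨r + 1, r + 2, by linarith, by linarith⟩
  have hb1 : ∀ x, ‖x - c‖ ≤ r → (b : ℂ → ℝ) =ᶠ[𝓝 x] fun _ => 1 := by
    intro x hx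
    refine b.eventuallyEq_one_of_mem_ball ?_
    rw [Metric.mem_ball, dist_eq_norm]
    have : b.rIn = r + 1 := rfl
    linarith
  have gen : ∀ (L : ℂ →L[ℝ] ℝ) (e : ℂ), L e = 1 →
      ∫ x in Metric.ball c r, (f x + inner ℝ (weakGrad f x) e * L (x - c)) =
      ∫ θ in (0 : ℝ)..(2 * Real.pi), T (circleMap c r θ) *
        (L (circleMap 0 r θ) * inner ℝ (circleMap 0 1 θ) e * r) := by
    intro L e hLe
    have hs : ContDiff ℝ ∞ (fun x => b x * L (x - c)) :=
      b.contDiff.mul (L.contDiff.comp (contDiff_id.sub contDiff_const))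
    have := hT (fun x => b x * L (x - c)) hs b.hasCompactSupport.mul_right e
    calc _ = ∫ x in Metric.ball c r, (f x * fderiv ℝ (fun x => b x * L (x - c)) x e +
          inner ℝ (weakGrad f x) e * (b x * L (x - c))) := by
          refine setIntegral_congr_fun Metric.isOpen_ball.measurableSet fun x hx => ?_
          rw [Metric.mem_ball, dist_eq_norm] at hx
          have h1 : (fun x => b x * L (x - c)) =ᶠ[𝓝 x] fun x => L (x - c) := by
            filter_upwards [hb1 x hx.le] with y hy
            simp [hy]
          have h2 : HasFDerivAt (fun x => L (x - c)) L x := by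
            simpa using L.hasFDerivAt.sub_const (x := x) (L c)
          simp only [h1.fderiv_eq, h2.fderiv, hLe, (hb1 x hx.le).self_of_nhds]
          ring
      _ = _ := this
      _ = _ := by
          congr 1; ext θ
          have hx : ‖circleMap c r θ - c‖ ≤ r := by
            rw [circleMap_sub_center, norm_circleMap_zero, abs_of_pos hr]
          rw [(hb1 _ hx).self_of_nhds, circleMap_sub_center]
          ring
  have g1 := gen Complex.reCLM 1 (by simp)
  have g2 := gen Complex.imCLM Complex.I (by simp)
  have iT : IntervalIntegrable (fun θ => T (circleMap c r θ)) volume 0 (2 * Real.pi) := hi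
  have ci : ∀ (L : ℂ →L[ℝ] ℝ) (e : ℂ), IntervalIntegrable (fun θ => T (circleMap c r θ) *
        (L (circleMap 0 r θ) * inner ℝ (circleMap 0 1 θ) e * r)) volume 0 (2 * Real.pi) := by
    intro L e
    refine iT.mul_continuousOn (Continuous.continuousOn ?_)
    have := continuous_circleMap 0 r
    have := continuous_circleMap 0 1
    fun_prop
  have cb : ∀ (L : ℂ →L[ℝ] ℝ) (e : ℂ), IntegrableOn
      (fun x => f x + inner ℝ (weakGrad f x) e * L (x - c)) (Metric.ball c r) := by
    intro L e
    have h1 := integrable_mul_continuous_on_ball hf.locallyIntegrable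
      (continuous_const (y := (1 : ℝ))) c r
    have h2 := integrable_inner_continuous_on_ball hf.locallyIntegrable_grad
      (F := fun x => L (x - c) • e) (by fun_prop) c r
    refine (h1.add h2).congr (ae_of_all _ fun x => ?_)
    simp only [Pi.add_apply, real_inner_smul_right]; ring
  have sum1 := intervalIntegral.integral_add (ci Complex.reCLM 1) (ci Complex.imCLM Complex.I)
  have sum2 := integral_add (cb Complex.reCLM 1) (cb Complex.imCLM Complex.I)
  rw [← g1, ← g2, ← sum2] at sum1
  have lhs : ∫ θ in (0 : ℝ)..(2 * Real.pi), (T (circleMap c r θ) *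
        (Complex.reCLM (circleMap 0 r θ) * inner ℝ (circleMap 0 1 θ) 1 * r) +
      T (circleMap c r θ) *
        (Complex.imCLM (circleMap 0 r θ) * inner ℝ (circleMap 0 1 θ) Complex.I * r)) =
      r ^ 2 * ∫ θ in (0 : ℝ)..(2 * Real.pi), T (circleMap c r θ) := by
    rw [← intervalIntegral.integral_const_mul]
    congr 1; ext θ
    have h1 : circleMap 0 r θ = r • circleMap 0 1 θ := by simp [circleMap]
    have h2 : (circleMap 0 1 θ).re ^ 2 + (circleMap 0 1 θ).im ^ 2 = 1 := by
      have := Complex.sq_norm (circleMap 0 1 θ)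
      rw [norm_circleMap_zero, Complex.normSq_apply] at this
      simp only [abs_one] at this
      linarith
    simp only [h1, inner_eq, Complex.reCLM_apply, Complex.imCLM_apply, Complex.smul_re,
      Complex.smul_im, smul_eq_mul, Complex.one_re, Complex.one_im, Complex.I_re, Complex.I_im]
    linear_combination T (circleMap c r θ) * r ^ 2 * h2
  rw [lhs] at sum1
  rw [circleMass, eq_inv_mul_iff_mul_eq₀ (by positivity), sum1]
  refine setIntegral_congr_fun Metric.isOpen_ball.measurableSet fun x _ => ?_
  simp only [inner_eq, Complex.reCLM_apply, Complex.imCLM_apply, Complex.one_re, Complex.one_im,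
    Complex.I_re, Complex.I_im]
  ring

/-- On the circle d(conj ζ)/(conj ζ - conj c) = -i dθ. Any weak gradient may be used on the right,
so the choices made in `weakGrad` and `circleTrace` disappear from here on. -/
lemma IsWeakGrad.boundaryTerm_eq {f : ℂ → ℝ} {v : ℂ → ℂ} (hf : IsWeakGrad f v) (c : ℂ) {r : ℝ}
    (hr : 0 < r) : boundaryTerm f c r = -Complex.I * (circleMass f v c r : ℝ) := by
  have hw : HasWeakGrad f := ⟨v, hf⟩
  have hT := hw.hasCircleTrace c hr
  have hspec : IsCircleTrace f c r (circleTrace f c r) := by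
    rw [circleTrace, dif_pos hT]; exact hT.2.choose_spec
  rw [← circleMass_congr_grad hf.weakGrad_ae_eq, ← hspec.integral_eq hw hr, boundaryTerm,
    conjCircleIntegral, ← intervalIntegral.integral_ofReal, ← intervalIntegral.integral_const_mul]
  congr 1; ext θ
  have h0 : (starRingEnd ℂ) (circleMap 0 r θ) ≠ 0 := by
    rw [Ne, map_eq_zero]
    exact circleMap_ne_center hr.ne'
  rw [deriv_circleMap, ← map_sub, circleMap_sub_center, map_mul, Complex.conj_I]
  field_simp

/-! ### Fields on the whole plane -/

lemma one_add_normSq_pos (x : ℂ) : 0 < 1 + ‖x‖ ^ 2 := by positivity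

lemma g_eq (x : ℂ) : g x = 4 * ((1 + ‖x‖ ^ 2)⁻¹) ^ 2 := by rw [g]; field_simp

lemma g_pos (x : ℂ) : 0 < g x := by rw [g]; positivity

lemma continuous_g : Continuous g := by
  unfold g
  exact continuous_const.div (by fun_prop) fun x => by positivity

lemma integrable_g : Integrable g := by
  have := (integrable_rpow_neg_one_add_norm_sq (E := ℂ) (μ := volume) (r := 4)
    (by rw [Complex.finrank_real_complex]; norm_num)).const_mul 4
  refine this.congr (ae_of_all _ fun x => ?_)
  simp only [g]
  rw [show (-4 : ℝ) / 2 = -(2 : ℕ) by norm_num, Real.rpow_neg (by positivity), Real.rpow_natCast]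
  ring

/-- Functions and gradients with enough decay for integration by parts on the sphere. -/
structure Tame (f : ℂ → ℝ) (v : ℂ → ℂ) : Prop where
  isWeakGrad : IsWeakGrad f v
  sq_integrable : Integrable (fun x => f x ^ 2 * g x)
  grad_integrable : Integrable (fun x => ‖v x‖ * (1 + ‖x‖ ^ 2)⁻¹)

lemma Tame.integrable_mul_g {f : ℂ → ℝ} {v : ℂ → ℂ} (h : Tame f v) :
    Integrable (fun x => f x * g x) := by
  refine (h.sq_integrable.add integrable_g).mono'
    (h.isWeakGrad.locallyIntegrable.aestronglyMeasurable.mul continuous_g.aestronglyMeasurable)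
    (ae_of_all _ fun x => ?_)
  rw [Real.norm_eq_abs, abs_mul, abs_of_pos (g_pos x)]
  have : |f x| ≤ f x ^ 2 + 1 := by nlinarith [sq_abs (f x), sq_nonneg (|f x| - 1), abs_nonneg (f x)]
  calc |f x| * g x ≤ (f x ^ 2 + 1) * g x := by gcongr; exact (g_pos x).le
    _ = _ := by simp; ring

lemma Tame.integrable_inner {f : ℂ → ℝ} {v F : ℂ → ℂ} (h : Tame f v)
    (hF : AEStronglyMeasurable F) {C : ℝ} (hC : ∀ᵐ x, ‖F x‖ ≤ C * (1 + ‖x‖ ^ 2)⁻¹) :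
    Integrable (fun x => inner ℝ (v x) (F x)) := by
  refine (h.grad_integrable.const_mul C).mono'
    (h.isWeakGrad.locallyIntegrable_grad.aestronglyMeasurable.inner hF) ?_
  filter_upwards [hC] with x hx
  calc ‖inner ℝ (v x) (F x)‖ ≤ ‖v x‖ * ‖F x‖ := norm_inner_le_norm _ _
    _ ≤ ‖v x‖ * (C * (1 + ‖x‖ ^ 2)⁻¹) := by gcongr
    _ = _ := by ring

lemma tendsto_integral_tail {q : ℂ → ℝ} (hq : Integrable q) :
    Tendsto (fun n : ℕ => ∫ x in {x : ℂ | (n : ℝ) ≤ ‖x‖}, q x) atTop (𝓝 0) := by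
  have hm : ∀ n : ℕ, MeasurableSet {x : ℂ | (n : ℝ) ≤ ‖x‖} := fun n =>
    measurableSet_le measurable_const measurable_norm
  rw [show (fun n : ℕ => ∫ x in {x : ℂ | (n : ℝ) ≤ ‖x‖}, q x) =
    fun n : ℕ => ∫ x, {x : ℂ | (n : ℝ) ≤ ‖x‖}.indicator q x from
    funext fun n => (integral_indicator (hm n)).symm]
  have := tendsto_integral_of_dominated_convergence (μ := volume)
    (F := fun (n : ℕ) => {x : ℂ | (n : ℝ) ≤ ‖x‖}.indicator q) (f := fun _ => 0) (fun x => ‖q x‖)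
    (fun n => hq.aestronglyMeasurable.indicator (hm n)) hq.norm
    (fun n => ae_of_all _ fun x => norm_indicator_le_norm_self _ _)
    (ae_of_all _ fun x => ?_)
  · simpa using this
  · refine tendsto_const_nhds.congr' ?_
    filter_upwards [(tendsto_natCast_atTop_atTop (R := ℝ)).eventually_gt_atTop ‖x‖] with n hn
    rw [Set.indicator_of_notMem]
    simpa using hn

/-- Integration by parts on the whole plane against a decaying field. -/
lemma Tame.integral_field_eq_zero {f : ℂ → ℝ} {v F : ℂ → ℂ} (h : Tame f v)
    (hF : ContDiff ℝ ∞ F) {C : ℝ} (hC : ∀ x, ‖F x‖ ≤ C * (1 + ‖x‖ ^ 2)⁻¹)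
    (hC' : ∀ x, |dvg F x| ≤ C * g x) :
    Integrable (fun x => f x * dvg F x + inner ℝ (v x) (F x)) ∧
    ∫ x, (f x * dvg F x + inner ℝ (v x) (F x)) = 0 := by
  have hf := h.isWeakGrad
  have hC0 : 0 ≤ C := by
    have := (norm_nonneg _).trans (hC 0)
    simpa using this
  have i1 : Integrable (fun x => f x * dvg F x) := by
    refine (h.integrable_mul_g.norm.const_mul C).mono'
      (hf.locallyIntegrable.aestronglyMeasurable.mul (continuous_dvg hF).aestronglyMeasurable)
      (ae_of_all _ fun x => ?_)
    rw [norm_mul, norm_mul, Real.norm_eq_abs (g x), abs_of_pos (g_pos x), Real.norm_eq_abs (dvg F x)]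
    calc ‖f x‖ * |dvg F x| ≤ ‖f x‖ * (C * g x) := by gcongr; exact hC' x
      _ = _ := by ring
  have i2 : Integrable (fun x => inner ℝ (v x) (F x)) :=
    h.integrable_inner hF.continuous.aestronglyMeasurable (ae_of_all _ hC)
  have i12 := i1.add i2
  refine ⟨i12, ?_⟩
  obtain ⟨S, hS0, hS⟩ := exists_bound_deriv_smoothTransition
  -- The cut-off is 1 for |x| ≤ n and 0 for |x|² ≥ 2n².
  set k : ℕ → ℝ → ℝ := fun n t => Real.smoothTransition (2 - ((n : ℝ) ^ 2)⁻¹ * t) with hk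
  have hkd : ∀ n t, HasDerivAt (k n)
      (-(((n : ℝ) ^ 2)⁻¹ * deriv Real.smoothTransition (2 - ((n : ℝ) ^ 2)⁻¹ * t))) t := by
    intro n t
    have h1 : HasDerivAt (fun t : ℝ => 2 - ((n : ℝ) ^ 2)⁻¹ * t) (-((n : ℝ) ^ 2)⁻¹) t := by
      simpa using ((hasDerivAt_id t).const_mul ((n : ℝ) ^ 2)⁻¹).const_sub 2
    exact ((hasDerivAt_smoothTransition _).comp t h1).congr_deriv (by ring)
  set η : ℕ → ℂ → ℝ := fun n x => k n (‖x - 0‖ ^ 2) with hη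
  have hηs : ∀ n, ContDiff ℝ ∞ (η n) := fun n =>
    Real.smoothTransition.contDiff.comp (contDiff_const.sub (contDiff_const.mul
      (contDiff_normSq_sub 0)))
  have hηc : ∀ n : ℕ, 1 ≤ n → HasCompactSupport (η n) := by
    intro n hn
    have hn' : (0 : ℝ) < n := by exact_mod_cast hn
    refine HasCompactSupport.intro (isCompact_closedBall 0 (2 * n : ℝ)) fun x hx => ?_
    rw [Metric.mem_closedBall, dist_eq_norm, not_le] at hx
    refine Real.smoothTransition.zero_of_nonpos ?_
    rw [sub_nonpos, inv_mul_eq_div, le_div_iff₀ (by positivity)]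
    nlinarith [sq_nonneg (‖x - 0‖ - 2 * n)]
  have hd : ∀ n x, fderiv ℝ (η n) x (F x) =
      -2 * (((n : ℝ) ^ 2)⁻¹ * deriv Real.smoothTransition (2 - ((n : ℝ) ^ 2)⁻¹ * ‖x‖ ^ 2)) *
        inner ℝ x (F x) := by
    intro n x
    rw [hη, fderiv_radial (hkd n _)]; simp only [sub_zero]; ring
  set A : ℕ → Set ℂ := fun n => {x : ℂ | (n : ℝ) ≤ ‖x‖} with hA
  -- On the transition annulus the error is of order |f| n⁻³. It is split as the product of |f| n⁻²
  -- and n⁻¹ with a free weight lam: the first square is a tail of ∫ f² g, since g is comparable to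
  -- n⁻⁴ there, and the second has total mass bounded independently of n.
  have hdb : ∀ n : ℕ, 1 ≤ n → ∀ x lam, 0 < lam → ‖f x * fderiv ℝ (η n) x (F x)‖ ≤
      2 * S * C * (lam * (9 / 4) * (A n).indicator (fun x => f x ^ 2 * g x) x +
        lam⁻¹ * (Metric.closedBall (0 : ℂ) (2 * n)).indicator (fun _ => ((n : ℝ) ^ 2)⁻¹) x) := by
    intro n hn x lam hlam
    have hn' : (0 : ℝ) < n := by exact_mod_cast hn
    have hn1 : (1 : ℝ) ≤ n := by exact_mod_cast hn
    have hnn : 0 ≤ 2 * S * C * (lam * (9 / 4) * (A n).indicator (fun x => f x ^ 2 * g x) x +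
        lam⁻¹ * (Metric.closedBall (0 : ℂ) (2 * n)).indicator (fun _ => ((n : ℝ) ^ 2)⁻¹) x) := by
      have a1 : 0 ≤ (A n).indicator (fun x => f x ^ 2 * g x) x :=
        Set.indicator_nonneg (fun y _ => mul_nonneg (sq_nonneg _) (g_pos y).le) x
      have a2 : 0 ≤ (Metric.closedBall (0 : ℂ) (2 * n)).indicator (fun _ => ((n : ℝ) ^ 2)⁻¹) x :=
        Set.indicator_nonneg (fun y _ => by positivity) x
      positivity
    by_cases hx : 2 - ((n : ℝ) ^ 2)⁻¹ * ‖x‖ ^ 2 ≤ 0 ∨ 1 ≤ 2 - ((n : ℝ) ^ 2)⁻¹ * ‖x‖ ^ 2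
    · rw [hd, deriv_smoothTransition_eq_zero hx]
      simpa using hnn
    push Not at hx
    obtain ⟨hx1, hx2⟩ := hx
    have hx1' : ‖x‖ ^ 2 < 2 * (n : ℝ) ^ 2 := by
      have : ((n : ℝ) ^ 2)⁻¹ * ‖x‖ ^ 2 < 2 := by linarith
      rwa [inv_mul_lt_iff₀ (by positivity), mul_comm] at this
    have hx2' : (n : ℝ) ^ 2 < ‖x‖ ^ 2 := by
      have : 1 < ((n : ℝ) ^ 2)⁻¹ * ‖x‖ ^ 2 := by linarith
      rwa [lt_inv_mul_iff₀ (by positivity), mul_one] at this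
    have hnx : (n : ℝ) < ‖x‖ := lt_of_pow_lt_pow_left₀ 2 (norm_nonneg _) hx2'
    have m1 : x ∈ A n := hnx.le
    have m2 : x ∈ Metric.closedBall (0 : ℂ) (2 * n) := by
      rw [Metric.mem_closedBall, dist_zero_right]
      refine le_of_lt (lt_of_pow_lt_pow_left₀ 2 (by positivity) (hx1'.trans_le ?_))
      nlinarith [sq_nonneg (n : ℝ)]
    rw [Set.indicator_of_mem m1, Set.indicator_of_mem m2, hd]
    have hin : |inner ℝ x (F x)| ≤ C * (n : ℝ)⁻¹ := by
      refine (abs_real_inner_le_norm _ _).trans ?_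
      calc ‖x‖ * ‖F x‖ ≤ ‖x‖ * (C * (1 + ‖x‖ ^ 2)⁻¹) := by gcongr; exact hC x
        _ = C * (‖x‖ * (1 + ‖x‖ ^ 2)⁻¹) := by ring
        _ ≤ C * (n : ℝ)⁻¹ := by
          gcongr
          rw [← div_eq_mul_inv, div_le_iff₀ (by positivity), inv_mul_eq_div, le_div_iff₀ hn']
          nlinarith
    have hgx : ((n : ℝ) ^ 4)⁻¹ ≤ 9 / 4 * g x := by
      rw [g_eq, inv_pow, ← mul_assoc]
      have : (1 + ‖x‖ ^ 2) ^ 2 ≤ 9 * (n : ℝ) ^ 4 := by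
        have : 1 + ‖x‖ ^ 2 ≤ 3 * (n : ℝ) ^ 2 := by nlinarith
        calc (1 + ‖x‖ ^ 2) ^ 2 ≤ (3 * (n : ℝ) ^ 2) ^ 2 := by gcongr
          _ = _ := by ring
      rw [show (9 / 4 * 4 : ℝ) = 9 by norm_num, ← div_eq_mul_inv, le_div_iff₀ (by positivity),
        inv_mul_le_iff₀ (by positivity)]
      linarith
    calc ‖f x * (-2 * (((n : ℝ) ^ 2)⁻¹ *
            deriv Real.smoothTransition (2 - ((n : ℝ) ^ 2)⁻¹ * ‖x‖ ^ 2)) * inner ℝ x (F x))‖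
        = |f x| * (2 * (((n : ℝ) ^ 2)⁻¹ *
          |deriv Real.smoothTransition (2 - ((n : ℝ) ^ 2)⁻¹ * ‖x‖ ^ 2)|) * |inner ℝ x (F x)|) := by
          simp
      _ ≤ |f x| * (2 * (((n : ℝ) ^ 2)⁻¹ * S) * (C * (n : ℝ)⁻¹)) := by
          gcongr
          exact hS _
      _ = 2 * S * C * (|f x| * ((n : ℝ) ^ 3)⁻¹) := by ring
      _ ≤ 2 * S * C * (lam * (f x ^ 2 * ((n : ℝ) ^ 4)⁻¹) + lam⁻¹ * ((n : ℝ) ^ 2)⁻¹) := by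
          gcongr
          set a := |f x| * ((n : ℝ) ^ 2)⁻¹ with ha
          set b := (n : ℝ)⁻¹ with hb
          have e1 : |f x| * ((n : ℝ) ^ 3)⁻¹ = a * b := by rw [ha, hb]; field_simp
          have e2 : f x ^ 2 * ((n : ℝ) ^ 4)⁻¹ = a ^ 2 := by
            rw [ha, mul_pow, sq_abs]; field_simp
          have e3 : ((n : ℝ) ^ 2)⁻¹ = b ^ 2 := by rw [hb]; simp
          rw [e1, e2, e3]
          have : lam * a ^ 2 + lam⁻¹ * b ^ 2 - a * b =
              lam * (a - lam⁻¹ * b / 2) ^ 2 + 3 / 4 * lam⁻¹ * b ^ 2 := by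
            field_simp; ring
          have : 0 ≤ lam * (a - lam⁻¹ * b / 2) ^ 2 + 3 / 4 * lam⁻¹ * b ^ 2 := by positivity
          linarith
      _ ≤ 2 * S * C * (lam * (f x ^ 2 * (9 / 4 * g x)) + lam⁻¹ * ((n : ℝ) ^ 2)⁻¹) := by
          gcongr
      _ = _ := by ring
  have hpt : ∀ n x, f x * dvg (fun y => η n y • F y) x + inner ℝ (v x) (η n x • F x) =
      η n x * (f x * dvg F x + inner ℝ (v x) (F x)) + f x * fderiv ℝ (η n) x (F x) := by
    intro n x
    rw [dvg_smul ((hηs n).differentiable (by simp) x) (hF.differentiable (by simp) x),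
      real_inner_smul_right]
    ring
  have ηb : ∀ n x, ‖η n x‖ ≤ 1 := fun n x => by
    rw [Real.norm_of_nonneg (Real.smoothTransition.nonneg _)]
    exact Real.smoothTransition.le_one _
  have hmain : Tendsto (fun n => ∫ x, η n x * (f x * dvg F x + inner ℝ (v x) (F x))) atTop
      (𝓝 (∫ x, (f x * dvg F x + inner ℝ (v x) (F x)))) := by
    refine tendsto_integral_of_dominated_convergence
      (fun x => ‖f x * dvg F x + inner ℝ (v x) (F x)‖)
      (fun n => (hηs n).continuous.aestronglyMeasurable.mul i12.aestronglyMeasurable) i12.norm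
      (fun n => ae_of_all _ fun x => ?_) (ae_of_all _ fun x => ?_)
    · rw [norm_mul]
      exact mul_le_of_le_one_left (norm_nonneg _) (ηb n x)
    · refine tendsto_const_nhds.congr' ?_
      filter_upwards [(tendsto_natCast_atTop_atTop (R := ℝ)).eventually_gt_atTop ‖x‖,
        eventually_ge_atTop 1] with n hn hn1
      have hn' : (0 : ℝ) < n := by exact_mod_cast hn1
      have : η n x = 1 := by
        refine Real.smoothTransition.one_of_one_le ?_
        rw [sub_zero]
        have : ((n : ℝ) ^ 2)⁻¹ * ‖x‖ ^ 2 ≤ 1 := by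
          rw [inv_mul_le_iff₀ (by positivity), mul_one]
          exact pow_le_pow_left₀ (norm_nonneg _) hn.le 2
        linarith
      rw [this, one_mul]
  have ieta : ∀ n, Integrable (fun x => η n x * (f x * dvg F x + inner ℝ (v x) (F x))) := fun n =>
    i12.bdd_mul (c := 1) (hηs n).continuous.aestronglyMeasurable (ae_of_all _ (ηb n))
  have hsplit : ∀ n : ℕ, 1 ≤ n → ∫ x, η n x * (f x * dvg F x + inner ℝ (v x) (F x)) =
      - ∫ x, f x * fderiv ℝ (η n) x (F x) := by
    intro n hn
    have hz : ∫ x, (f x * dvg (fun y => η n y • F y) x + inner ℝ (v x) (η n x • F x)) = 0 :=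
      hf.integral_field ((hηs n).smul hF) ((hηc n hn).smul_right)
    have hi : Integrable fun x =>
        f x * dvg (fun y => η n y • F y) x + inner ℝ (v x) (η n x • F x) :=
      hf.integrable_field ((hηs n).smul hF) ((hηc n hn).smul_right)
    simp only [hpt] at hz hi
    have i3 : Integrable (fun x => f x * fderiv ℝ (η n) x (F x)) := by
      refine (hi.sub (ieta n)).congr (ae_of_all _ fun x => ?_)
      simp
    rw [integral_add (ieta n) i3] at hz
    linarith
  have hAm : ∀ n, MeasurableSet (A n) := fun n => measurableSet_le measurable_const measurable_norm
  have htail := tendsto_integral_tail h.sq_integrable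
  have hsmall : Tendsto (fun n : ℕ => ∫ x, f x * fderiv ℝ (η n) x (F x)) atTop (𝓝 0) := by
    rw [Metric.tendsto_atTop']
    intro δ hδ
    -- This value turns the n-independent part into δ/4; the tail is then made small enough, for
    -- this lam, to contribute at most δ/2. Using C + 1 avoids a zero denominator.
    set lam : ℝ := 32 * S * (C + 1) * Real.pi / δ with hlam
    have hlam0 : 0 < lam := by have := Real.pi_pos; positivity
    have htl : ∀ᶠ n : ℕ in atTop, ∫ x in A n, f x ^ 2 * g x < δ / (9 * S * (C + 1) * lam) :=
      htail.eventually_lt_const (by positivity)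
    have := htl.and (eventually_ge_atTop 1)
    obtain ⟨N, hN⟩ := eventually_atTop.1 this
    refine ⟨N, fun n hn => ?_⟩
    obtain ⟨hn1, hn2⟩ := hN n hn.le
    have hn' : (0 : ℝ) < n := by exact_mod_cast hn2
    rw [dist_zero_right]
    have ia : Integrable ((A n).indicator (fun x => f x ^ 2 * g x)) :=
      h.sq_integrable.indicator (hAm n)
    have ib : Integrable ((Metric.closedBall (0 : ℂ) (2 * n)).indicator
        (fun _ => ((n : ℝ) ^ 2)⁻¹)) := by
      rw [integrable_indicator_iff Metric.isClosed_closedBall.measurableSet]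
      exact integrableOn_const (isCompact_closedBall _ _).measure_lt_top.ne
    have vol : ∫ x, (Metric.closedBall (0 : ℂ) (2 * n)).indicator (fun _ => ((n : ℝ) ^ 2)⁻¹) x =
        4 * Real.pi := by
      rw [integral_indicator Metric.isClosed_closedBall.measurableSet, setIntegral_const,
        Measure.real, Complex.volume_closedBall]
      simp [ENNReal.toReal_mul, ENNReal.toReal_pow]
      field_simp
      norm_num
    calc ‖∫ x, f x * fderiv ℝ (η n) x (F x)‖
        ≤ ∫ x, 2 * S * C * (lam * (9 / 4) * (A n).indicator (fun x => f x ^ 2 * g x) x +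
          lam⁻¹ * (Metric.closedBall (0 : ℂ) (2 * n)).indicator (fun _ => ((n : ℝ) ^ 2)⁻¹) x) :=
          norm_integral_le_of_norm_le (((ia.const_mul _).add (ib.const_mul _)).const_mul _)
            (ae_of_all _ fun x => hdb n hn2 x lam hlam0)
      _ = 2 * S * C * (lam * (9 / 4) * (∫ x in A n, f x ^ 2 * g x) + lam⁻¹ * (4 * Real.pi)) := by
          rw [integral_const_mul, integral_add (ia.const_mul _) (ib.const_mul _),
            integral_const_mul, integral_const_mul, vol, integral_indicator (hAm n)]
      _ ≤ 2 * S * (C + 1) * (lam * (9 / 4) * (δ / (9 * S * (C + 1) * lam)) +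
            lam⁻¹ * (4 * Real.pi)) := by
          have : 0 ≤ ∫ x in A n, f x ^ 2 * g x :=
            integral_nonneg fun x => mul_nonneg (sq_nonneg _) (g_pos x).le
          gcongr
          linarith
      _ = δ / 2 + δ / 4 := by
          rw [hlam]
          have := Real.pi_pos
          field_simp
          norm_num
      _ < δ := by linarith
  refine tendsto_nhds_unique hmain ?_
  have : Tendsto (fun n : ℕ => - ∫ x, f x * fderiv ℝ (η n) x (F x)) atTop (𝓝 0) := by
    simpa using hsmall.neg
  refine this.congr' ?_
  filter_upwards [eventually_ge_atTop 1] with n hn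
  exact (hsplit n hn).symm

/-! ### Linear combinations -/

lemma IsWeakGrad.add {f₁ f₂ : ℂ → ℝ} {v₁ v₂ : ℂ → ℂ} (h₁ : IsWeakGrad f₁ v₁)
    (h₂ : IsWeakGrad f₂ v₂) : IsWeakGrad (fun x => f₁ x + f₂ x) (fun x => v₁ x + v₂ x) where
  locallyIntegrable := h₁.locallyIntegrable.add h₂.locallyIntegrable
  locallyIntegrable_grad := h₁.locallyIntegrable_grad.add h₂.locallyIntegrable_grad
  integral_eq ψ hψ hs e := by
    have c1 : Continuous (fun x => fderiv ℝ ψ x e) :=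
      (hψ.continuous_fderiv (by simp)).clm_apply continuous_const
    have s1 : HasCompactSupport (fun x => fderiv ℝ ψ x e) :=
      (hs.fderiv ℝ).comp_left (g := fun L : ℂ →L[ℝ] ℝ => L e) (by simp)
    have i : ∀ {f v}, IsWeakGrad f v → Integrable (fun x => f x * fderiv ℝ ψ x e) := fun h =>
      integrable_mul_of_compactSupport h.locallyIntegrable c1 s1
    have j : ∀ {f v}, IsWeakGrad f v → Integrable (fun x => inner ℝ (v x) e * ψ x) := by
      intro f v h
      have := integrable_inner_of_compactSupport h.locallyIntegrable_grad (F := fun x => ψ x • e)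
        (hψ.continuous.smul continuous_const) hs.smul_right
      simpa only [real_inner_smul_right, mul_comm] using this
    simp only [add_mul, inner_add_left]
    rw [integral_add (i h₁) (i h₂), integral_add (j h₁) (j h₂), h₁.integral_eq ψ hψ hs e,
      h₂.integral_eq ψ hψ hs e]
    ring

lemma IsWeakGrad.const_mul {f : ℂ → ℝ} {v : ℂ → ℂ} (h : IsWeakGrad f v) (a : ℝ) :
    IsWeakGrad (fun x => a * f x) (fun x => a • v x) where
  locallyIntegrable := h.locallyIntegrable.smul a
  locallyIntegrable_grad := h.locallyIntegrable_grad.smul a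
  integral_eq ψ hψ hs e := by
    simp only [real_inner_smul_left, mul_assoc]
    rw [integral_const_mul, integral_const_mul, h.integral_eq ψ hψ hs e]
    ring

lemma IsWeakGrad.of_contDiff {f : ℂ → ℝ} {v : ℂ → ℂ} (hf : ContDiff ℝ 1 f)
    (hv : Continuous v) (h : ∀ x e, fderiv ℝ f x e = inner ℝ (v x) e) : IsWeakGrad f v where
  locallyIntegrable := hf.continuous.locallyIntegrable
  locallyIntegrable_grad := hv.locallyIntegrable
  integral_eq ψ hψ hs e := by
    have c1 : Continuous (fun x => fderiv ℝ ψ x e) :=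
      (hψ.continuous_fderiv (by simp)).clm_apply continuous_const
    have s1 : HasCompactSupport (fun x => fderiv ℝ ψ x e) :=
      (hs.fderiv ℝ).comp_left (g := fun L : ℂ →L[ℝ] ℝ => L e) (by simp)
    have := integral_mul_fderiv_eq_neg_fderiv_mul_of_integrable (μ := volume) (f := f) (g := ψ)
      (v := e)
      (by
        refine Continuous.integrable_of_hasCompactSupport ?_ hs.mul_left
        exact ((hf.continuous_fderiv (by simp)).clm_apply continuous_const).mul hψ.continuous)
      (Continuous.integrable_of_hasCompactSupport (hf.continuous.mul c1) s1.mul_left)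
      (Continuous.integrable_of_hasCompactSupport (hf.continuous.mul hψ.continuous) hs.mul_left)
      (fun x _ => hf.differentiable (by simp) x) (fun x _ => hψ.differentiable (by simp) x)
    rw [this]
    simp only [h]

/-- Dominated convergence on both sides of the defining identity; local domination is enough because
test functions have compact support. -/
lemma IsWeakGrad.of_tendsto {f F : ℂ → ℝ} {v : ℂ → ℂ} {V : ℂ → ℝ} {fn : ℕ → ℂ → ℝ}
    {vn : ℕ → ℂ → ℂ} (hn : ∀ n, IsWeakGrad (fn n) (vn n)) (hF : LocallyIntegrable F volume)
    (hV : LocallyIntegrable V volume) (hfF : ∀ n, ∀ᵐ x, |fn n x| ≤ F x)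
    (hvV : ∀ n, ∀ᵐ x, ‖vn n x‖ ≤ V x)
    (hf : ∀ᵐ x, Tendsto (fun n => fn n x) atTop (𝓝 (f x)))
    (hv : ∀ᵐ x, Tendsto (fun n => vn n x) atTop (𝓝 (v x))) : IsWeakGrad f v where
  locallyIntegrable := by
    refine hF.mono (aestronglyMeasurable_of_tendsto_ae atTop
      (fun n => (hn n).locallyIntegrable.aestronglyMeasurable) hf) ?_
    filter_upwards [ae_all_iff.2 hfF, hf] with x h1 h2
    exact (le_of_tendsto h2.norm (Eventually.of_forall h1)).trans (le_abs_self _)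
  locallyIntegrable_grad := by
    refine hV.mono (aestronglyMeasurable_of_tendsto_ae atTop
      (fun n => (hn n).locallyIntegrable_grad.aestronglyMeasurable) hv) ?_
    filter_upwards [ae_all_iff.2 hvV, hv] with x h1 h2
    exact (le_of_tendsto h2.norm (Eventually.of_forall h1)).trans (le_abs_self _)
  integral_eq ψ hψ hs e := by
    have c1 : Continuous (fun x => fderiv ℝ ψ x e) :=
      (hψ.continuous_fderiv (by simp)).clm_apply continuous_const
    have s1 : HasCompactSupport (fun x => fderiv ℝ ψ x e) :=
      (hs.fderiv ℝ).comp_left (g := fun L : ℂ →L[ℝ] ℝ => L e) (by simp)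
    have l1 : Tendsto (fun n => ∫ x, fn n x * fderiv ℝ ψ x e) atTop
        (𝓝 (∫ x, f x * fderiv ℝ ψ x e)) := by
      refine tendsto_integral_of_dominated_convergence (fun x => F x * |fderiv ℝ ψ x e|)
        (fun n => ((hn n).locallyIntegrable.aestronglyMeasurable.mul c1.aestronglyMeasurable))
        (integrable_mul_of_compactSupport hF c1.abs s1.abs) (fun n => ?_) ?_
      · filter_upwards [hfF n] with x hx
        rw [norm_mul]
        exact mul_le_mul_of_nonneg_right hx (norm_nonneg _)
      · filter_upwards [hf] with x hx
        exact hx.mul_const _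
    have l2 : Tendsto (fun n => - ∫ x, inner ℝ (vn n x) e * ψ x) atTop
        (𝓝 (- ∫ x, inner ℝ (v x) e * ψ x)) := by
      refine (tendsto_integral_of_dominated_convergence (fun x => V x * (‖e‖ * |ψ x|))
        (fun n => ?_) (integrable_mul_of_compactSupport hV (by have := hψ.continuous; fun_prop)
          (hs.abs.mul_left)) (fun n => ?_) ?_).neg
      · exact (((hn n).locallyIntegrable_grad.aestronglyMeasurable).inner
          aestronglyMeasurable_const).mul hψ.continuous.aestronglyMeasurable
      · filter_upwards [hvV n] with x hx
        rw [norm_mul, ← mul_assoc]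
        refine mul_le_mul_of_nonneg_right ?_ (norm_nonneg _)
        exact (norm_inner_le_norm _ _).trans (mul_le_mul_of_nonneg_right hx (norm_nonneg _))
      · filter_upwards [hv] with x hx
        exact (hx.inner tendsto_const_nhds).mul_const _
    refine tendsto_nhds_unique l1 (l2.congr fun n => ((hn n).integral_eq ψ hψ hs e).symm)

lemma Tame.add {f₁ f₂ : ℂ → ℝ} {v₁ v₂ : ℂ → ℂ} (h₁ : Tame f₁ v₁) (h₂ : Tame f₂ v₂) :
    Tame (fun x => f₁ x + f₂ x) (fun x => v₁ x + v₂ x) where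
  isWeakGrad := h₁.isWeakGrad.add h₂.isWeakGrad
  sq_integrable := by
    refine ((h₁.sq_integrable.const_mul 2).add (h₂.sq_integrable.const_mul 2)).mono'
      (((h₁.isWeakGrad.locallyIntegrable.aestronglyMeasurable.add
        h₂.isWeakGrad.locallyIntegrable.aestronglyMeasurable).pow 2).mul
        continuous_g.aestronglyMeasurable) (ae_of_all _ fun x => ?_)
    have := g_pos x
    rw [Real.norm_of_nonneg (by positivity)]
    have : (f₁ x + f₂ x) ^ 2 ≤ 2 * f₁ x ^ 2 + 2 * f₂ x ^ 2 := by nlinarith [sq_nonneg (f₁ x - f₂ x)]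
    calc (f₁ x + f₂ x) ^ 2 * g x ≤ (2 * f₁ x ^ 2 + 2 * f₂ x ^ 2) * g x := by gcongr
      _ = _ := by simp; ring
  grad_integrable := by
    refine (h₁.grad_integrable.add h₂.grad_integrable).mono'
      (AEStronglyMeasurable.mul (h₁.isWeakGrad.locallyIntegrable_grad.aestronglyMeasurable.add
        h₂.isWeakGrad.locallyIntegrable_grad.aestronglyMeasurable).norm
        (by fun_prop)) (ae_of_all _ fun x => ?_)
    rw [Real.norm_of_nonneg (by positivity), Pi.add_apply, ← add_mul]
    gcongr
    exact norm_add_le _ _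

lemma Tame.const_mul {f : ℂ → ℝ} {v : ℂ → ℂ} (h : Tame f v) (a : ℝ) :
    Tame (fun x => a * f x) (fun x => a • v x) where
  isWeakGrad := h.isWeakGrad.const_mul a
  sq_integrable := by
    refine (h.sq_integrable.const_mul (a ^ 2)).congr (ae_of_all _ fun x => ?_)
    simp only; ring
  grad_integrable := by
    refine (h.grad_integrable.const_mul |a|).congr (ae_of_all _ fun x => ?_)
    simp only [norm_smul, Real.norm_eq_abs]; ring

lemma tame_const (a : ℝ) : Tame (fun _ => a) (fun _ => 0) where
  isWeakGrad := IsWeakGrad.of_contDiff contDiff_const continuous_const (by simp)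
  sq_integrable := integrable_g.const_mul _
  grad_integrable := by simp

lemma tame_sum {n : ℕ} {f : Fin n → ℂ → ℝ} {v : Fin n → ℂ → ℂ} (s : Finset (Fin n))
    (h : ∀ k, Tame (f k) (v k)) : Tame (fun x => ∑ k ∈ s, f k x) (fun x => ∑ k ∈ s, v k x) := by
  induction s using Finset.induction_on with
  | empty => simpa using tame_const 0
  | insert a s ha ih => simpa only [Finset.sum_insert ha] using (h a).add ih

/-! ### The logarithm -/

/-- The gradient of `ln |x - c|`. -/
def poleField (c x : ℂ) : ℂ := (‖x - c‖ ^ 2)⁻¹ • (x - c)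

/-- The gradient of `(1/2) ln (1 + |x|²)`. -/
def roundField (x : ℂ) : ℂ := (1 + ‖x‖ ^ 2)⁻¹ • x

lemma norm_poleField (c x : ℂ) : ‖poleField c x‖ = ‖x - c‖⁻¹ := by
  rw [poleField, norm_smul, norm_inv, norm_pow, norm_norm]
  rcases eq_or_ne ‖x - c‖ 0 with h | h
  · simp [h]
  · field_simp

lemma contDiff_roundField : ContDiff ℝ ∞ roundField :=
  ((contDiff_const.add (contDiff_id.norm_sq ℝ)).inv fun x => (one_add_normSq_pos x).ne').smul
    contDiff_id

lemma dvg_roundField (x : ℂ) : dvg roundField x = 1 / 2 * g x := by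
  have h0 := one_add_normSq_pos x
  have hk : HasDerivAt (fun t : ℝ => (1 + t)⁻¹) (-1 / (1 + ‖x - 0‖ ^ 2) ^ 2) (‖x - 0‖ ^ 2) :=
    ((hasDerivAt_id _).const_add 1).inv (by simpa using h0.ne')
  have := dvg_radial_profile hk
  simp only [sub_zero] at this
  change dvg (fun y => (1 + ‖y‖ ^ 2)⁻¹ • y) x = _
  rw [this, g]
  field_simp
  ring

lemma one_add_normSq_sub_le (c x : ℂ) :
    1 + ‖x - c‖ ^ 2 ≤ 2 * (1 + ‖c‖ ^ 2) * (1 + ‖x‖ ^ 2) := by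
  have h1 : ‖x - c‖ ^ 2 ≤ (‖x‖ + ‖c‖) ^ 2 := by gcongr; exact norm_sub_le _ _
  nlinarith [sq_nonneg (‖x‖ - ‖c‖), mul_nonneg (sq_nonneg ‖x‖) (sq_nonneg ‖c‖)]

/-- For c = 0 the polar Jacobian cancels the singularity and leaves 1/(1+y²). For general c the
weights centred at c and at 0 are comparable. -/
lemma integrable_inv_norm_weight (c : ℂ) :
    Integrable (fun x : ℂ => ‖x - c‖⁻¹ * (1 + ‖x‖ ^ 2)⁻¹) := by
  have h0 : Integrable (fun x : ℂ => ‖x‖⁻¹ * (1 + ‖x‖ ^ 2)⁻¹) := by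
    have := (integrable_fun_norm_addHaar (volume : Measure ℂ)
      (f := fun y : ℝ => y⁻¹ * (1 + y ^ 2)⁻¹)).2
    refine this ?_
    have h1 : IntegrableOn (fun y : ℝ => (1 + y ^ 2)⁻¹) (Set.Ioi 0) :=
      integrable_inv_one_add_sq.integrableOn
    refine h1.congr_fun (fun y hy => ?_) measurableSet_Ioi
    have : (0 : ℝ) < y := hy
    simp only [Complex.finrank_real_complex, smul_eq_mul]
    norm_num
    field_simp
  have h1 : Integrable (fun x : ℂ => ‖x - c‖⁻¹ * (1 + ‖x - c‖ ^ 2)⁻¹) := h0.comp_sub_right c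
  refine (h1.const_mul (2 * (1 + ‖c‖ ^ 2))).mono' ?_ (ae_of_all _ fun x => ?_)
  · exact Measurable.aestronglyMeasurable (by fun_prop)
  rw [Real.norm_of_nonneg (by positivity)]
  have h2 := one_add_normSq_sub_le c x
  calc ‖x - c‖⁻¹ * (1 + ‖x‖ ^ 2)⁻¹
      ≤ ‖x - c‖⁻¹ * (2 * (1 + ‖c‖ ^ 2) * (1 + ‖x - c‖ ^ 2)⁻¹) := by
        gcongr
        rw [← div_eq_mul_inv, le_div_iff₀ (by positivity), inv_mul_le_iff₀ (by positivity)]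
        linarith
    _ = _ := by ring

/-- For t ≥ 1 one has ln t = 2 ln √t ≤ 2√t; this is applied to r or to 1/r. -/
lemma sq_log_le {r : ℝ} (hr : 0 ≤ r) : Real.log r ^ 2 ≤ 4 * (r + r⁻¹) := by
  rcases hr.eq_or_lt with rfl | hr
  · simp
  have key : ∀ t : ℝ, 0 < t → 0 ≤ Real.log t → Real.log t ^ 2 ≤ 4 * t := by
    intro t ht hl
    have h1 : Real.log t = 2 * Real.log (√t) := by rw [Real.log_sqrt ht.le]; ring
    have h2 : Real.log (√t) ≤ √t := (Real.log_le_sub_one_of_pos (Real.sqrt_pos.2 ht)).trans (by linarith)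
    have h3 : √t ^ 2 = t := Real.sq_sqrt ht.le
    have h4 : 0 ≤ Real.log (√t) := by linarith
    rw [h1]
    nlinarith [pow_le_pow_left₀ h4 h2 2]
  have hi : 0 < r⁻¹ := by positivity
  rcases le_total 0 (Real.log r) with h | h
  · linarith [key r hr h]
  · have := key r⁻¹ hi (by rw [Real.log_inv]; linarith)
    rw [Real.log_inv] at this
    nlinarith

lemma integrable_sq_log_mul_g (c : ℂ) :
    Integrable (fun x : ℂ => Real.log ‖x - c‖ ^ 2 * g x) := by
  refine ((integrable_inv_norm_weight c).const_mul (16 * (2 * (1 + ‖c‖ ^ 2) + 1))).mono' ?_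
    (ae_of_all _ fun x => ?_)
  · exact (Measurable.aestronglyMeasurable (by fun_prop)).mul continuous_g.aestronglyMeasurable
  have hg := g_pos x
  rw [Real.norm_of_nonneg (by positivity)]
  have h1 := sq_log_le (norm_nonneg (x - c))
  have h2 : ‖x - c‖ ≤ 2 * (1 + ‖c‖ ^ 2) * (1 + ‖x‖ ^ 2) * ‖x - c‖⁻¹ := by
    rcases (norm_nonneg (x - c)).eq_or_lt with h | h
    · rw [← h]; simp
    · rw [← div_eq_mul_inv, le_div_iff₀ h]
      nlinarith [one_add_normSq_sub_le c x]
  have h3 : (1 + ‖x‖ ^ 2)⁻¹ ≤ 1 := inv_le_one_of_one_le₀ (by nlinarith [sq_nonneg ‖x‖])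
  have h4 : (1 + ‖x‖ ^ 2) * (1 + ‖x‖ ^ 2)⁻¹ = 1 := mul_inv_cancel₀ (one_add_normSq_pos x).ne'
  rw [g_eq]
  set a := (1 + ‖x‖ ^ 2)⁻¹
  have ha : 0 ≤ a := by positivity
  have hi : 0 ≤ ‖x - c‖⁻¹ := by positivity
  calc Real.log ‖x - c‖ ^ 2 * (4 * a ^ 2)
      ≤ (4 * (2 * (1 + ‖c‖ ^ 2) * (1 + ‖x‖ ^ 2) * ‖x - c‖⁻¹ + ‖x - c‖⁻¹)) * (4 * a ^ 2) := by
        gcongr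
        linarith
    _ = 16 * (2 * (1 + ‖c‖ ^ 2) * ((1 + ‖x‖ ^ 2) * a) + a) * (‖x - c‖⁻¹ * a) := by ring
    _ ≤ 16 * (2 * (1 + ‖c‖ ^ 2) + 1) * (‖x - c‖⁻¹ * a) := by
        rw [h4]
        exact mul_le_mul_of_nonneg_right (by linarith) (by positivity)

lemma locallyIntegrable_of_weight {E : Type*} [NormedAddCommGroup E] {f : ℂ → E} {ρ : ℂ → ℝ}
    (hm : AEStronglyMeasurable f) (hρ : Continuous ρ) (hpos : ∀ x, 0 < ρ x)
    (hi : Integrable (fun x => ‖f x‖ * ρ x)) : LocallyIntegrable f volume := by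
  rw [locallyIntegrable_iff]
  intro k hk
  have := (hi.integrableOn (s := k)).continuousOn_mul (g := fun x => (ρ x)⁻¹)
    (hρ.inv₀ fun x => (hpos x).ne').continuousOn hk
  refine this.mono' hm.restrict (ae_of_all _ fun x => ?_)
  have := (hpos x).ne'
  refine le_of_eq ?_
  field_simp

/-- `(1/2) ln (|x - c|² + d)`. -/
def smoothLog (d : ℝ) (c x : ℂ) : ℝ := 1 / 2 * Real.log (‖x - c‖ ^ 2 + d)

lemma isWeakGrad_smoothLog {d : ℝ} (hd : 0 < d) (c : ℂ) :
    IsWeakGrad (smoothLog d c) (fun x => (‖x - c‖ ^ 2 + d)⁻¹ • (x - c)) := by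
  have hp : ∀ x : ℂ, 0 < ‖x - c‖ ^ 2 + d := fun x => by positivity
  refine IsWeakGrad.of_contDiff ?_ ?_ fun x e => ?_
  · exact contDiff_const.mul ((((contDiff_normSq_sub c).of_le (by simp)).add contDiff_const).log
      fun x => (hp x).ne')
  · exact (Continuous.inv₀ (by fun_prop) fun x => (hp x).ne').smul (by fun_prop)
  · have hk : HasDerivAt (fun t : ℝ => 1 / 2 * Real.log (t + d))
        (1 / 2 * (1 / (‖x - c‖ ^ 2 + d))) (‖x - c‖ ^ 2) :=
      (((hasDerivAt_id _).add_const d).log (hp x).ne').const_mul _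
    change fderiv ℝ (fun y => (fun t : ℝ => 1 / 2 * Real.log (t + d)) (‖y - c‖ ^ 2)) x e = _
    rw [fderiv_radial hk, real_inner_smul_left]
    ring

/-- The regularizations ½ ln(|x - c|² + d) are smooth. They and their gradients converge off c,
under locally integrable bounds built from ln² and 1/|x - c|, so the point c adds nothing to the
weak gradient. -/
lemma isWeakGrad_log (c : ℂ) : IsWeakGrad (fun x => Real.log ‖x - c‖) (poleField c) := by
  have hlog : LocallyIntegrable (fun x : ℂ => Real.log ‖x - c‖ ^ 2) volume :=
    locallyIntegrable_of_weight (Measurable.aestronglyMeasurable (by fun_prop)) continuous_g g_pos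
      (by simpa using integrable_sq_log_mul_g c)
  have hF : LocallyIntegrable (fun x : ℂ => Real.log ‖x - c‖ ^ 2 +
      (1 + 1 / 2 * Real.log (1 + ‖x - c‖ ^ 2))) volume := by
    refine hlog.add (Continuous.locallyIntegrable ?_)
    exact continuous_const.add (continuous_const.mul (Continuous.log (by fun_prop)
      fun x => by positivity))
  have hV : LocallyIntegrable (fun x : ℂ => ‖x - c‖⁻¹) volume :=
    locallyIntegrable_of_weight (Measurable.aestronglyMeasurable (by fun_prop))
      (ρ := fun x => (1 + ‖x‖ ^ 2)⁻¹) (Continuous.inv₀ (by fun_prop) fun x =>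
        (one_add_normSq_pos x).ne') (fun x => by positivity)
      (by simpa using integrable_inv_norm_weight c)
  have hne : ∀ᵐ x : ℂ, x ≠ c := by simp [ae_iff]
  have hd : ∀ n : ℕ, 0 < 1 / ((n : ℝ) + 1) := fun n => Nat.one_div_pos_of_nat
  have hd1 : ∀ n : ℕ, 1 / ((n : ℝ) + 1) ≤ 1 := fun n => by
    rw [div_le_one (by positivity)]; linarith [Nat.cast_nonneg (α := ℝ) n]
  have hlim : Tendsto (fun n : ℕ => 1 / ((n : ℝ) + 1)) atTop (𝓝 0) :=
    tendsto_one_div_add_atTop_nhds_zero_nat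
  refine IsWeakGrad.of_tendsto (fun n => isWeakGrad_smoothLog (hd n) c) hF hV ?_ ?_ ?_ ?_
  · intro n
    filter_upwards [hne] with x hx
    have h0 : 0 < ‖x - c‖ := norm_pos_iff.2 (sub_ne_zero.2 hx)
    have l1 : Real.log ‖x - c‖ ≤ smoothLog (1 / ((n : ℝ) + 1)) c x := by
      have : Real.log ‖x - c‖ = 1 / 2 * Real.log (‖x - c‖ ^ 2) := by rw [Real.log_pow]; push_cast; ring
      rw [this, smoothLog]
      have := Real.log_le_log (by positivity : 0 < ‖x - c‖ ^ 2)
        (le_add_of_nonneg_right (hd n).le : ‖x - c‖ ^ 2 ≤ ‖x - c‖ ^ 2 + 1 / ((n : ℝ) + 1))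
      linarith
    have l2 : smoothLog (1 / ((n : ℝ) + 1)) c x ≤ 1 / 2 * Real.log (1 + ‖x - c‖ ^ 2) := by
      rw [smoothLog]
      have := Real.log_le_log (by have := hd n; positivity)
        (show ‖x - c‖ ^ 2 + 1 / ((n : ℝ) + 1) ≤ 1 + ‖x - c‖ ^ 2 by linarith [hd1 n])
      linarith
    have l3 : 0 ≤ Real.log (1 + ‖x - c‖ ^ 2) := Real.log_nonneg (by nlinarith)
    rw [abs_le]
    constructor <;> nlinarith [sq_nonneg (Real.log ‖x - c‖), sq_nonneg (Real.log ‖x - c‖ + 1),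
      sq_nonneg (Real.log ‖x - c‖ - 1)]
  · intro n
    refine ae_of_all _ fun x => ?_
    rw [norm_smul, norm_inv, Real.norm_of_nonneg (by have := hd n; positivity)]
    rcases (norm_nonneg (x - c)).eq_or_lt with h | h
    · rw [← h]; simp
    · rw [inv_mul_le_iff₀ (by have := hd n; positivity), ← div_eq_mul_inv, le_div_iff₀ h]
      nlinarith [hd n]
  · filter_upwards [hne] with x hx
    have h0 : 0 < ‖x - c‖ := norm_pos_iff.2 (sub_ne_zero.2 hx)
    have : Tendsto (fun n : ℕ => ‖x - c‖ ^ 2 + 1 / ((n : ℝ) + 1)) atTop (𝓝 (‖x - c‖ ^ 2)) := by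
      simpa using hlim.const_add (‖x - c‖ ^ 2)
    have h2 := (this.log (by positivity)).const_mul (1 / 2)
    rw [Real.log_pow, show 1 / 2 * (((2 : ℕ) : ℝ) * Real.log ‖x - c‖) = Real.log ‖x - c‖ by
      push_cast; ring] at h2
    exact h2
  · filter_upwards [hne] with x hx
    have h0 : 0 < ‖x - c‖ := norm_pos_iff.2 (sub_ne_zero.2 hx)
    have : Tendsto (fun n : ℕ => ‖x - c‖ ^ 2 + 1 / ((n : ℝ) + 1)) atTop (𝓝 (‖x - c‖ ^ 2)) := by
      simpa using hlim.const_add (‖x - c‖ ^ 2)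
    exact (this.inv₀ (by positivity)).smul_const _

lemma tame_log (c : ℂ) : Tame (fun x => Real.log ‖x - c‖) (poleField c) where
  isWeakGrad := isWeakGrad_log c
  sq_integrable := integrable_sq_log_mul_g c
  grad_integrable := by
    simp only [norm_poleField]
    exact integrable_inv_norm_weight c

/-- `(1/2) ln (1 + |x|²)`. -/
def halfLog (x : ℂ) : ℝ := 1 / 2 * Real.log (1 + ‖x‖ ^ 2)

lemma halfLog_nonneg (x : ℂ) : 0 ≤ halfLog x := by
  have : 0 ≤ Real.log (1 + ‖x‖ ^ 2) := Real.log_nonneg (by nlinarith [sq_nonneg ‖x‖])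
  rw [halfLog]; positivity

lemma continuous_halfLog : Continuous halfLog :=
  continuous_const.mul (Continuous.log (by fun_prop) fun x => (one_add_normSq_pos x).ne')

lemma log_g (x : ℂ) : Real.log (g x) = Real.log 4 - 4 * halfLog x := by
  rw [g, Real.log_div (by norm_num) (by positivity), Real.log_pow, halfLog]
  push_cast; ring

lemma norm_roundField_le (x : ℂ) : ‖roundField x‖ ≤ ‖x - 0‖⁻¹ := by
  rw [roundField, norm_smul, norm_inv, Real.norm_of_nonneg (by positivity), sub_zero]
  rcases (norm_nonneg x).eq_or_lt with h | h
  · rw [← h]; simp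
  · rw [inv_mul_le_iff₀ (by positivity), ← div_eq_mul_inv, le_div_iff₀ h]
    nlinarith

lemma tame_halfLog : Tame halfLog roundField where
  isWeakGrad := by
    have := isWeakGrad_smoothLog one_pos 0
    unfold smoothLog at this
    simp only [sub_zero, add_comm _ (1 : ℝ)] at this
    exact this
  sq_integrable := by
    refine (((integrable_sq_log_mul_g 0).const_mul 2).add integrable_g).mono'
      ((continuous_halfLog.pow 2).mul continuous_g).aestronglyMeasurable (ae_of_all _ fun x => ?_)
    have hg := g_pos x
    rw [Real.norm_of_nonneg (by positivity)]
    simp only [Pi.add_apply, sub_zero]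
    have hx : halfLog x ^ 2 ≤ 2 * Real.log ‖x‖ ^ 2 + 1 := by
      have h0 := halfLog_nonneg x
      rcases le_or_gt ‖x‖ 1 with h | h
      · have : halfLog x ≤ 1 := by
          rw [halfLog]
          have h1 : ‖x‖ ^ 2 ≤ 1 := pow_le_one₀ (norm_nonneg _) h
          have := Real.log_le_sub_one_of_pos (one_add_normSq_pos x)
          linarith
        nlinarith [sq_nonneg (Real.log ‖x‖)]
      · have hl : 0 < Real.log ‖x‖ := Real.log_pos h
        have h1 : Real.log (1 + ‖x‖ ^ 2) ≤ Real.log 2 + 2 * Real.log ‖x‖ := by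
          have : Real.log 2 + 2 * Real.log ‖x‖ = Real.log (2 * ‖x‖ ^ 2) := by
            rw [Real.log_mul (by norm_num) (by positivity), Real.log_pow]; push_cast; ring
          rw [this]
          exact Real.log_le_log (by positivity) (by nlinarith)
        have h2 : Real.log 2 < 0.7 := lt_trans Real.log_two_lt_d9 (by norm_num)
        -- Here 0.35 bounds (ln 2)/2, and (a + 0.35)² ≤ 2a² + 0.245.
        have : halfLog x ≤ Real.log ‖x‖ + 0.35 := by rw [halfLog]; linarith
        nlinarith [sq_nonneg (Real.log ‖x‖ - 0.35)]
    nlinarith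
  grad_integrable := by
    refine (integrable_inv_norm_weight 0).mono' (AEStronglyMeasurable.mul
      contDiff_roundField.continuous.norm.aestronglyMeasurable
      (Measurable.aestronglyMeasurable (by fun_prop))) (ae_of_all _ fun x => ?_)
    rw [Real.norm_of_nonneg (by positivity)]
    exact mul_le_mul_of_nonneg_right (norm_roundField_le x) (by positivity)

/-- With y = x - c the difference is y(1 + x c̄) / (|y|²(1+|x|²)): the leading 1/|x| terms cancel,
which provides the decay required by integration by parts on the whole plane. -/
lemma norm_poleField_sub_roundField {c x : ℂ} {r : ℝ} (hr : 0 < r) (hx : r ≤ ‖x - c‖) :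
    ‖poleField c x - roundField x‖ ≤ ((1 + ‖c‖ ^ 2) / r + ‖c‖) * (1 + ‖x‖ ^ 2)⁻¹ := by
  have h0 : 0 < ‖x - c‖ := hr.trans_le hx
  have hx0 := one_add_normSq_pos x
  set y := x - c with hy
  have hxy : x = y + c := by rw [hy]; ring
  have hn1 : ((‖y‖ ^ 2 : ℝ) : ℂ) = y * (starRingEnd ℂ) y := by
    rw [Complex.mul_conj, Complex.normSq_eq_norm_sq]
  have hn2 : ((‖x‖ ^ 2 : ℝ) : ℂ) = x * (starRingEnd ℂ) x := by
    rw [Complex.mul_conj, Complex.normSq_eq_norm_sq]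
  have e : poleField c x - roundField x =
      ((‖y‖ ^ 2)⁻¹ * (1 + ‖x‖ ^ 2)⁻¹ : ℝ) • (y * (1 + x * (starRingEnd ℂ) c)) := by
    rw [poleField, roundField, ← hy]
    have h1 : y ≠ 0 := norm_pos_iff.1 h0
    simp only [Complex.real_smul]
    have h2 : ((‖y‖ ^ 2 : ℝ) : ℂ) ≠ 0 := by exact_mod_cast (by positivity : ‖y‖ ^ 2 ≠ 0)
    have h3 : ((1 + ‖x‖ ^ 2 : ℝ) : ℂ) ≠ 0 := by exact_mod_cast hx0.ne'
    rw [Complex.ofReal_mul, Complex.ofReal_inv, Complex.ofReal_inv]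
    field_simp
    rw [Complex.ofReal_add, hn1, hn2, Complex.ofReal_one]
    have hc : (starRingEnd ℂ) x = (starRingEnd ℂ) y + (starRingEnd ℂ) c := by
      rw [hxy, map_add]
    rw [hc, hxy]
    ring
  rw [e, norm_smul, Real.norm_of_nonneg (by positivity), norm_mul]
  have h4 : ‖1 + x * (starRingEnd ℂ) c‖ ≤ 1 + (‖y‖ + ‖c‖) * ‖c‖ := by
    refine (norm_add_le _ _).trans ?_
    rw [norm_one, norm_mul, RCLike.norm_conj]
    gcongr
    rw [hxy]
    exact norm_add_le _ _
  calc (‖y‖ ^ 2)⁻¹ * (1 + ‖x‖ ^ 2)⁻¹ * (‖y‖ * ‖1 + x * (starRingEnd ℂ) c‖)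
      ≤ (‖y‖ ^ 2)⁻¹ * (1 + ‖x‖ ^ 2)⁻¹ * (‖y‖ * (1 + (‖y‖ + ‖c‖) * ‖c‖)) := by gcongr
    _ = ((1 + ‖c‖ ^ 2) / ‖y‖ + ‖c‖) * (1 + ‖x‖ ^ 2)⁻¹ := by field_simp; ring
    _ ≤ _ := by gcongr

/-! ### Flux through a truncated pole -/

lemma exists_bound_on_ball {E : Type*} [NormedAddCommGroup E] {F : ℂ → E}
    (hF : Continuous F) {ρ : ℂ → ℝ} (hρ : Continuous ρ) (hpos : ∀ x, 0 < ρ x) (c : ℂ) (r : ℝ) :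
    ∃ C, 0 ≤ C ∧ ∀ x ∈ Metric.closedBall c r, ‖F x‖ ≤ C * ρ x := by
  obtain ⟨C, hC⟩ := (isCompact_closedBall c r).exists_bound_of_continuousOn
    (f := fun x => ‖F x‖ * (ρ x)⁻¹) (hF.norm.mul (hρ.inv₀ fun x => (hpos x).ne')).continuousOn
  refine ⟨max C 0, le_max_right _ _, fun x hx => ?_⟩
  have h1 := hC x hx
  have h2 := hpos x
  rw [Real.norm_of_nonneg (by positivity), ← div_eq_mul_inv, div_le_iff₀ h2] at h1
  exact h1.trans (mul_le_mul_of_nonneg_right (le_max_left _ _) h2.le)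

/-- The fields (x - c)/r² and `pointField` have the same normal component on the circle, hence the
same flux. -/
lemma IsWeakGrad.circleMass_eq {f : ℂ → ℝ} {v : ℂ → ℂ} (hf : IsWeakGrad f v) (c : ℂ) {r : ℝ}
    (hr : 0 < r) : circleMass f v c r = ∫ x in Metric.ball c r,
      (f x * dvg (pointField c r) x + inner ℝ (v x) (pointField c r x)) := by
  have hs : ContDiff ℝ ∞ (fun x : ℂ => (r ^ 2)⁻¹ • (x - c)) :=
    (contDiff_id.sub contDiff_const).const_smul _
  rw [← hf.integral_ball_congr hs (contDiff_pointField c hr) hr, circleMass, ← integral_const_mul]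
  · congr 1; ext x
    have : dvg (fun x : ℂ => (r ^ 2)⁻¹ • (x - c)) x = (r ^ 2)⁻¹ * 2 := by
      rw [dvg_smul (a := fun _ => (r ^ 2)⁻¹) (by fun_prop) (by fun_prop), dvg_sub_const]
      simp
    rw [this, real_inner_smul_right]; ring
  · intro x hx
    rw [inner_pointField hr hx, real_inner_smul_right, real_inner_self_eq_norm_sq, hx]
    field_simp

/-- The flux of a gradient against a truncated pole. -/
lemma Tame.integral_flux {f : ℂ → ℝ} {v : ℂ → ℂ} (h : Tame f v) (c : ℂ) {r : ℝ} (hr : 0 < r) :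
    Integrable (fun x => inner ℝ (v x)
      ((Metric.ball c r)ᶜ.indicator (poleField c) x - roundField x)) ∧
    ∫ x, inner ℝ (v x) ((Metric.ball c r)ᶜ.indicator (poleField c) x - roundField x) =
      1 / 2 * (∫ x, f x * g x) - circleMass f v c r := by
  have hf := h.isWeakGrad
  have hb : MeasurableSet (Metric.ball c r) := Metric.isOpen_ball.measurableSet
  have hK := contDiff_pointField c hr
  have hF : ContDiff ℝ ∞ (fun x => pointField c r x - roundField x) :=
    hK.sub contDiff_roundField
  have hinvc : Continuous (fun x : ℂ => (1 + ‖x‖ ^ 2)⁻¹) :=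
    Continuous.inv₀ (by fun_prop) fun x => (one_add_normSq_pos x).ne'
  have hout : ∀ x, x ∉ Metric.ball c r → r ≤ ‖x - c‖ := fun x hx => by
    rwa [Metric.mem_ball, dist_eq_norm, not_lt] at hx
  have hKN : ∀ x, x ∉ Metric.ball c r → pointField c r x = poleField c x := fun x hx =>
    pointField_eq hr (hout x hx)
  have hd : ∀ x, dvg (fun x => pointField c r x - roundField x) x =
      dvg (pointField c r) x - 1 / 2 * g x := fun x => by
    rw [dvg_sub (hK.differentiable (by simp) x)
      (contDiff_roundField.differentiable (by simp) x), dvg_roundField]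
  obtain ⟨C₁, hC₁0, hC₁⟩ := exists_bound_on_ball hF.continuous hinvc
    (fun x => by positivity) c r
  obtain ⟨C₂, hC₂0, hC₂⟩ := exists_bound_on_ball (continuous_dvg hF) continuous_g g_pos c r
  set C₃ := (1 + ‖c‖ ^ 2) / r + ‖c‖ with hC₃
  have hC₃0 : 0 ≤ C₃ := by positivity
  set C := C₁ + C₂ + C₃ + 1 with hC
  have b1 : ∀ x, ‖pointField c r x - roundField x‖ ≤ C * (1 + ‖x‖ ^ 2)⁻¹ := by
    intro x
    by_cases hx : x ∈ Metric.ball c r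
    · refine (hC₁ x (Metric.ball_subset_closedBall hx)).trans ?_
      gcongr; linarith
    · rw [hKN x hx]
      refine (norm_poleField_sub_roundField hr (hout x hx)).trans ?_
      gcongr; linarith
  have b2 : ∀ x, |dvg (fun x => pointField c r x - roundField x) x| ≤ C * g x := by
    intro x
    have := g_pos x
    by_cases hx : x ∈ Metric.ball c r
    · refine (hC₂ x (Metric.ball_subset_closedBall hx)).trans ?_
      gcongr; linarith
    · rw [hd, dvg_pointField hr (hout x hx), zero_sub, abs_neg, abs_of_pos (by positivity)]
      gcongr; linarith
  obtain ⟨i1, i2⟩ := h.integral_field_eq_zero hF b1 b2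
  have i3 : Integrable ((Metric.ball c r).indicator (fun x =>
      f x * dvg (pointField c r) x + inner ℝ (v x) (pointField c r x))) :=
    (integrable_indicator_iff hb).2 (hf.integrableOn_field hK c r)
  have i4 := h.integrable_mul_g.const_mul (1 / 2)
  -- The truncated pole and the smooth `pointField` differ only inside the disc. The smooth field
  -- minus the round field has total flux zero; what must be corrected is the round divergence g/2
  -- everywhere and the flux density of `pointField` in the disc, which integrates to the circle
  -- mass.
  have hpt : ∀ x, inner ℝ (v x) ((Metric.ball c r)ᶜ.indicator (poleField c) x - roundField x) =
      (f x * dvg (fun x => pointField c r x - roundField x) x +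
        inner ℝ (v x) (pointField c r x - roundField x)) + 1 / 2 * (f x * g x) -
      (Metric.ball c r).indicator (fun x =>
        f x * dvg (pointField c r) x + inner ℝ (v x) (pointField c r x)) x := by
    intro x
    rw [hd, inner_sub_right, inner_sub_right]
    by_cases hx : x ∈ Metric.ball c r
    · rw [Set.indicator_of_notMem (by simpa using hx), Set.indicator_of_mem hx, inner_zero_right]
      ring
    · rw [Set.indicator_of_mem (by simpa using hx), Set.indicator_of_notMem hx, hKN x hx,
        dvg_pointField hr (hout x hx)]
      ring
  simp only [hpt]
  refine ⟨(i1.add i4).sub i3, ?_⟩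
  have s1 := integral_sub (i1.add i4) i3
  have s2 := integral_add i1 i4
  simp only [Pi.add_apply] at s1 s2
  rw [s1, s2, i2, integral_const_mul, integral_indicator hb, ← hf.circleMass_eq c hr, zero_add]

/-! ### Circle integrals of logarithms -/

lemma circleMass_add {f₁ f₂ : ℂ → ℝ} {v₁ v₂ : ℂ → ℂ} (h₁ : IsWeakGrad f₁ v₁)
    (h₂ : IsWeakGrad f₂ v₂) (c : ℂ) (r : ℝ) :
    circleMass (fun x => f₁ x + f₂ x) (fun x => v₁ x + v₂ x) c r =
      circleMass f₁ v₁ c r + circleMass f₂ v₂ c r := by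
  have i : ∀ {f v}, IsWeakGrad f v →
      IntegrableOn (fun x => 2 * f x + inner ℝ (v x) (x - c)) (Metric.ball c r) := by
    intro f v h
    have := h.integrableOn_field (F := fun x => x - c) (contDiff_id.sub contDiff_const) c r
    simp only [dvg_sub_const, mul_comm _ (2 : ℝ)] at this
    exact this
  rw [circleMass, circleMass, circleMass, ← mul_add, ← integral_add (i h₁) (i h₂)]
  congr 2; ext x
  rw [inner_add_left]; ring

lemma circleMass_const_mul (f : ℂ → ℝ) (v : ℂ → ℂ) (a : ℝ) (c : ℂ) (r : ℝ) :
    circleMass (fun x => a * f x) (fun x => a • v x) c r = a * circleMass f v c r := by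
  rw [circleMass, circleMass, mul_left_comm, ← integral_const_mul a]
  congr 2; ext x
  rw [real_inner_smul_left]; ring

lemma circleMass_sum {n : ℕ} {f : Fin n → ℂ → ℝ} {v : Fin n → ℂ → ℂ} (s : Finset (Fin n))
    (h : ∀ k, Tame (f k) (v k)) (c : ℂ) (r : ℝ) :
    circleMass (fun x => ∑ k ∈ s, f k x) (fun x => ∑ k ∈ s, v k x) c r =
      ∑ k ∈ s, circleMass (f k) (v k) c r := by
  induction s using Finset.induction_on with
  | empty => simp [circleMass]
  | insert a s ha ih =>
    simp only [Finset.sum_insert ha]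
    rw [circleMass_add (h a).isWeakGrad (tame_sum s h).isWeakGrad, ih]

lemma volume_real_ball (c : ℂ) {r : ℝ} (hr : 0 ≤ r) :
    (volume : Measure ℂ).real (Metric.ball c r) = Real.pi * r ^ 2 := by
  rw [Measure.real, Complex.volume_ball, ENNReal.toReal_mul, ENNReal.toReal_pow,
    ENNReal.toReal_ofReal hr]
  simp [mul_comm]

lemma circleMass_const (a : ℝ) (c : ℂ) {r : ℝ} (hr : 0 < r) :
    circleMass (fun _ => a) (fun _ => 0) c r = 2 * Real.pi * a := by
  rw [circleMass]
  simp only [inner_zero_left, add_zero, setIntegral_const, volume_real_ball c hr.le, smul_eq_mul]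
  field_simp

lemma integral_radial (F : ℝ → ℝ) :
    ∫ x : ℂ, F ‖x‖ = 2 * Real.pi * ∫ y in Set.Ioi (0 : ℝ), y * F y := by
  have := integral_fun_norm_addHaar (volume : Measure ℂ) F
  rw [this, volume_real_ball 0 zero_le_one, Complex.finrank_real_complex]
  simp only [nsmul_eq_mul, smul_eq_mul]
  norm_num
  ring

/-- The gradient term of the integrand is 1 off c, so polar coordinates leave 2y ln y + y, with
primitive y² ln y. -/
lemma circleMass_log (c : ℂ) {r : ℝ} (hr : 0 < r) :
    circleMass (fun x => Real.log ‖x - c‖) (poleField c) c r = 2 * Real.pi * Real.log r := by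
  have hb : MeasurableSet (Metric.ball c r) := Metric.isOpen_ball.measurableSet
  have hne : ∀ᵐ x : ℂ, x ≠ c := by simp [ae_iff]
  have e1 : ∫ x in Metric.ball c r, (2 * Real.log ‖x - c‖ + inner ℝ (poleField c x) (x - c)) =
      ∫ x, (fun x : ℂ => (Set.Iio r).indicator (fun y => 2 * Real.log y + 1) ‖x‖) (x - c) := by
    rw [← integral_indicator hb]
    refine integral_congr_ae ?_
    filter_upwards [hne] with x hx
    have h0 : 0 < ‖x - c‖ := norm_pos_iff.2 (sub_ne_zero.2 hx)
    by_cases hxr : ‖x - c‖ < r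
    · rw [Set.indicator_of_mem (by simpa [dist_eq_norm] using hxr)]
      rw [Set.indicator_of_mem (by simpa using hxr), poleField, real_inner_smul_left,
        real_inner_self_eq_norm_sq, inv_mul_cancel₀ (by positivity)]
    · rw [Set.indicator_of_notMem (by simpa [dist_eq_norm] using hxr)]
      rw [Set.indicator_of_notMem (by simpa using hxr)]
  have hcont : Continuous fun y : ℝ => 2 * (y * Real.log y) + y :=
    (continuous_const.mul Real.continuous_mul_log).add continuous_id
  have e2 : ∫ y in (0 : ℝ)..r, (2 * (y * Real.log y) + y) = r ^ 2 * Real.log r := by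
    have := intervalIntegral.integral_eq_sub_of_hasDerivAt_of_le hr.le
      (f := fun y : ℝ => y * (y * Real.log y)) (f' := fun y => 2 * (y * Real.log y) + y)
      (continuous_id.mul Real.continuous_mul_log).continuousOn (fun y hy => by
        have h1 := (hasDerivAt_id y).mul ((hasDerivAt_id y).mul (Real.hasDerivAt_log hy.1.ne'))
        refine h1.congr_deriv ?_
        have := hy.1.ne'
        simp only [id, Pi.mul_apply]
        field_simp
        ring) (hcont.intervalIntegrable _ _)
    rw [this]; ring
  rw [circleMass, e1, integral_sub_right_eq_self
    (fun x : ℂ => (Set.Iio r).indicator (fun y => 2 * Real.log y + 1) ‖x‖), integral_radial]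
  have e3 : ∫ y in Set.Ioi (0 : ℝ), y * (Set.Iio r).indicator (fun y => 2 * Real.log y + 1) y =
      ∫ y in (0 : ℝ)..r, (2 * (y * Real.log y) + y) := by
    rw [intervalIntegral.integral_of_le hr.le, integral_Ioc_eq_integral_Ioo,
      ← Set.Ioi_inter_Iio, ← setIntegral_indicator measurableSet_Iio]
    congr 1; ext y
    by_cases hy : y ∈ Set.Iio r
    · rw [Set.indicator_of_mem hy, Set.indicator_of_mem hy]; ring
    · rw [Set.indicator_of_notMem hy, Set.indicator_of_notMem hy, mul_zero]
  rw [e3, e2]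
  field_simp

lemma tendsto_mean_small {p : ℂ → ℝ} {c : ℂ} {a : ℝ} (hp : LocallyIntegrable p volume)
    (ha : Tendsto p (𝓝 c) (𝓝 a)) :
    Tendsto (fun r : ℝ => (r ^ 2)⁻¹ * ∫ x in Metric.ball c r, p x) (𝓝[>] 0)
      (𝓝 (Real.pi * a)) := by
  rw [Metric.tendsto_nhds]
  intro δ hδ
  have hπ := Real.pi_pos
  have h1 : ∀ᶠ x in 𝓝 c, dist (p x) a < δ / (2 * Real.pi) :=
    (Metric.tendsto_nhds.1 ha) _ (by positivity)
  obtain ⟨ρ, hρ, hball⟩ := Metric.eventually_nhds_iff_ball.1 h1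
  filter_upwards [Ioo_mem_nhdsGT hρ] with r hr
  have hr0 : 0 < r := hr.1
  have ip : IntegrableOn p (Metric.ball c r) :=
    (hp.integrableOn_isCompact (isCompact_closedBall c r)).mono_set Metric.ball_subset_closedBall
  have ic : IntegrableOn (fun _ : ℂ => a) (Metric.ball c r) :=
    integrableOn_const measure_ball_lt_top.ne
  have e : (r ^ 2)⁻¹ * (∫ x in Metric.ball c r, p x) - Real.pi * a =
      (r ^ 2)⁻¹ * ∫ x in Metric.ball c r, (p x - a) := by
    rw [integral_sub ip ic, setIntegral_const, volume_real_ball c hr0.le, smul_eq_mul]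
    field_simp
  have h2 : ‖∫ x in Metric.ball c r, (p x - a)‖ ≤ δ / (2 * Real.pi) * (Real.pi * r ^ 2) := by
    rw [← volume_real_ball c hr0.le]
    refine norm_setIntegral_le_of_norm_le_const measure_ball_lt_top fun x hx => ?_
    have := hball x (Metric.ball_subset_ball hr.2.le hx)
    rw [dist_eq_norm] at this
    exact this.le
  rw [dist_eq_norm, e, norm_mul, Real.norm_of_nonneg (by positivity)]
  calc (r ^ 2)⁻¹ * ‖∫ x in Metric.ball c r, (p x - a)‖
      ≤ (r ^ 2)⁻¹ * (δ / (2 * Real.pi) * (Real.pi * r ^ 2)) := by gcongr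
    _ = δ / 2 := by field_simp
    _ < δ := by linarith

/-- The contribution of a fixed disc is washed out by r⁻², and outside it p is uniformly small. -/
lemma tendsto_mean_large {p : ℂ → ℝ} (hp : LocallyIntegrable p volume)
    (ha : Tendsto p (cocompact ℂ) (𝓝 0)) :
    Tendsto (fun r : ℝ => (r ^ 2)⁻¹ * ∫ x in Metric.ball 0 r, p x) atTop (𝓝 0) := by
  rw [Metric.tendsto_nhds]
  intro δ hδ
  have hπ := Real.pi_pos
  have h1 : ∀ᶠ x in cocompact ℂ, dist (p x) 0 < δ / (4 * Real.pi) :=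
    (Metric.tendsto_nhds.1 ha) _ (by positivity)
  rw [Metric.cobounded_eq_cocompact.symm, (Metric.hasBasis_cobounded_compl_closedBall 0).eventually_iff] at h1
  obtain ⟨ρ, -, hρ⟩ := h1
  set B := ∫ x in Metric.closedBall 0 ρ, ‖p x‖ with hB
  have hB0 : 0 ≤ B := integral_nonneg fun _ => norm_nonneg _
  have hlim : Tendsto (fun r : ℝ => (r ^ 2)⁻¹ * B) atTop (𝓝 0) := by
    have : Tendsto (fun r : ℝ => (r ^ 2)⁻¹) atTop (𝓝 0) :=
      tendsto_inv_atTop_zero.comp (tendsto_pow_atTop two_ne_zero)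
    simpa using this.mul_const B
  filter_upwards [eventually_gt_atTop 0, hlim.eventually_lt_const (half_pos hδ)] with r hr hr2
  have ip : IntegrableOn p (Metric.ball 0 r) :=
    (hp.integrableOn_isCompact (isCompact_closedBall 0 r)).mono_set Metric.ball_subset_closedBall
  have ib : Integrable ((Metric.closedBall 0 ρ).indicator fun x => ‖p x‖) :=
    (integrable_indicator_iff Metric.isClosed_closedBall.measurableSet).2
      (hp.integrableOn_isCompact (isCompact_closedBall 0 ρ)).norm
  have ic : IntegrableOn (fun _ : ℂ => δ / (4 * Real.pi)) (Metric.ball 0 r) :=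
    integrableOn_const measure_ball_lt_top.ne
  have h2 : ‖∫ x in Metric.ball 0 r, p x‖ ≤ B + δ / (4 * Real.pi) * (Real.pi * r ^ 2) := by
    calc ‖∫ x in Metric.ball 0 r, p x‖
        ≤ ∫ x in Metric.ball 0 r, ((Metric.closedBall 0 ρ).indicator (fun x => ‖p x‖) x +
            δ / (4 * Real.pi)) := by
          refine norm_integral_le_of_norm_le (ib.integrableOn.add ic) (ae_of_all _ fun x => ?_)
          by_cases hx : x ∈ Metric.closedBall 0 ρ
          · rw [Set.indicator_of_mem hx]
            have : 0 ≤ δ / (4 * Real.pi) := by positivity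
            linarith
          · rw [Set.indicator_of_notMem hx, zero_add]
            have := hρ hx
            rw [dist_zero_right] at this
            exact this.le
      _ = (∫ x in Metric.ball 0 r, (Metric.closedBall 0 ρ).indicator (fun x => ‖p x‖) x) +
            δ / (4 * Real.pi) * (Real.pi * r ^ 2) := by
          rw [integral_add ib.integrableOn ic, setIntegral_const, volume_real_ball 0 hr.le,
            smul_eq_mul, mul_comm (Real.pi * r ^ 2)]
      _ ≤ _ := by
          gcongr
          rw [hB, ← integral_indicator Metric.isClosed_closedBall.measurableSet]
          refine setIntegral_le_integral ib (ae_of_all _ fun x => ?_)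
          exact Set.indicator_nonneg (fun _ _ => norm_nonneg _) x
  rw [dist_zero_right, norm_mul, Real.norm_of_nonneg (by positivity)]
  calc (r ^ 2)⁻¹ * ‖∫ x in Metric.ball 0 r, p x‖
      ≤ (r ^ 2)⁻¹ * (B + δ / (4 * Real.pi) * (Real.pi * r ^ 2)) := by gcongr
    _ = (r ^ 2)⁻¹ * B + δ / 4 := by field_simp
    _ < δ := by linarith

lemma IsWeakGrad.locallyIntegrable_mass {f : ℂ → ℝ} {v : ℂ → ℂ} (h : IsWeakGrad f v) (c : ℂ) :
    LocallyIntegrable (fun x => 2 * f x + inner ℝ (v x) (x - c)) volume := by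
  refine (h.locallyIntegrable.smul (2 : ℝ)).add ?_
  rw [locallyIntegrable_iff]
  intro k hk
  obtain ⟨R, hR⟩ := hk.isBounded.subset_ball 0
  exact (integrable_inner_continuous_on_ball h.locallyIntegrable_grad (F := fun x => x - c)
    (by fun_prop) 0 R).mono_set hR

lemma IsWeakGrad.tendsto_circleMass_small {f : ℂ → ℝ} {v : ℂ → ℂ} (h : IsWeakGrad f v) {c : ℂ}
    (hf : ContinuousAt f c) (hv : ContinuousAt v c) :
    Tendsto (circleMass f v c) (𝓝[>] 0) (𝓝 (2 * Real.pi * f c)) := by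
  have h1 : Tendsto (fun x => 2 * f x + inner ℝ (v x) (x - c)) (𝓝 c) (𝓝 (2 * f c)) := by
    have : ContinuousAt (fun x => 2 * f x + inner ℝ (v x) (x - c)) c := by
      refine (continuousAt_const.mul hf).add (hv.inner ?_)
      fun_prop
    simpa [ContinuousAt] using this
  have := tendsto_mean_small (h.locallyIntegrable_mass c) h1
  rw [show Real.pi * (2 * f c) = 2 * Real.pi * f c by ring] at this
  exact this

lemma IsWeakGrad.tendsto_circleMass_large {f : ℂ → ℝ} {v : ℂ → ℂ} (h : IsWeakGrad f v)
    (hf : Tendsto f (cocompact ℂ) (𝓝 0))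
    (hv : Tendsto (fun x => inner ℝ (v x) x) (cocompact ℂ) (𝓝 0)) :
    Tendsto (circleMass f v 0) atTop (𝓝 0) := by
  refine tendsto_mean_large (h.locallyIntegrable_mass 0) ?_
  simpa using (hf.const_mul 2).add hv

lemma tendsto_norm_inv_cocompact : Tendsto (fun x : ℂ => ‖x‖⁻¹) (cocompact ℂ) (𝓝 0) :=
  tendsto_inv_atTop_zero.comp tendsto_norm_cocompact_atTop

lemma tendsto_log_sub_log (c : ℂ) :
    Tendsto (fun x : ℂ => Real.log ‖x - c‖ - Real.log ‖x‖) (cocompact ℂ) (𝓝 0) := by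
  have h1 : Tendsto (fun x : ℂ => ‖x - c‖ / ‖x‖) (cocompact ℂ) (𝓝 1) := by
    have h2 : Tendsto (fun x : ℂ => ‖x - c‖ / ‖x‖ - 1) (cocompact ℂ) (𝓝 0) := by
      refine squeeze_zero_norm' ?_ (by simpa using tendsto_norm_inv_cocompact.const_mul ‖c‖)
      filter_upwards [tendsto_norm_cocompact_atTop.eventually_gt_atTop 0] with x hx
      rw [div_sub_one hx.ne', norm_div, norm_norm, div_eq_mul_inv]
      gcongr
      rw [Real.norm_eq_abs]
      simpa using abs_norm_sub_norm_le (x - c) x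
    simpa using h2.add_const 1
  have h3 := h1.log one_ne_zero
  rw [Real.log_one] at h3
  refine h3.congr' ?_
  filter_upwards [tendsto_norm_cocompact_atTop.eventually_gt_atTop ‖c‖] with x hx
  have h0 : 0 < ‖x‖ := (norm_nonneg _).trans_lt hx
  have h4 : ‖x - c‖ ≠ 0 := by
    rw [norm_ne_zero_iff, sub_ne_zero]
    rintro rfl
    exact lt_irrefl _ hx
  rw [Real.log_div h4 h0.ne']

lemma tendsto_halfLog_sub_log :
    Tendsto (fun x : ℂ => halfLog x - Real.log ‖x‖) (cocompact ℂ) (𝓝 0) := by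
  have h1 : Tendsto (fun x : ℂ => 1 + ‖x‖⁻¹ ^ 2) (cocompact ℂ) (𝓝 1) := by
    simpa using (tendsto_norm_inv_cocompact.pow 2).const_add 1
  have h3 := (h1.log one_ne_zero).const_mul (1 / 2)
  rw [Real.log_one, mul_zero] at h3
  refine h3.congr' ?_
  filter_upwards [tendsto_norm_cocompact_atTop.eventually_gt_atTop 0] with x hx
  have e : 1 + ‖x‖⁻¹ ^ 2 = (1 + ‖x‖ ^ 2) / ‖x‖ ^ 2 := by field_simp; ring
  rw [e, Real.log_div (by positivity) (by positivity), Real.log_pow, halfLog]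
  push_cast; ring

lemma tendsto_inner_pole_sub_round (c : ℂ) :
    Tendsto (fun x : ℂ => inner ℝ (poleField c x - roundField x) x) (cocompact ℂ) (𝓝 0) := by
  refine squeeze_zero_norm' ?_ (by
    simpa using tendsto_norm_inv_cocompact.const_mul ((1 + ‖c‖ ^ 2) / 1 + ‖c‖))
  filter_upwards [tendsto_norm_cocompact_atTop.eventually_ge_atTop (1 + ‖c‖)] with x hx
  have h1 : 1 ≤ ‖x - c‖ := by
    have := norm_sub_norm_le x c
    linarith
  have h0 : 0 < ‖x‖ := by have := norm_nonneg c; linarith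
  refine (norm_inner_le_norm _ _).trans ?_
  calc ‖poleField c x - roundField x‖ * ‖x‖
      ≤ ((1 + ‖c‖ ^ 2) / 1 + ‖c‖) * (1 + ‖x‖ ^ 2)⁻¹ * ‖x‖ := by
        gcongr
        exact norm_poleField_sub_roundField one_pos h1
    _ = ((1 + ‖c‖ ^ 2) / 1 + ‖c‖) * ((1 + ‖x‖ ^ 2)⁻¹ * ‖x‖) := by ring
    _ ≤ _ := by
        gcongr
        rw [inv_mul_le_iff₀ (by positivity), ← div_eq_mul_inv, le_div_iff₀ h0]
        nlinarith

/-! ### Potential and moments of the round metric -/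

lemma Tame.sub {f₁ f₂ : ℂ → ℝ} {v₁ v₂ : ℂ → ℂ} (h₁ : Tame f₁ v₁) (h₂ : Tame f₂ v₂) :
    Tame (fun x => f₁ x - f₂ x) (fun x => v₁ x - v₂ x) := by
  have := h₁.add (h₂.const_mul (-1))
  simpa only [neg_mul, one_mul, neg_smul, one_smul, ← sub_eq_add_neg] using this

/-- `ln |x - c| - ln |x|` and its gradient decay at infinity. -/
lemma tendsto_circleMass_log_sub_halfLog (c : ℂ) :
    Tendsto (circleMass (fun x => Real.log ‖x - c‖ - halfLog x)
      (fun x => poleField c x - roundField x) 0) atTop (𝓝 0) := by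
  refine ((tame_log c).sub tame_halfLog).isWeakGrad.tendsto_circleMass_large ?_
    (tendsto_inner_pole_sub_round c)
  have := (tendsto_log_sub_log c).sub tendsto_halfLog_sub_log
  simpa using this

lemma norm_roundField_le_one (x : ℂ) : ‖roundField x‖ ≤ 1 := by
  rw [roundField, norm_smul, norm_inv, Real.norm_of_nonneg (by positivity),
    inv_mul_le_iff₀ (by positivity)]
  nlinarith [sq_nonneg (‖x‖ - 1)]

/-- The logarithmic potential of the round metric. -/
lemma integral_log_mul_g (c : ℂ) :
    ∫ x, Real.log ‖x - c‖ * g x = 4 * Real.pi * halfLog c := by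
  -- Green's symmetry: the Dirichlet pairing of ln|x - c| - `halfLog` with `halfLog` is evaluated
  -- twice. Large circles about 0 make the truncated pole disappear; small circles about c turn it
  -- into the full pole. Comparing the two values gives the integral.
  set v₁ : ℂ → ℂ := fun x => poleField c x - roundField x with hv₁
  have t₁ : Tame (fun x => Real.log ‖x - c‖ - halfLog x) v₁ := (tame_log c).sub tame_halfLog
  have hne : ∀ᵐ x : ℂ, x ≠ c := by simp [ae_iff]
  obtain ⟨C₀, hC₀, hC₀b⟩ := exists_bound_on_ball (continuous_const (y := (1 : ℝ)))
    (ρ := fun x : ℂ => (1 + ‖x‖ ^ 2)⁻¹)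
    (Continuous.inv₀ (by fun_prop) fun x => (one_add_normSq_pos x).ne') (fun x => by positivity) c 1
  simp only [norm_one] at hC₀b
  set C₁ := (1 + ‖c‖ ^ 2) / 1 + ‖c‖ with hC₁
  have hC₁0 : 0 ≤ C₁ := by positivity
  have hv₁b : ∀ x, 1 ≤ ‖x - c‖ → ‖v₁ x‖ ≤ C₁ * (1 + ‖x‖ ^ 2)⁻¹ := fun x hx =>
    norm_poleField_sub_roundField one_pos hx
  -- Near c the weight (1+|x|²)⁻¹ dominates the round field up to a constant, away from c it
  -- dominates v₁; so the product of the two gradients is integrable even though v₁ has a pole.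
  set D : ℂ → ℝ := fun x => C₁ * (‖roundField x‖ * (1 + ‖x‖ ^ 2)⁻¹) +
    C₀ * (‖v₁ x‖ * (1 + ‖x‖ ^ 2)⁻¹) with hD
  have iD : Integrable D :=
    (tame_halfLog.grad_integrable.const_mul _).add (t₁.grad_integrable.const_mul _)
  have hDb : ∀ x, ‖v₁ x‖ * ‖roundField x‖ ≤ D x := by
    intro x
    rcases lt_or_ge ‖x - c‖ 1 with h | h
    · have h1 := hC₀b x (by rw [Metric.mem_closedBall, dist_eq_norm]; exact h.le)
      have h2 : ‖v₁ x‖ * ‖roundField x‖ ≤ ‖v₁ x‖ * (C₀ * (1 + ‖x‖ ^ 2)⁻¹) := by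
        gcongr
        exact (norm_roundField_le_one x).trans h1
      have h3 : 0 ≤ C₁ * (‖roundField x‖ * (1 + ‖x‖ ^ 2)⁻¹) := by positivity
      simp only [hD]; linarith
    · have h2 : ‖v₁ x‖ * ‖roundField x‖ ≤ C₁ * (1 + ‖x‖ ^ 2)⁻¹ * ‖roundField x‖ := by
        gcongr
        exact hv₁b x h
      have h3 : 0 ≤ C₀ * (‖v₁ x‖ * (1 + ‖x‖ ^ 2)⁻¹) := by positivity
      simp only [hD]; linarith
  have hmb : ∀ (a : ℂ) (r : ℝ), MeasurableSet (Metric.ball a r)ᶜ := fun a r =>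
    Metric.isOpen_ball.measurableSet.compl
  have hroundm : AEStronglyMeasurable roundField volume :=
    contDiff_roundField.continuous.aestronglyMeasurable
  -- the flux of `f₁` through large circles
  have lim1 : Tendsto (fun R : ℝ => ∫ x, inner ℝ (v₁ x)
      ((Metric.ball 0 R)ᶜ.indicator (poleField 0) x - roundField x)) atTop
      (𝓝 (∫ x, inner ℝ (v₁ x) (-roundField x))) := by
    refine tendsto_integral_filter_of_dominated_convergence
      (fun x => D x + 1 * (‖v₁ x‖ * (1 + ‖x‖ ^ 2)⁻¹)) ?_ ?_
      (iD.add (t₁.grad_integrable.const_mul _)) ?_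
    · filter_upwards [eventually_gt_atTop 0] with R hR
      exact (t₁.integral_flux 0 hR).1.aestronglyMeasurable
    · filter_upwards [eventually_ge_atTop 1] with R hR
      refine ae_of_all _ fun x => (norm_inner_le_norm _ _).trans ?_
      by_cases hx : x ∈ Metric.ball 0 R
      · rw [Set.indicator_of_notMem (by simpa using hx), zero_sub, norm_neg]
        have : 0 ≤ 1 * (‖v₁ x‖ * (1 + ‖x‖ ^ 2)⁻¹) := by positivity
        linarith [hDb x]
      · rw [Set.indicator_of_mem (by simpa using hx)]
        have h1 : 1 ≤ ‖x - 0‖ := by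
          rw [Metric.mem_ball, dist_eq_norm, not_lt] at hx
          linarith
        have h2 := norm_poleField_sub_roundField one_pos h1
        simp only [norm_zero] at h2
        have h3 : ‖v₁ x‖ * ‖poleField 0 x - roundField x‖ ≤
            ‖v₁ x‖ * (((1 + 0 ^ 2) / 1 + 0) * (1 + ‖x‖ ^ 2)⁻¹) := by gcongr
        have h4 : 0 ≤ D x := le_trans (by positivity) (hDb x)
        norm_num at h3
        linarith
    · refine ae_of_all _ fun x => tendsto_const_nhds.congr' ?_
      filter_upwards [eventually_gt_atTop ‖x‖] with R hR
      rw [Set.indicator_of_notMem (by simpa using hR), zero_sub]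
  have lim1' : Tendsto (fun R : ℝ => ∫ x, inner ℝ (v₁ x)
      ((Metric.ball 0 R)ᶜ.indicator (poleField 0) x - roundField x)) atTop
      (𝓝 (1 / 2 * (∫ x, (Real.log ‖x - c‖ - halfLog x) * g x) - 0)) := by
    refine (tendsto_const_nhds.sub (tendsto_circleMass_log_sub_halfLog c)).congr' ?_
    filter_upwards [eventually_gt_atTop 0] with R hR
    exact (t₁.integral_flux 0 hR).2.symm
  have eq1 := tendsto_nhds_unique lim1 lim1'
  -- the flux of `halfLog` through small circles
  have lim2 : Tendsto (fun r : ℝ => ∫ x, inner ℝ (roundField x)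
      ((Metric.ball c r)ᶜ.indicator (poleField c) x - roundField x)) (𝓝[>] 0)
      (𝓝 (∫ x, inner ℝ (roundField x) (v₁ x))) := by
    refine tendsto_integral_filter_of_dominated_convergence
      (fun x => D x + C₀ * (‖roundField x‖ * (1 + ‖x‖ ^ 2)⁻¹)) ?_ ?_
      (iD.add (tame_halfLog.grad_integrable.const_mul _)) ?_
    · filter_upwards [self_mem_nhdsWithin] with r hr
      exact (tame_halfLog.integral_flux c hr).1.aestronglyMeasurable
    · filter_upwards [Ioo_mem_nhdsGT one_pos] with r hr
      refine ae_of_all _ fun x => (norm_inner_le_norm _ _).trans ?_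
      by_cases hx : x ∈ Metric.ball c r
      · rw [Set.indicator_of_notMem (by simpa using hx), zero_sub, norm_neg]
        have h1 := hC₀b x (Metric.closedBall_subset_closedBall hr.2.le
          (Metric.ball_subset_closedBall hx))
        have h4 : 0 ≤ D x := le_trans (by positivity) (hDb x)
        have h5 : ‖roundField x‖ * ‖roundField x‖ ≤
            ‖roundField x‖ * (C₀ * (1 + ‖x‖ ^ 2)⁻¹) := by
          gcongr
          exact (norm_roundField_le_one x).trans h1
        linarith
      · rw [Set.indicator_of_mem (by simpa using hx)]
        have h5 : 0 ≤ C₀ * (‖roundField x‖ * (1 + ‖x‖ ^ 2)⁻¹) := by positivity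
        have := hDb x
        rw [mul_comm]
        linarith
    · filter_upwards [hne] with x hx
      refine tendsto_const_nhds.congr' ?_
      have h0 : 0 < ‖x - c‖ := norm_pos_iff.2 (sub_ne_zero.2 hx)
      filter_upwards [Ioo_mem_nhdsGT h0] with r hr
      rw [Set.indicator_of_mem]
      simpa [dist_eq_norm] using hr.2.le
  have lim2' : Tendsto (fun r : ℝ => ∫ x, inner ℝ (roundField x)
      ((Metric.ball c r)ᶜ.indicator (poleField c) x - roundField x)) (𝓝[>] 0)
      (𝓝 (1 / 2 * (∫ x, halfLog x * g x) - 2 * Real.pi * halfLog c)) := by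
    refine (tendsto_const_nhds.sub (tame_halfLog.isWeakGrad.tendsto_circleMass_small
      continuous_halfLog.continuousAt contDiff_roundField.continuous.continuousAt)).congr' ?_
    filter_upwards [self_mem_nhdsWithin] with r hr
    exact (tame_halfLog.integral_flux c hr).2.symm
  have eq2 := tendsto_nhds_unique lim2 lim2'
  have e3 : ∫ x, inner ℝ (v₁ x) (-roundField x) = - ∫ x, inner ℝ (roundField x) (v₁ x) := by
    rw [← integral_neg]
    congr 1; ext x
    rw [inner_neg_right, real_inner_comm]
  have e4 : ∫ x, (Real.log ‖x - c‖ - halfLog x) * g x =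
      (∫ x, Real.log ‖x - c‖ * g x) - ∫ x, halfLog x * g x := by
    rw [← integral_sub (tame_log c).integrable_mul_g tame_halfLog.integrable_mul_g]
    congr 1; ext x; ring
  rw [e3, eq2, e4] at eq1
  linarith

lemma integral_g : ∫ x, g x = 4 * Real.pi := by
  have h := integral_radial fun y => 4 / (1 + y ^ 2) ^ 2
  have hd : ∀ y : ℝ, HasDerivAt (fun y : ℝ => -2 / (1 + y ^ 2)) (y * (4 / (1 + y ^ 2) ^ 2)) y := by
    intro y
    have h1 : HasDerivAt (fun y : ℝ => 1 + y ^ 2) (2 * y) y := by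
      simpa using (hasDerivAt_pow 2 y).const_add 1
    refine ((hasDerivAt_const y (-2 : ℝ)).div h1 (by positivity)).congr_deriv ?_
    field_simp
    ring
  have ht : Tendsto (fun y : ℝ => -2 / (1 + y ^ 2)) atTop (𝓝 0) :=
    tendsto_const_nhds.div_atTop (tendsto_const_nhds.add_atTop (tendsto_pow_atTop two_ne_zero))
  have := integral_Ioi_of_hasDerivAt_of_nonneg (a := 0) (hd 0).continuousAt.continuousWithinAt
    (fun y _ => hd y) (fun y hy => by have : (0 : ℝ) < y := hy; positivity) ht
  unfold g
  rw [h, this]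
  norm_num
  ring

/-- The mean value 1/2 of `halfLog` is the origin of the -1/2 in κ: it is what gives G vanishing
mean against g. -/
lemma integral_halfLog_mul_g : ∫ x, halfLog x * g x = 2 * Real.pi := by
  have h := integral_radial fun y => 1 / 2 * Real.log (1 + y ^ 2) * (4 / (1 + y ^ 2) ^ 2)
  have hd : ∀ y : ℝ, HasDerivAt (fun y : ℝ => -(Real.log (1 + y ^ 2) + 1) / (1 + y ^ 2))
      (y * (1 / 2 * Real.log (1 + y ^ 2) * (4 / (1 + y ^ 2) ^ 2))) y := by
    intro y
    have h1 : HasDerivAt (fun y : ℝ => 1 + y ^ 2) (2 * y) y := by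
      simpa using (hasDerivAt_pow 2 y).const_add 1
    have h0 : 0 < 1 + y ^ 2 := by positivity
    refine ((((h1.log h0.ne').add_const 1).neg).div h1 h0.ne').congr_deriv ?_
    simp only [Pi.neg_apply]
    field_simp
    ring
  have ht : Tendsto (fun y : ℝ => -(Real.log (1 + y ^ 2) + 1) / (1 + y ^ 2)) atTop (𝓝 0) := by
    have h1 : Tendsto (fun t : ℝ => -(Real.log t + 1) / t) atTop (𝓝 0) := by
      have h2 : Tendsto (fun t : ℝ => Real.log t / t) atTop (𝓝 0) :=
        Real.isLittleO_log_id_atTop.tendsto_div_nhds_zero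
      have h3 := (h2.add tendsto_inv_atTop_zero).neg
      simp only [add_zero, neg_zero] at h3
      refine h3.congr fun t => ?_
      rw [← one_div, ← add_div, neg_div]
    exact h1.comp (tendsto_const_nhds.add_atTop (tendsto_pow_atTop two_ne_zero))
  have := integral_Ioi_of_hasDerivAt_of_nonneg (a := 0) (hd 0).continuousAt.continuousWithinAt
    (fun y _ => hd y) (fun y hy => by
      have : (0 : ℝ) < y := hy
      have : 0 ≤ Real.log (1 + y ^ 2) := Real.log_nonneg (by nlinarith)
      positivity) ht
  unfold g halfLog
  rw [h, this]
  norm_num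

/-! ### Exponential integrability of Sobolev functions -/

open scoped ENNReal NNReal in
/-- The constant of the planar Gagliardo–Nirenberg–Sobolev inequality. -/
def gnsConst : ℝ≥0 := eLpNormLESNormFDerivOneConst (volume : Measure ℂ) 2

open scoped ENNReal NNReal in
lemma lintegral_sq_le_gns {f : ℂ → ℝ} (hf : ContDiff ℝ 1 f) (hs : HasCompactSupport f) :
    ∫⁻ x, ‖f x‖ₑ ^ 2 ≤ (gnsConst * ∫⁻ x, ‖fderiv ℝ f x‖ₑ) ^ 2 := by
  have h := eLpNorm_le_eLpNorm_fderiv_one (volume : Measure ℂ) hf hs (p := 2) (by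
    rw [Complex.finrank_real_complex]
    exact_mod_cast NNReal.HolderConjugate.two_two)
  rw [eLpNorm_one_eq_lintegral_enorm] at h
  have h2 := eLpNorm_nnreal_pow_eq_lintegral (μ := (volume : Measure ℂ)) (f := f) (p := 2)
    two_ne_zero
  norm_num at h2
  rw [← h2]
  exact pow_le_pow_left' h 2

open scoped ENNReal in
lemma lintegral_mul_sq_le {α : Type*} [MeasurableSpace α] (μ : Measure α) {a b : α → ℝ≥0∞}
    (ha : AEMeasurable a μ) (hb : AEMeasurable b μ) :
    (∫⁻ x, a x * b x ∂μ) ^ 2 ≤ (∫⁻ x, a x ^ 2 ∂μ) * ∫⁻ x, b x ^ 2 ∂μ := by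
  have h := ENNReal.lintegral_mul_le_Lp_mul_Lq μ Real.HolderConjugate.two_two ha hb
  have e : ∀ t : ℝ≥0∞, (t ^ (1 / 2 : ℝ)) ^ 2 = t := fun t => by
    rw [← ENNReal.rpow_natCast, ← ENNReal.rpow_mul]; norm_num
  calc (∫⁻ x, a x * b x ∂μ) ^ 2
      ≤ ((∫⁻ x, a x ^ (2 : ℝ) ∂μ) ^ (1 / 2 : ℝ) * (∫⁻ x, b x ^ (2 : ℝ) ∂μ) ^ (1 / 2 : ℝ)) ^ 2 :=
        pow_le_pow_left' h 2
    _ = _ := by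
        rw [mul_pow, e, e]
        simp only [ENNReal.rpow_ofNat]

open scoped ENNReal in
-- The Sobolev inequality is applied to u^(m+1), whose gradient is (m+1) u^m ∇u, and Cauchy–Schwarz
-- splits off the Dirichlet energy.
lemma lintegral_pow_succ_le {u : ℂ → ℝ} (hu : ContDiff ℝ 1 u) {K : Set ℂ} (hK : IsCompact K)
    (hs : ∀ x ∉ K, u x = 0) (m : ℕ) :
    ∫⁻ x in K, ‖u x‖ₑ ^ (2 * (m + 1)) ≤
      (gnsConst : ℝ≥0∞) ^ 2 * (m + 1) ^ 2 * (∫⁻ x, ‖fderiv ℝ u x‖ₑ ^ 2) *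
        ∫⁻ x in K, ‖u x‖ₑ ^ (2 * m) := by
  have hKm : MeasurableSet K := hK.measurableSet
  have hcs : HasCompactSupport u := HasCompactSupport.intro hK hs
  have hcs' : HasCompactSupport (fun x => u x ^ (m + 1)) :=
    hcs.comp_left (g := fun t : ℝ => t ^ (m + 1)) (by simp)
  have h1 := lintegral_sq_le_gns (hu.pow (m + 1)) hcs'
  have hd : ∀ x, fderiv ℝ (fun x => u x ^ (m + 1)) x =
      ((m + 1 : ℝ) * u x ^ m) • fderiv ℝ u x := by
    intro x
    have := ((hu.differentiable (by simp) x).hasFDerivAt.pow (m + 1)).fderiv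
    rw [this]
    simp
  have hae : ∀ᵐ x, x ∉ K → fderiv ℝ u x = 0 := by
    refine ae_of_all _ fun x hx => ?_
    have : u =ᶠ[𝓝 x] fun _ => 0 := by
      filter_upwards [hK.isClosed.isOpen_compl.mem_nhds hx] with y hy
      exact hs y hy
    rw [this.fderiv_eq]; simp
  have h2 : ∫⁻ x, ‖fderiv ℝ (fun x => u x ^ (m + 1)) x‖ₑ =
      (m + 1) * ∫⁻ x in K, ‖u x‖ₑ ^ m * ‖fderiv ℝ u x‖ₑ := by
    rw [← lintegral_const_mul' _ _ (by finiteness), ← lintegral_indicator hKm]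
    refine lintegral_congr_ae ?_
    filter_upwards [hae] with x hx
    rw [hd]
    by_cases hxK : x ∈ K
    · rw [Set.indicator_of_mem hxK, enorm_smul, enorm_mul, enorm_pow, mul_assoc]
      congr 1
      rw [Real.enorm_of_nonneg (by positivity)]
      exact_mod_cast ENNReal.ofReal_natCast (m + 1)
    · rw [Set.indicator_of_notMem hxK, hx hxK, smul_zero]
      simp [enorm]
  have h3 := lintegral_mul_sq_le (volume.restrict K) (a := fun x => ‖u x‖ₑ ^ m)
    (b := fun x => ‖fderiv ℝ u x‖ₑ)
    ((hu.continuous.enorm.measurable.pow_const m).aemeasurable)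
    ((hu.continuous_fderiv (by simp)).enorm.measurable.aemeasurable)
  calc ∫⁻ x in K, ‖u x‖ₑ ^ (2 * (m + 1))
      = ∫⁻ x in K, ‖u x ^ (m + 1)‖ₑ ^ 2 := by
        simp only [enorm_pow, ← pow_mul, mul_comm]
    _ ≤ ∫⁻ x, ‖u x ^ (m + 1)‖ₑ ^ 2 := setLIntegral_le_lintegral _ _
    _ ≤ _ := h1
    _ = gnsConst ^ 2 * (m + 1) ^ 2 * (∫⁻ x in K, ‖u x‖ₑ ^ m * ‖fderiv ℝ u x‖ₑ) ^ 2 := by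
        rw [h2]; ring
    _ ≤ gnsConst ^ 2 * (m + 1) ^ 2 * ((∫⁻ x in K, (‖u x‖ₑ ^ m) ^ 2) *
          ∫⁻ x in K, ‖fderiv ℝ u x‖ₑ ^ 2) := by gcongr
    _ ≤ gnsConst ^ 2 * (m + 1) ^ 2 * ((∫⁻ x in K, (‖u x‖ₑ ^ m) ^ 2) *
          ∫⁻ x, ‖fderiv ℝ u x‖ₑ ^ 2) := by
        gcongr
        exact Measure.restrict_le_self
    _ = _ := by
        simp only [← pow_mul, mul_comm m 2]
        ring

open scoped ENNReal in
-- Iteration of the previous bound. The growth (m!)² is harmless because the exponential series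
-- divides the moment of order 2m by (2m)!.
lemma lintegral_pow_le {u : ℂ → ℝ} (hu : ContDiff ℝ 1 u) {K : Set ℂ} (hK : IsCompact K)
    (hs : ∀ x ∉ K, u x = 0) (m : ℕ) :
    ∫⁻ x in K, ‖u x‖ₑ ^ (2 * m) ≤
      ((gnsConst : ℝ≥0∞) ^ 2 * ∫⁻ x, ‖fderiv ℝ u x‖ₑ ^ 2) ^ m * (m.factorial : ℝ≥0∞) ^ 2 *
        volume K := by
  induction m with
  | zero => simp
  | succ m ih =>
    refine (lintegral_pow_succ_le hu hK hs m).trans ?_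
    refine (mul_le_mul_right ih _).trans (le_of_eq ?_)
    rw [Nat.factorial_succ]
    push_cast
    ring

open scoped ENNReal in
/-- A Trudinger-type inequality for smooth functions with small Dirichlet energy. -/
lemma lintegral_exp_le {u : ℂ → ℝ} (hu : ContDiff ℝ 1 u) {K : Set ℂ} (hK : IsCompact K)
    (hs : ∀ x ∉ K, u x = 0) {q : ℝ}
    (hq : ENNReal.ofReal (q ^ 2) * ((gnsConst : ℝ≥0∞) ^ 2 * ∫⁻ x, ‖fderiv ℝ u x‖ₑ ^ 2) ≤ 2⁻¹) :
    ∫⁻ x in K, ENNReal.ofReal (Real.exp (q * |u x|)) ≤ 4 * volume K := by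
  set D := (gnsConst : ℝ≥0∞) ^ 2 * ∫⁻ x, ‖fderiv ℝ u x‖ₑ ^ 2
  -- The bound exp ≤ 2 cosh leaves even moments only. With (m!)² ≤ (2m)! and the smallness
  -- assumption, the series is dominated by a geometric one of ratio 1/2, whence the constant 2 · 2
  -- = 4.
  have h1 : ∀ x, ENNReal.ofReal (Real.exp (q * |u x|)) ≤
      2 * ∑' m : ℕ, ENNReal.ofReal ((q ^ 2) ^ m / (2 * m).factorial) * ‖u x‖ₑ ^ (2 * m) := by
    intro x
    have hc := Real.hasSum_cosh (q * |u x|)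
    have e1 : ∀ m : ℕ, (q * |u x|) ^ (2 * m) / ((2 * m).factorial : ℝ) =
        (q ^ 2) ^ m / (2 * m).factorial * |u x| ^ (2 * m) := fun m => by
      rw [mul_pow, pow_mul q]; ring
    simp only [e1] at hc
    have hnn : ∀ m : ℕ, 0 ≤ (q ^ 2) ^ m / (2 * m).factorial * |u x| ^ (2 * m) := fun m => by
      positivity
    have e2 : ∑' m : ℕ, ENNReal.ofReal ((q ^ 2) ^ m / (2 * m).factorial) * ‖u x‖ₑ ^ (2 * m) =
        ENNReal.ofReal (Real.cosh (q * |u x|)) := by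
      rw [← hc.tsum_eq, ENNReal.ofReal_tsum_of_nonneg hnn hc.summable]
      congr 1; ext m
      rw [ENNReal.ofReal_mul (by positivity), ENNReal.ofReal_pow (abs_nonneg _),
        ← Real.enorm_eq_ofReal_abs]
    rw [e2, ← ENNReal.ofReal_ofNat 2, ← ENNReal.ofReal_mul (by norm_num)]
    refine ENNReal.ofReal_le_ofReal ?_
    rw [Real.cosh_eq]
    have := Real.exp_pos (-(q * |u x|))
    linarith
  have hmeas : ∀ m : ℕ, Measurable fun x => ENNReal.ofReal ((q ^ 2) ^ m / (2 * m).factorial) *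
      ‖u x‖ₑ ^ (2 * m) := fun m => (hu.continuous.enorm.measurable.pow_const _).const_mul _
  calc ∫⁻ x in K, ENNReal.ofReal (Real.exp (q * |u x|))
      ≤ ∫⁻ x in K, 2 * ∑' m : ℕ, ENNReal.ofReal ((q ^ 2) ^ m / (2 * m).factorial) *
          ‖u x‖ₑ ^ (2 * m) := lintegral_mono fun x => h1 x
    _ = 2 * ∑' m : ℕ, ENNReal.ofReal ((q ^ 2) ^ m / (2 * m).factorial) *
          ∫⁻ x in K, ‖u x‖ₑ ^ (2 * m) := by
        rw [lintegral_const_mul' _ _ (by finiteness),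
          lintegral_tsum fun m => (hmeas m).aemeasurable]
        congr 2; ext m
        rw [lintegral_const_mul' _ _ (by finiteness)]
    _ ≤ 2 * ∑' m : ℕ, (2⁻¹ : ℝ≥0∞) ^ m * volume K := by
        refine mul_le_mul_right (ENNReal.tsum_le_tsum fun m => ?_) _
        refine (mul_le_mul_right (lintegral_pow_le hu hK hs m) _).trans ?_
        rw [← mul_assoc, ← mul_assoc]
        refine mul_le_mul_left ?_ _
        have e3 : ENNReal.ofReal ((q ^ 2) ^ m / (2 * m).factorial) * D ^ m *
            (m.factorial : ℝ≥0∞) ^ 2 = (ENNReal.ofReal (q ^ 2) * D) ^ m *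
            ((m.factorial : ℝ≥0∞) ^ 2 * ENNReal.ofReal (1 / (2 * m).factorial)) := by
          rw [div_eq_mul_one_div, ENNReal.ofReal_mul (by positivity),
            ENNReal.ofReal_pow (by positivity)]
          ring
        rw [e3]
        have e4 : (m.factorial : ℝ≥0∞) ^ 2 * ENNReal.ofReal (1 / (2 * m).factorial) ≤ 1 := by
          have : (m.factorial : ℝ≥0∞) ^ 2 = ENNReal.ofReal ((m.factorial : ℝ) ^ 2) := by
            rw [ENNReal.ofReal_pow (by positivity), ENNReal.ofReal_natCast]
          rw [this, ← ENNReal.ofReal_mul (by positivity), ENNReal.ofReal_le_one, mul_one_div,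
            div_le_one (by positivity)]
          have := Nat.le_of_dvd (Nat.factorial_pos _)
            (Nat.factorial_mul_factorial_dvd_factorial_add m m)
          rw [two_mul, sq]
          exact_mod_cast this
        calc _ ≤ (2⁻¹ : ℝ≥0∞) ^ m * 1 := by gcongr
          _ = _ := mul_one _
    _ = 4 * volume K := by
        rw [ENNReal.tsum_mul_right, ENNReal.tsum_geometric, ENNReal.one_sub_inv_two, inv_inv,
          ← mul_assoc]
        norm_num

/-! ### Mollification -/

open scoped ENNReal in
-- Translations act continuously on L².
lemma exists_translation_bound {v : ℂ → ℂ} (hv : MemLp v 2) {ε : ℝ≥0∞}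
    (hε : 0 < ε) : ∃ δ > 0, ∀ t : ℂ, ‖t‖ < δ → ∫⁻ x, ‖v (x - t) - v x‖ₑ ^ 2 ≤ ε := by
  have : Fact ((1 : ℝ≥0∞) ≤ 2) := ⟨one_le_two⟩
  have hmp : ∀ t : ℂ, MeasurePreserving (fun x : ℂ => x - t) volume volume := fun t =>
    measurePreserving_sub_right volume t
  let gt : ℂ → C(ℂ, ℂ) := fun t => ⟨fun x => x - t, by fun_prop⟩
  have hg : Continuous gt := by
    refine ContinuousMap.continuous_of_continuous_uncurry _ ?_
    change Continuous fun p : ℂ × ℂ => p.2 - p.1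
    fun_prop
  have hc : Continuous fun t => Lp.compMeasurePreserving (gt t) (hmp t) hv.toLp :=
    Continuous.compMeasurePreservingLp continuous_const hg hmp (by norm_num)
  have ht := hc.tendsto 0
  rw [EMetric.tendsto_nhds] at ht
  obtain ⟨η, hη0, hη⟩ : ∃ η : ℝ≥0∞, 0 < η ∧ η ^ 2 ≤ ε := by
    refine ⟨min 1 ε, lt_min one_pos hε, ?_⟩
    rw [sq]
    exact (mul_le_mul' (min_le_left _ _) (min_le_right _ _)).trans (by simp)
  obtain ⟨δ, hδ, hδ'⟩ := Metric.eventually_nhds_iff.1 (ht η hη0)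
  refine ⟨δ, hδ, fun t ht => ?_⟩
  have h1 := hδ' (by simpa using ht : dist t 0 < δ)
  rw [Lp.edist_def] at h1
  have hcoe : ∀ s : ℂ, (Lp.compMeasurePreserving (gt s) (hmp s) hv.toLp : ℂ → ℂ) =ᵐ[volume]
      fun x => v (x - s) := by
    intro s
    have a1 := Lp.coeFn_compMeasurePreserving hv.toLp (hmp s)
    have a2 := (hmp s).quasiMeasurePreserving.ae_eq_comp hv.coeFn_toLp
    exact a1.trans a2
  have h2 : eLpNorm (fun x => v (x - t) - v x) 2 volume < η := by
    refine lt_of_eq_of_lt (eLpNorm_congr_ae ?_) h1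
    filter_upwards [hcoe t, hcoe 0] with x hx hx0
    rw [Pi.sub_apply, hx, hx0, sub_zero]
  have h3 := eLpNorm_nnreal_pow_eq_lintegral (μ := (volume : Measure ℂ))
    (f := fun x => v (x - t) - v x) (p := 2) two_ne_zero
  norm_num at h3
  rw [← h3]
  exact (pow_le_pow_left' h2.le 2).trans hη

/-- Convolution with a real kernel. -/
def moll {E : Type*} [NormedAddCommGroup E] [NormedSpace ℝ E] (φ : ℂ → ℝ) (f : ℂ → E) (x : ℂ) : E :=
  ∫ t, φ (x - t) • f t

lemma integrable_moll {E : Type*} [NormedAddCommGroup E] [NormedSpace ℝ E] {φ : ℂ → ℝ} {f : ℂ → E}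
    (hφ : Continuous φ) (hs : HasCompactSupport φ) (hf : LocallyIntegrable f volume) (x : ℂ) :
    Integrable (fun t => φ (x - t) • f t) :=
  hf.integrable_smul_left_of_hasCompactSupport (by fun_prop)
    (hs.comp_homeomorph (Homeomorph.subLeft x))

open scoped ENNReal in
-- The mollification error is an average, against a probability density, of differences between v
-- and its translates. Cauchy–Schwarz bounds the squared average by the average of squares, and
-- Tonelli exchanges the integrals.
lemma lintegral_moll_sub_le {v : ℂ → ℂ} (hm : Measurable v) (hv : LocallyIntegrable v volume)
    (φ : ContDiffBump (0 : ℂ)) {ε : ℝ≥0∞}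
    (hε : ∀ t : ℂ, ‖t‖ < φ.rOut → ∫⁻ x, ‖v (x - t) - v x‖ₑ ^ 2 ≤ ε) :
    ∫⁻ x, ‖moll (φ.normed volume) v x - v x‖ₑ ^ 2 ≤ ε := by
  set ρ := φ.normed (volume : Measure ℂ) with hρ
  have hρc : Continuous ρ := φ.continuous_normed
  have hρs : HasCompactSupport ρ := φ.hasCompactSupport_normed
  have hρ1 : ∫⁻ t, ‖ρ t‖ₑ = 1 := by
    have := ofReal_integral_eq_lintegral_ofReal (φ.integrable_normed (μ := volume))
      (ae_of_all _ fun t => φ.nonneg_normed t)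
    rw [φ.integral_normed, ENNReal.ofReal_one] at this
    rw [this]
    congr 1; ext t
    exact Real.enorm_of_nonneg (φ.nonneg_normed t)
  have e1 : ∀ x, moll ρ v x - v x = ∫ t, ρ t • (v (x - t) - v x) := by
    intro x
    have i1 : Integrable fun t => ρ t • v (x - t) := by
      have := (integrable_moll hρc hρs hv x).comp_sub_left x
      simpa using this
    have i2 : Integrable fun t => ρ t • v x := φ.integrable_normed.smul_const _
    simp only [smul_sub]
    rw [integral_sub i1 i2, hρ, φ.integral_normed_smul, moll]
    congr 1
    have := integral_sub_left_eq_self (fun t => ρ (x - t) • v t) volume x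
    rw [← this]
    simp only [sub_sub_cancel, hρ]
  have e2 : ∀ x, ‖moll ρ v x - v x‖ₑ ^ 2 ≤ ∫⁻ t, ‖ρ t‖ₑ * ‖v (x - t) - v x‖ₑ ^ 2 := by
    intro x
    have h1 : ‖moll ρ v x - v x‖ₑ ≤
        ∫⁻ t, ‖ρ t‖ₑ ^ (1 / 2 : ℝ) * (‖ρ t‖ₑ ^ (1 / 2 : ℝ) * ‖v (x - t) - v x‖ₑ) := by
      rw [e1]
      refine (enorm_integral_le_lintegral_enorm _).trans (le_of_eq ?_)
      congr 1; ext t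
      rw [← mul_assoc, ← ENNReal.rpow_add_of_nonneg _ _ (by norm_num) (by norm_num), enorm_smul]
      norm_num
    have e : ∀ s : ℝ≥0∞, (s ^ (1 / 2 : ℝ)) ^ 2 = s := fun s => by
      rw [← ENNReal.rpow_natCast, ← ENNReal.rpow_mul]; norm_num
    have h2 := lintegral_mul_sq_le (volume : Measure ℂ)
      (a := fun t => ‖ρ t‖ₑ ^ (1 / 2 : ℝ))
      (b := fun t => ‖ρ t‖ₑ ^ (1 / 2 : ℝ) * ‖v (x - t) - v x‖ₑ)
      (by fun_prop) (by fun_prop)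
    refine (pow_le_pow_left' h1 2).trans (h2.trans (le_of_eq ?_))
    simp only [mul_pow, e, hρ1, one_mul]
  calc ∫⁻ x, ‖moll ρ v x - v x‖ₑ ^ 2
      ≤ ∫⁻ x, ∫⁻ t, ‖ρ t‖ₑ * ‖v (x - t) - v x‖ₑ ^ 2 := lintegral_mono e2
    _ = ∫⁻ t, ∫⁻ x, ‖ρ t‖ₑ * ‖v (x - t) - v x‖ₑ ^ 2 :=
        lintegral_lintegral_swap (Measurable.aemeasurable (by
          have := hρc.measurable
          fun_prop))
    _ = ∫⁻ t, ‖ρ t‖ₑ * ∫⁻ x, ‖v (x - t) - v x‖ₑ ^ 2 := by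
        congr 1; ext t
        rw [lintegral_const_mul' _ _ (by finiteness)]
    _ ≤ ∫⁻ t, ‖ρ t‖ₑ * ε := by
        refine lintegral_mono fun t => ?_
        by_cases ht : ‖t‖ < φ.rOut
        · exact mul_le_mul_right (hε t ht) _
        · have : ρ t = 0 := by
            have : t ∉ Function.support ρ := by
              rw [hρ, φ.support_normed_eq]; simpa using ht
            simpa using this
          simp [this]
    _ = ε := by
        rw [lintegral_mul_const _ hρc.enorm.measurable, hρ1, one_mul]

lemma moll_eq_convolution (φ f : ℂ → ℝ) :
    moll φ f = convolution f φ (ContinuousLinearMap.lsmul ℝ ℝ).flip volume := by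
  ext x
  simp [moll, convolution_def]

lemma contDiff_moll {φ f : ℂ → ℝ} (hφ : ContDiff ℝ ∞ φ) (hs : HasCompactSupport φ)
    (hf : LocallyIntegrable f volume) : ContDiff ℝ ∞ (moll φ f) := by
  rw [moll_eq_convolution]
  exact hs.contDiff_convolution_right _ hf hφ

lemma IsWeakGrad.fderiv_moll {f : ℂ → ℝ} {v : ℂ → ℂ} (h : IsWeakGrad f v) {φ : ℂ → ℝ}
    (hφ : ContDiff ℝ ∞ φ) (hs : HasCompactSupport φ) (x e : ℂ) :
    fderiv ℝ (moll φ f) x e = inner ℝ (moll φ v x) e := by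
  rw [moll_eq_convolution, (hs.hasFDerivAt_convolution_right _ h.locallyIntegrable
    (hφ.of_le (by simp)) x).fderiv, convolution_precompR_apply _ h.locallyIntegrable (hs.fderiv ℝ)
    (hφ.continuous_fderiv (by simp)), convolution_def]
  simp only [ContinuousLinearMap.flip_apply, ContinuousLinearMap.lsmul_apply, smul_eq_mul]
  have hψ : ContDiff ℝ ∞ (fun t => φ (x - t)) := hφ.comp (contDiff_const.sub contDiff_id)
  have hψs : HasCompactSupport (fun t => φ (x - t)) := hs.comp_homeomorph (Homeomorph.subLeft x)
  have h1 := h.integral_eq _ hψ hψs e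
  have h2 : ∀ t, fderiv ℝ (fun t => φ (x - t)) t e = - fderiv ℝ φ (x - t) e := by
    intro t
    have := ((hφ.differentiable (by simp) (x - t)).hasFDerivAt.comp t
      ((hasFDerivAt_id t).const_sub x)).fderiv
    simp only [Function.comp_def] at this
    rw [this]; simp
  simp only [h2, mul_neg, integral_neg, neg_inj] at h1
  simp only [mul_comm (fderiv ℝ φ _ e), h1]
  rw [moll, real_inner_comm,
    ← integral_inner (integrable_moll hφ.continuous hs h.locallyIntegrable_grad x) e]
  congr 1; ext t
  rw [real_inner_smul_right, real_inner_comm]; ring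

lemma enorm_fderiv_of_inner {u : ℂ → ℝ} {w x : ℂ} (h : ∀ e, fderiv ℝ u x e = inner ℝ w e) :
    ‖fderiv ℝ u x‖ₑ = ‖w‖ₑ := by
  have : fderiv ℝ u x = innerSL ℝ w := by
    refine ContinuousLinearMap.ext fun e => ?_
    rw [h e, innerSL_apply_apply]
  rw [this, ← ofReal_norm, innerSL_apply_norm, ofReal_norm]

/-- Bump functions shrinking to the origin. -/
def shrinkingBump (n : ℕ) : ContDiffBump (0 : ℂ) :=
  ⟨1 / (2 * ((n : ℝ) + 1)), 1 / ((n : ℝ) + 1), by positivity, by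
    have : (0 : ℝ) < n + 1 := by positivity
    rw [div_lt_div_iff₀ (by positivity) this]; linarith⟩

lemma shrinkingBump_rOut (n : ℕ) : (shrinkingBump n).rOut = 1 / ((n : ℝ) + 1) := rfl

open scoped ENNReal in
-- The Trudinger bound requires small energy, so f is compared with one fixed mollification u_N.
-- Mollified gradients converge in L², hence u_n - u_N has energy small relative to q for all n ≥ N.
-- Fatou's lemma gives the bound for f - u_N, and the bounded function u_N costs only a constant
-- factor.
lemma lintegral_exp_lt_top_of_compactSupport {f : ℂ → ℝ} {v : ℂ → ℂ} (h : IsWeakGrad f v)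
    (hm : Measurable v) (hv : MemLp v 2) {R : ℝ} (hR : ∀ x ∉ Metric.closedBall 0 R, f x = 0)
    (q : ℝ) :
    ∫⁻ x in Metric.closedBall 0 (R + 1), ENNReal.ofReal (Real.exp (q * |f x|)) < ⊤ := by
  set K := Metric.closedBall (0 : ℂ) (R + 1) with hK
  have hKc : IsCompact K := isCompact_closedBall _ _
  set φ : ℕ → ℂ → ℝ := fun n => (shrinkingBump n).normed volume with hφ
  have φs : ∀ n, ContDiff ℝ ∞ (φ n) := fun n => (shrinkingBump n).contDiff_normed
  have φc : ∀ n, HasCompactSupport (φ n) := fun n => (shrinkingBump n).hasCompactSupport_normed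
  set u : ℕ → ℂ → ℝ := fun n => moll (φ n) f with hu
  set w : ℕ → ℂ → ℂ := fun n => moll (φ n) v with hw
  have us : ∀ n, ContDiff ℝ ∞ (u n) := fun n => contDiff_moll (φs n) (φc n) h.locallyIntegrable
  have ud : ∀ n x e, fderiv ℝ (u n) x e = inner ℝ (w n x) e := fun n x e =>
    h.fderiv_moll (φs n) (φc n) x e
  have hr : Tendsto (fun n : ℕ => (shrinkingBump n).rOut) atTop (𝓝 0) :=
    tendsto_one_div_add_atTop_nhds_zero_nat
  have u0 : ∀ n, ∀ x ∉ K, u n x = 0 := by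
    intro n x hx
    have : ∀ t, φ n (x - t) • f t = 0 := by
      intro t
      by_cases ht : t ∈ Metric.closedBall (0 : ℂ) R
      · have : x - t ∉ Function.support (φ n) := by
          rw [hφ]
          simp only
          rw [(shrinkingBump n).support_normed_eq, Metric.mem_ball, dist_zero_right, not_lt,
            shrinkingBump_rOut]
          rw [Metric.mem_closedBall, dist_zero_right] at ht
          rw [hK, Metric.mem_closedBall, dist_zero_right, not_le] at hx
          have h1 : 1 / ((n : ℝ) + 1) ≤ 1 := by
            rw [div_le_one (by positivity)]; linarith [Nat.cast_nonneg (α := ℝ) n]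
          have := norm_sub_norm_le x t
          linarith
        rw [Function.notMem_support.1 this, zero_smul]
      · rw [hR t ht, smul_zero]
    simp only [hu, moll, this, integral_zero]
  -- gradients are Cauchy in `L²`
  set G : ℝ≥0∞ := (gnsConst : ℝ≥0∞) ^ 2 with hG
  have hGt : G ≠ ⊤ := by simp [hG]
  -- The factor 2(ε + ε) comes from |a - b|² ≤ 2(|a|² + |b|²), applied to two mollification errors
  -- of energy at most ε.
  obtain ⟨ε, hε0, hε⟩ : ∃ ε : ℝ≥0∞, 0 < ε ∧
      ENNReal.ofReal (q ^ 2) * (G * (2 * (ε + ε))) ≤ 2⁻¹ := by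
    have hA : ENNReal.ofReal (q ^ 2) * G * 4 + 1 ≠ ⊤ := by finiteness
    refine ⟨2⁻¹ / (ENNReal.ofReal (q ^ 2) * G * 4 + 1), ENNReal.div_pos (by norm_num) hA, ?_⟩
    set A := ENNReal.ofReal (q ^ 2) * G * 4
    calc ENNReal.ofReal (q ^ 2) * (G * (2 * (2⁻¹ / (A + 1) + 2⁻¹ / (A + 1))))
        = A * (2⁻¹ / (A + 1)) := by simp only [A]; ring
      _ ≤ (A + 1) * (2⁻¹ / (A + 1)) := by gcongr; exact le_self_add
      _ = 2⁻¹ := ENNReal.mul_div_cancel (by simp) hA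
  obtain ⟨δ, hδ, hδ'⟩ := exists_translation_bound hv hε0
  obtain ⟨N, hN⟩ := eventually_atTop.1 (hr.eventually_lt_const hδ)
  have hwv : ∀ n, N ≤ n → ∫⁻ x, ‖w n x - v x‖ₑ ^ 2 ≤ ε := fun n hn =>
    lintegral_moll_sub_le hm h.locallyIntegrable_grad _ fun t ht => hδ' t (ht.trans (hN n hn))
  have hwm : ∀ n, Continuous (w n) := by
    intro n
    have h1 : ∀ x, w n x = ((fderiv ℝ (u n) x 1 : ℝ) : ℂ) +
        ((fderiv ℝ (u n) x Complex.I : ℝ) : ℂ) * Complex.I := by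
      intro x
      rw [ud, ud, inner_eq, inner_eq]
      apply Complex.ext <;> simp
    have h2 : ∀ e, Continuous fun x => fderiv ℝ (u n) x e := fun e =>
      ((us n).continuous_fderiv (by simp)).clm_apply continuous_const
    have h3 := h2 1
    have h4 := h2 Complex.I
    rw [show w n = fun x => _ from funext h1]
    fun_prop
  have hD : ∀ n, N ≤ n → ∫⁻ x, ‖fderiv ℝ (fun y => u n y - u N y) x‖ₑ ^ 2 ≤ 2 * (ε + ε) := by
    intro n hn
    have h1 : ∀ x, ‖fderiv ℝ (fun y => u n y - u N y) x‖ₑ = ‖w n x - w N x‖ₑ := by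
      intro x
      refine enorm_fderiv_of_inner fun e => ?_
      rw [fderiv_fun_sub ((us n).differentiable (by simp) x) ((us N).differentiable (by simp) x),
        _root_.sub_apply, ud, ud, inner_sub_left]
    have h2 : ∀ x, ‖w n x - w N x‖ₑ ^ 2 ≤ 2 * (‖w n x - v x‖ₑ ^ 2 + ‖w N x - v x‖ₑ ^ 2) := by
      intro x
      have e1 : ∀ z : ℂ, ‖z‖ₑ ^ 2 = ENNReal.ofReal (‖z‖ ^ 2) := fun z => by
        rw [← ofReal_norm, ENNReal.ofReal_pow (norm_nonneg _)]
      rw [e1, e1, e1, ← ENNReal.ofReal_add (by positivity) (by positivity),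
        ← ENNReal.ofReal_ofNat 2, ← ENNReal.ofReal_mul (by norm_num)]
      refine ENNReal.ofReal_le_ofReal ?_
      have : ‖w n x - w N x‖ ≤ ‖w n x - v x‖ + ‖w N x - v x‖ := by
        rw [← norm_neg (w N x - v x)]
        refine le_trans (le_of_eq ?_) (norm_add_le _ _)
        congr 1; ring
      nlinarith [norm_nonneg (w n x - w N x), sq_nonneg (‖w n x - v x‖ - ‖w N x - v x‖)]
    simp only [h1]
    calc ∫⁻ x, ‖w n x - w N x‖ₑ ^ 2
        ≤ ∫⁻ x, 2 * (‖w n x - v x‖ₑ ^ 2 + ‖w N x - v x‖ₑ ^ 2) := lintegral_mono h2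
      _ = 2 * ((∫⁻ x, ‖w n x - v x‖ₑ ^ 2) + ∫⁻ x, ‖w N x - v x‖ₑ ^ 2) := by
        rw [lintegral_const_mul' _ _ (by norm_num), lintegral_add_left]
        have := (hwm n).measurable
        fun_prop
      _ ≤ _ := by gcongr <;> [exact hwv n hn; exact hwv N le_rfl]
  have hexp : ∀ n, N ≤ n → ∫⁻ x in K, ENNReal.ofReal (Real.exp (q * |u n x - u N x|)) ≤
      4 * volume K := by
    intro n hn
    refine lintegral_exp_le (((us n).sub (us N)).of_le (by simp)) hKc (fun x hx => ?_) ?_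
    · rw [u0 n x hx, u0 N x hx, sub_zero]
    · refine le_trans ?_ hε
      gcongr
      exact hD n hn
  -- pass to the limit
  have hlim : ∀ᵐ x, Tendsto (fun n => u n x) atTop (𝓝 (f x)) := by
    -- Almost everywhere convergence by Lebesgue differentiation, which needs the outer radius of
    -- the bump to be at most a fixed multiple of the inner one; here the ratio is exactly 2.
    have := ContDiffBump.ae_convolution_tendsto_right_of_locallyIntegrable
      (φ := shrinkingBump) (K := 2) hr (Eventually.of_forall fun n => by
        have : (0 : ℝ) < n + 1 := by positivity
        change 1 / ((n : ℝ) + 1) ≤ 2 * (1 / (2 * ((n : ℝ) + 1)))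
        apply le_of_eq
        field_simp) h.locallyIntegrable
    filter_upwards [this] with x hx
    simp only [convolution_lsmul_swap] at hx
    exact hx
  have hfatou : ∫⁻ x in K, ENNReal.ofReal (Real.exp (q * |f x - u N x|)) ≤ 4 * volume K := by
    have hc : Continuous fun t : ℝ => ENNReal.ofReal (Real.exp (q * |t|)) :=
      ENNReal.continuous_ofReal.comp (by fun_prop)
    calc ∫⁻ x in K, ENNReal.ofReal (Real.exp (q * |f x - u N x|))
        ≤ ∫⁻ x in K, liminf (fun n => ENNReal.ofReal (Real.exp (q * |u n x - u N x|))) atTop := by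
          refine lintegral_mono_ae (ae_restrict_of_ae ?_)
          filter_upwards [hlim] with x hx
          exact (((hc.tendsto _).comp (hx.sub_const (u N x))).liminf_eq).ge
      _ ≤ liminf (fun n => ∫⁻ x in K, ENNReal.ofReal (Real.exp (q * |u n x - u N x|))) atTop := by
          refine lintegral_liminf_le fun n => ?_
          exact (hc.comp ((us n).continuous.sub (us N).continuous)).measurable
      _ ≤ 4 * volume K := by
          refine liminf_le_of_frequently_le' (Eventually.frequently ?_)
          filter_upwards [eventually_ge_atTop N] with n hn
          exact hexp n hn
  obtain ⟨B, hB⟩ := hKc.exists_bound_of_continuousOn (us N).continuous.continuousOn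
  calc ∫⁻ x in K, ENNReal.ofReal (Real.exp (q * |f x|))
      ≤ ∫⁻ x in K, ENNReal.ofReal (Real.exp (|q| * B)) *
          ENNReal.ofReal (Real.exp (q * |f x - u N x|)) := by
        refine setLIntegral_mono' hKc.measurableSet fun x hx => ?_
        rw [← ENNReal.ofReal_mul (Real.exp_pos _).le, ← Real.exp_add]
        refine ENNReal.ofReal_le_ofReal (Real.exp_le_exp.2 ?_)
        have h1 := hB x hx
        rw [Real.norm_eq_abs] at h1
        have h2 : abs (|f x| - |f x - u N x|) ≤ |u N x| := by
          have := abs_abs_sub_abs_le (f x) (f x - u N x)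
          simpa using this
        have h3 : q * (|f x| - |f x - u N x|) ≤ |q| * B := by
          refine (le_abs_self _).trans ?_
          rw [abs_mul]
          gcongr
          exact h2.trans h1
        linarith
    _ = ENNReal.ofReal (Real.exp (|q| * B)) *
          ∫⁻ x in K, ENNReal.ofReal (Real.exp (q * |f x - u N x|)) := by
        rw [lintegral_const_mul' _ _ (by finiteness)]
    _ ≤ ENNReal.ofReal (Real.exp (|q| * B)) * (4 * volume K) := by gcongr
    _ < ⊤ := by
        have := hKc.measure_lt_top (μ := volume)
        finiteness

/-! ### Local exponential integrability -/

lemma IsWeakGrad.congr {f f' : ℂ → ℝ} {v v' : ℂ → ℂ} (h : IsWeakGrad f v) (hf : f =ᵐ[volume] f')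
    (hv : v =ᵐ[volume] v') : IsWeakGrad f' v' where
  locallyIntegrable := h.locallyIntegrable.congr hf
  locallyIntegrable_grad := h.locallyIntegrable_grad.congr hv
  integral_eq ψ hψ hs e := by
    have e1 : ∫ x, f' x * fderiv ℝ ψ x e = ∫ x, f x * fderiv ℝ ψ x e :=
      integral_congr_ae (by filter_upwards [hf] with x hx; rw [hx])
    have e2 : ∫ x, inner ℝ (v' x) e * ψ x = ∫ x, inner ℝ (v x) e * ψ x :=
      integral_congr_ae (by filter_upwards [hv] with x hx; rw [hx])
    rw [e1, e2, h.integral_eq ψ hψ hs e]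

/-- The gradient of a smooth function. -/
def smoothGrad (η : ℂ → ℝ) (x : ℂ) : ℂ := ⟨fderiv ℝ η x 1, fderiv ℝ η x Complex.I⟩

lemma inner_smoothGrad (η : ℂ → ℝ) (x e : ℂ) : inner ℝ (smoothGrad η x) e = fderiv ℝ η x e := by
  rw [fderiv_apply_eq_re_im, inner_eq, smoothGrad]; ring

lemma continuous_smoothGrad {η : ℂ → ℝ} (hη : ContDiff ℝ ∞ η) : Continuous (smoothGrad η) := by
  have h1 : Continuous fun x => fderiv ℝ η x 1 :=
    (hη.continuous_fderiv (by simp)).clm_apply continuous_const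
  have h2 : Continuous fun x => fderiv ℝ η x Complex.I :=
    (hη.continuous_fderiv (by simp)).clm_apply continuous_const
  have : smoothGrad η = fun x => ((fderiv ℝ η x 1 : ℝ) : ℂ) +
      ((fderiv ℝ η x Complex.I : ℝ) : ℂ) * Complex.I := by
    ext x; apply Complex.ext <;> simp [smoothGrad]
  rw [this]
  fun_prop

lemma hasCompactSupport_smoothGrad {η : ℂ → ℝ} (hη : HasCompactSupport η) :
    HasCompactSupport (smoothGrad η) :=
  HasCompactSupport.intro hη fun x hx => by
    rw [smoothGrad, fderiv_of_notMem_tsupport ℝ hx]; rfl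

/-- The product rule for weak gradients. -/
lemma IsWeakGrad.smooth_mul {f : ℂ → ℝ} {v : ℂ → ℂ} (h : IsWeakGrad f v) {η : ℂ → ℝ}
    (hη : ContDiff ℝ ∞ η) :
    IsWeakGrad (fun x => η x * f x) (fun x => η x • v x + f x • smoothGrad η x) where
  locallyIntegrable := h.locallyIntegrable.continuous_mul hη.continuous
  locallyIntegrable_grad := (h.locallyIntegrable_grad.continuous_smul hη.continuous).add
    (h.locallyIntegrable.smul_continuous (continuous_smoothGrad hη))
  integral_eq ψ hψ hs e := by
    have h1 := h.integral_eq (fun x => η x * ψ x) (hη.mul hψ) (hs.mul_left (f := η)) e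
    have d1 : ∀ x, fderiv ℝ (fun x => η x * ψ x) x e =
        η x * fderiv ℝ ψ x e + ψ x * fderiv ℝ η x e := by
      intro x
      rw [fderiv_fun_mul (hη.differentiable (by simp) x) (hψ.differentiable (by simp) x)]
      simp
    have c1 : Continuous fun x => fderiv ℝ ψ x e :=
      (hψ.continuous_fderiv (by simp)).clm_apply continuous_const
    have c2 : Continuous fun x => fderiv ℝ η x e :=
      (hη.continuous_fderiv (by simp)).clm_apply continuous_const
    have s1 : HasCompactSupport fun x => fderiv ℝ ψ x e := hs.fderiv_apply ℝ e
    have i1 : Integrable fun x => f x * (η x * fderiv ℝ ψ x e) :=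
      integrable_mul_of_compactSupport h.locallyIntegrable (hη.continuous.mul c1)
        (s1.mul_left (f := η))
    have i2 : Integrable fun x => f x * (ψ x * fderiv ℝ η x e) :=
      integrable_mul_of_compactSupport h.locallyIntegrable (hψ.continuous.mul c2) hs.mul_right
    have i3 : Integrable fun x => inner ℝ (v x) e * (η x * ψ x) := by
      have := integrable_inner_of_compactSupport (F := fun x => (η x * ψ x) • e)
        h.locallyIntegrable_grad
        ((hη.continuous.mul hψ.continuous).smul continuous_const)
        ((hs.mul_left (f := η)).smul_right)
      refine this.congr (ae_of_all _ fun x => ?_)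
      simp only [real_inner_smul_right]; ring
    simp only [d1, mul_add] at h1
    rw [integral_add i1 i2] at h1
    have e1 : ∫ x, η x * f x * fderiv ℝ ψ x e = ∫ x, f x * (η x * fderiv ℝ ψ x e) := by
      congr 1; ext x; ring
    have e2 : ∫ x, inner ℝ (η x • v x + f x • smoothGrad η x) e * ψ x =
        (∫ x, inner ℝ (v x) e * (η x * ψ x)) + ∫ x, f x * (ψ x * fderiv ℝ η x e) := by
      rw [← integral_add i3 i2]
      congr 1; ext x
      rw [inner_add_left, real_inner_smul_left, real_inner_smul_left, inner_smoothGrad]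
      ring
    rw [e1, e2]
    linarith

/-- A cut-off equal to 1 on the disc reduces to compact support; local square integrability of both
f and v keeps the gradient of the product in L². A measurable representative of that gradient is
taken because the mollification estimate asks for one. -/
lemma IsWeakGrad.integrableOn_exp {f : ℂ → ℝ} {v : ℂ → ℂ} (h : IsWeakGrad f v)
    (hf2 : LocallyIntegrable (fun x => f x ^ 2) volume)
    (hv2 : LocallyIntegrable (fun x => ‖v x‖ ^ 2) volume) (q : ℝ) {R : ℝ} (hR : 0 < R) :
    IntegrableOn (fun x => Real.exp (q * |f x|)) (Metric.closedBall 0 R) := by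
  let η : ContDiffBump (0 : ℂ) := ⟨R, R + 1, hR, by linarith⟩
  have hη : ContDiff ℝ ∞ η := η.contDiff
  have hηs : HasCompactSupport η := η.hasCompactSupport
  have h1 := h.smooth_mul hη
  set v₁ : ℂ → ℂ := fun x => η x • v x + f x • smoothGrad η x with hv₁
  have hm1 := h1.locallyIntegrable_grad.aestronglyMeasurable
  have hsq : Integrable (fun x => ‖v₁ x‖ ^ 2) := by
    have i1 : Integrable fun x => ‖v x‖ ^ 2 * η x ^ 2 :=
      integrable_mul_of_compactSupport hv2 (hη.continuous.pow 2)
        (hηs.comp_left (g := fun t => t ^ 2) (by simp))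
    have i2 : Integrable fun x => f x ^ 2 * ‖smoothGrad η x‖ ^ 2 :=
      integrable_mul_of_compactSupport hf2 ((continuous_smoothGrad hη).norm.pow 2)
        ((hasCompactSupport_smoothGrad hηs).comp_left (g := fun t => ‖t‖ ^ 2) (by simp))
    refine ((i1.const_mul 2).add (i2.const_mul 2)).mono' (hm1.norm.pow 2) (ae_of_all _ fun x => ?_)
    rw [Real.norm_of_nonneg (by positivity)]
    have : ‖v₁ x‖ ≤ ‖v x‖ * |η x| + |f x| * ‖smoothGrad η x‖ := by
      refine (norm_add_le _ _).trans (le_of_eq ?_)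
      rw [norm_smul, norm_smul, Real.norm_eq_abs, Real.norm_eq_abs, mul_comm]
    have h2 := pow_le_pow_left₀ (norm_nonneg _) this 2
    simp only [Pi.add_apply]
    rw [← sq_abs (η x), ← sq_abs (f x)]
    nlinarith [sq_nonneg (‖v x‖ * |η x| - |f x| * ‖smoothGrad η x‖)]
  have hL : MemLp (hm1.mk v₁) 2 :=
    ((memLp_two_iff_integrable_sq_norm hm1).2 hsq).ae_eq hm1.ae_eq_mk
  have h2 := lintegral_exp_lt_top_of_compactSupport (h1.congr (ae_eq_refl _) hm1.ae_eq_mk)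
    hm1.stronglyMeasurable_mk.measurable hL (R := R + 1) (fun x hx => by
      rw [η.zero_of_le_dist, zero_mul]
      rw [Metric.mem_closedBall, not_le] at hx
      exact hx.le) q
  have hsub : Metric.closedBall (0 : ℂ) R ⊆ Metric.closedBall 0 (R + 1 + 1) :=
    Metric.closedBall_subset_closedBall (by linarith)
  refine ⟨Real.continuous_exp.comp_aestronglyMeasurable
    ((h.locallyIntegrable.aestronglyMeasurable.norm.const_mul q).restrict), ?_⟩
  rw [hasFiniteIntegral_iff_ofReal (ae_of_all _ fun x => (Real.exp_pos _).le)]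
  refine lt_of_le_of_lt ?_ h2
  refine le_trans (setLIntegral_mono' Metric.isClosed_closedBall.measurableSet fun x hx => ?_)
    (lintegral_mono_set hsub)
  rw [η.one_of_mem_closedBall hx, one_mul]

/-! ### The inversion -/

lemma hasFDerivAt_inv_real {x : ℂ} (hx : x ≠ 0) :
    HasFDerivAt (fun y : ℂ => y⁻¹)
      ((ContinuousLinearMap.toSpanSingleton ℂ (-(x ^ 2)⁻¹)).restrictScalars ℝ) x :=
  (hasDerivAt_inv hx).hasFDerivAt.restrictScalars ℝ

lemma abs_det_inv (x : ℂ) :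
    |((ContinuousLinearMap.toSpanSingleton ℂ (-(x ^ 2)⁻¹)).restrictScalars ℝ).det| =
      (‖x‖ ^ 4)⁻¹ := by
  have : ((ContinuousLinearMap.toSpanSingleton ℂ (-(x ^ 2)⁻¹)).restrictScalars ℝ).det =
      Algebra.norm ℝ (-(x ^ 2)⁻¹) := by
    rw [ContinuousLinearMap.det, Algebra.norm_apply]
    congr 1
    ext; simp [mul_comm]
  rw [this, Algebra.norm_complex_apply, Complex.normSq_eq_norm_sq, abs_of_nonneg (by positivity)]
  simp only [norm_neg, norm_inv, norm_pow, inv_pow]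
  rw [← pow_mul]

lemma integrableOn_inv_image_iff {F : ℂ → ℝ} {s : Set ℂ} (hs : MeasurableSet s) (h0 : (0 : ℂ) ∉ s) :
    IntegrableOn F ((fun y : ℂ => y⁻¹) '' s) ↔
      IntegrableOn (fun y => (‖y‖ ^ 4)⁻¹ * F y⁻¹) s := by
  rw [integrableOn_image_iff_integrableOn_abs_det_fderiv_smul volume hs
    (fun x hx => (hasFDerivAt_inv_real fun h => h0 (h ▸ hx)).hasFDerivWithinAt)
    (inv_injective.injOn)]
  simp only [abs_det_inv, smul_eq_mul]

lemma inv_image_compl_zero : (fun y : ℂ => y⁻¹) '' {0}ᶜ = {0}ᶜ := by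
  ext x
  simp only [Set.mem_image, Set.mem_compl_iff, Set.mem_singleton_iff]
  exact ⟨fun ⟨y, hy, h⟩ => h ▸ inv_ne_zero hy, fun h => ⟨x⁻¹, inv_ne_zero h, inv_inv x⟩⟩

lemma integrable_inv_iff {F : ℂ → ℝ} :
    Integrable (fun y => (‖y‖ ^ 4)⁻¹ * F y⁻¹) ↔ Integrable F := by
  have := integrableOn_inv_image_iff (F := F) (measurableSet_singleton (0 : ℂ)).compl (by simp)
  rwa [inv_image_compl_zero, IntegrableOn, IntegrableOn, restrict_compl_singleton, Iff.comm] at this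

lemma integral_inv (F : ℂ → ℝ) : ∫ y, (‖y‖ ^ 4)⁻¹ * F y⁻¹ = ∫ y, F y := by
  have := integral_image_eq_integral_abs_det_fderiv_smul volume
    (measurableSet_singleton (0 : ℂ)).compl
    (fun x hx => (hasFDerivAt_inv_real (x := x) (by simpa using hx)).hasFDerivWithinAt)
    (inv_injective.injOn) F
  rw [inv_image_compl_zero, restrict_compl_singleton] at this
  rw [this]
  simp only [abs_det_inv, smul_eq_mul]

lemma quasiMeasurePreserving_inv :
    Measure.QuasiMeasurePreserving (fun y : ℂ => y⁻¹) volume volume := by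
  refine ⟨measurable_inv, Measure.AbsolutelyContinuous.mk fun s hs h0 => ?_⟩
  rw [Measure.map_apply measurable_inv hs]
  have h1 : volume ((fun y : ℂ => y⁻¹) '' (s \ {0})) = 0 := by
    refine addHaar_image_eq_zero_of_differentiableOn_of_addHaar_eq_zero volume ?_
      (measure_mono_null Set.sdiff_subset h0)
    exact fun x hx => (hasFDerivAt_inv_real hx.2).differentiableAt.differentiableWithinAt
  refine measure_mono_null (t := (fun y : ℂ => y⁻¹) '' (s \ {0}) ∪ {0}) ?_
    (measure_union_null h1 (by simp))
  intro x hx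
  by_cases h : x = 0
  · exact Or.inr h
  · exact Or.inl ⟨x⁻¹, ⟨hx, inv_ne_zero h⟩, inv_inv x⟩

/-- The inversion is an isometry of the round metric. -/
lemma g_inv {y : ℂ} (hy : y ≠ 0) : (‖y‖ ^ 4)⁻¹ * g y⁻¹ = g y := by
  have : 0 < ‖y‖ := norm_pos_iff.2 hy
  rw [g, g, norm_inv]
  field_simp
  ring

/-- The image of a constant vector under the differential of the inversion, up to a positive
factor. -/
def inversionField (e y : ℂ) : ℂ := -e * ((starRingEnd ℂ) y ^ 2)⁻¹

lemma hasFDerivAt_inversionField (e : ℂ) {y : ℂ} (hy : y ≠ 0) :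
    ∃ p : ℂ, HasFDerivAt (inversionField e)
      (((ContinuousLinearMap.toSpanSingleton ℂ p).restrictScalars ℝ).comp
        (Complex.conjCLE : ℂ →L[ℝ] ℂ)) y := by
  have hy' : (starRingEnd ℂ) y ≠ 0 := by simpa using hy
  have h1 := (((hasDerivAt_id ((starRingEnd ℂ) y)).pow 2).inv (pow_ne_zero 2 hy')).const_mul (-e)
  exact ⟨_, (h1.hasFDerivAt.restrictScalars ℝ).comp y Complex.conjCLE.hasFDerivAt⟩

/-- A function of conj y has differential e ↦ p · conj e, with divergence Re p + Im(-ip) = 0. -/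
lemma dvg_inversionField (e : ℂ) {y : ℂ} (hy : y ≠ 0) : dvg (inversionField e) y = 0 := by
  obtain ⟨p, hp⟩ := hasFDerivAt_inversionField e hy
  rw [dvg, hp.fderiv]
  simp

lemma norm_inversionField (e y : ℂ) : ‖inversionField e y‖ = ‖e‖ * (‖y‖ ^ 2)⁻¹ := by
  simp [inversionField]

lemma fderiv_comp_inv_inversionField {ψ : ℂ → ℝ} (hψ : ContDiff ℝ ∞ ψ) (e : ℂ) {y : ℂ}
    (hy : y ≠ 0) :
    fderiv ℝ (fun y => ψ y⁻¹) y (inversionField e y) = (‖y‖ ^ 4)⁻¹ * fderiv ℝ ψ y⁻¹ e := by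
  have h1 := ((hψ.differentiable (by simp) y⁻¹).hasFDerivAt.comp y (hasFDerivAt_inv_real hy)).fderiv
  simp only [Function.comp_def] at h1
  rw [h1]
  have h2 : inversionField e y * -(y ^ 2)⁻¹ = (‖y‖ ^ 4)⁻¹ • e := by
    have h3 : (‖y‖ : ℂ) ^ 2 = (starRingEnd ℂ) y * y := (Complex.conj_mul' y).symm
    have h4 : (‖y‖ : ℂ) ^ 4 = (starRingEnd ℂ) y ^ 2 * y ^ 2 := by
      rw [show (‖y‖ : ℂ) ^ 4 = ((‖y‖ : ℂ) ^ 2) ^ 2 by ring, h3]; ring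
    rw [inversionField, Complex.real_smul]
    push_cast
    rw [h4, mul_inv]; ring
  simp only [ContinuousLinearMap.coe_comp, Function.comp_apply,
    ContinuousLinearMap.coe_restrictScalars', ContinuousLinearMap.toSpanSingleton_apply,
    smul_eq_mul, h2, map_smul]

lemma contDiffAt_inversionField (e : ℂ) {y : ℂ} (hy : y ≠ 0) :
    ContDiffAt ℝ ∞ (inversionField e) y := by
  have hy' : (starRingEnd ℂ) y ≠ 0 := by simpa using hy
  have h1 : ContDiffAt ℝ ∞ (fun y : ℂ => (starRingEnd ℂ) y ^ 2) y :=
    (Complex.conjCLE.contDiff.pow 2).contDiffAt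
  exact contDiffAt_const.mul (h1.inv (pow_ne_zero 2 hy'))

/-- Pullback of a tame function under the inversion: the weak formula. -/
lemma Tame.integral_comp_inv {f : ℂ → ℝ} {v : ℂ → ℂ} (h : Tame f v) {ψ : ℂ → ℝ}
    (hψ : ContDiff ℝ ∞ ψ) (hs : HasCompactSupport ψ) (e : ℂ) :
    ∫ y, f y * ((‖y‖ ^ 4)⁻¹ * fderiv ℝ ψ y⁻¹ e) =
      - ∫ y, ψ y⁻¹ * inner ℝ (v y) (inversionField e y) := by
  obtain ⟨ρ, hρ, hsub⟩ := hs.isBounded.subset_closedBall_lt 0 0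
  obtain ⟨B, hB⟩ := hψ.continuous.bounded_above_of_compact_support hs
  have hc1 : Continuous fun x => fderiv ℝ ψ x e :=
    (hψ.continuous_fderiv (by simp)).clm_apply continuous_const
  obtain ⟨B', hB'⟩ := hc1.bounded_above_of_compact_support (hs.fderiv_apply ℝ e)
  have hB0 : 0 ≤ B := (norm_nonneg _).trans (hB 0)
  have hB0' : 0 ≤ B' := (norm_nonneg _).trans (hB' 0)
  have hfar : ∀ y : ℂ, ‖y‖ < ρ⁻¹ → y ≠ 0 → y⁻¹ ∉ tsupport ψ := by
    intro y hy h0 hm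
    have h1 := hsub hm
    rw [mem_closedBall_zero_iff, norm_inv] at h1
    have h2 : 0 < ‖y‖ := norm_pos_iff.2 h0
    have h3 := inv_anti₀ (inv_pos.2 h2) h1
    rw [inv_inv] at h3
    linarith
  -- The factor ψ(1/y) vanishes near 0 because ψ has compact support, so F is smooth there. At
  -- infinity F is O(|y|⁻²) and its divergence O(|y|⁻⁴), as integration by parts on the plane
  -- requires.
  set F : ℂ → ℂ := fun y => ψ y⁻¹ • inversionField e y with hF
  have hnear : ∀ y : ℂ, ‖y‖ < ρ⁻¹ → F =ᶠ[𝓝 y] fun _ => 0 := by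
    intro y hy
    filter_upwards [(isOpen_lt continuous_norm continuous_const).mem_nhds hy] with x hx
    rcases eq_or_ne x 0 with rfl | h0
    · simp [hF, inversionField]
    · simp [hF, image_eq_zero_of_notMem_tsupport (hfar x hx h0)]
  have hne : ∀ y : ℂ, ¬ ‖y‖ < ρ⁻¹ → y ≠ 0 := by
    rintro y hy rfl
    exact hy (by simpa using hρ)
  have hdec : ∀ y : ℂ, ¬ ‖y‖ < ρ⁻¹ → (‖y‖ ^ 2)⁻¹ ≤ (1 + ρ ^ 2) * (1 + ‖y‖ ^ 2)⁻¹ := by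
    intro y hy
    have h0 : 0 < ‖y‖ := norm_pos_iff.2 (hne y hy)
    have h1 : 1 ≤ ρ * ‖y‖ := by
      have := mul_le_mul_of_nonneg_left (not_lt.1 hy) hρ.le
      rwa [mul_inv_cancel₀ hρ.ne'] at this
    rw [inv_le_iff_one_le_mul₀ (by positivity), mul_assoc, mul_comm (1 + ρ ^ 2), mul_assoc,
      ← div_eq_inv_mul, le_div_iff₀ (by positivity)]
    nlinarith
  have hsm : ContDiff ℝ ∞ F := by
    rw [contDiff_iff_contDiffAt]
    intro y
    by_cases hy : ‖y‖ < ρ⁻¹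
    · exact contDiffAt_const.congr_of_eventuallyEq (hnear y hy)
    · have h0 := hne y hy
      exact (hψ.contDiffAt.comp y (contDiffAt_inv ℝ h0)).smul (contDiffAt_inversionField e h0)
  have hdv : ∀ y, dvg F y = (‖y‖ ^ 4)⁻¹ * fderiv ℝ ψ y⁻¹ e := by
    intro y
    by_cases hy : ‖y‖ < ρ⁻¹
    · rw [dvg_congr (hnear y hy), dvg_const]
      rcases eq_or_ne y 0 with rfl | h0
      · simp
      · rw [fderiv_of_notMem_tsupport ℝ (hfar y hy h0)]; simp
    · have h0 := hne y hy
      obtain ⟨p, hp⟩ := hasFDerivAt_inversionField e h0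
      rw [hF, dvg_smul (a := fun y => ψ y⁻¹)
        ((hψ.contDiffAt.comp y (contDiffAt_inv ℝ h0)).differentiableAt (by simp)) hp.differentiableAt, dvg_inversionField e h0, mul_zero, zero_add,
        fderiv_comp_inv_inversionField hψ e h0]
  have hb1 : ∀ y, ‖F y‖ ≤ B * ‖e‖ * (1 + ρ ^ 2) * (1 + ‖y‖ ^ 2)⁻¹ := by
    intro y
    by_cases hy : ‖y‖ < ρ⁻¹
    · rw [(hnear y hy).eq_of_nhds, norm_zero]; positivity
    · rw [hF, norm_smul, norm_inversionField]
      have := hdec y hy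
      calc ‖ψ y⁻¹‖ * (‖e‖ * (‖y‖ ^ 2)⁻¹) ≤ B * (‖e‖ * ((1 + ρ ^ 2) * (1 + ‖y‖ ^ 2)⁻¹)) := by
            gcongr
            exact hB _
        _ = _ := by ring
  have hb2 : ∀ y, |dvg F y| ≤ B' * (1 + ρ ^ 2) ^ 2 / 4 * g y := by
    intro y
    have hg := g_pos y
    by_cases hy : ‖y‖ < ρ⁻¹
    · rw [dvg_congr (hnear y hy), dvg_const, abs_zero]; positivity
    · rw [hdv, abs_mul, abs_of_nonneg (by positivity), g_eq]
      have := pow_le_pow_left₀ (by positivity) (hdec y hy) 2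
      calc (‖y‖ ^ 4)⁻¹ * |fderiv ℝ ψ y⁻¹ e|
          = ((‖y‖ ^ 2)⁻¹) ^ 2 * |fderiv ℝ ψ y⁻¹ e| := by rw [inv_pow, ← pow_mul]
        _ ≤ ((1 + ρ ^ 2) * (1 + ‖y‖ ^ 2)⁻¹) ^ 2 * B' := by
            gcongr
            exact hB' _
        _ = _ := by ring
  set C := max (B * ‖e‖ * (1 + ρ ^ 2)) (B' * (1 + ρ ^ 2) ^ 2 / 4) with hC
  have h1 := (h.integral_field_eq_zero hsm (C := C)
    (fun y => (hb1 y).trans (by gcongr; exact le_max_left _ _))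
    (fun y => (hb2 y).trans (by gcongr; exacts [(g_pos y).le, le_max_right _ _]))).2
  have i1 : Integrable fun y => inner ℝ (v y) (F y) :=
    h.integrable_inner hsm.continuous.aestronglyMeasurable (ae_of_all _ hb1)
  have i2 : Integrable fun y => f y * dvg F y := by
    refine (h.integrable_mul_g.norm.const_mul (B' * (1 + ρ ^ 2) ^ 2 / 4)).mono'
      (h.isWeakGrad.locallyIntegrable.aestronglyMeasurable.mul
        (continuous_dvg hsm).aestronglyMeasurable) (ae_of_all _ fun y => ?_)
    rw [norm_mul, norm_mul, Real.norm_eq_abs (dvg F y), Real.norm_of_nonneg (g_pos y).le]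
    calc ‖f y‖ * |dvg F y| ≤ ‖f y‖ * (B' * (1 + ρ ^ 2) ^ 2 / 4 * g y) := by gcongr; exact hb2 y
      _ = _ := by ring
  rw [integral_add i2 i1] at h1
  simp only [hdv] at h1
  simp only [hF, real_inner_smul_right] at h1
  linarith

lemma locallyIntegrable_of_mul_g {p : ℂ → ℝ} (hp : Integrable fun x => p x * g x) :
    LocallyIntegrable p volume := by
  refine (hp.locallyIntegrable.mul_continuous
    (continuous_g.inv₀ fun x => (g_pos x).ne')).congr (ae_of_all _ fun y => ?_)
  simp only [Pi.inv_apply, mul_assoc, mul_inv_cancel₀ (g_pos y).ne', mul_one]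

/-- The inversion of a function with square integrable gradient. -/
lemma Tame.isWeakGrad_comp_inv {f : ℂ → ℝ} {v : ℂ → ℂ} (h : Tame f v)
    (hv : Integrable fun x => ‖v x‖ ^ 2) :
    IsWeakGrad (fun y => f y⁻¹) (fun y => inversionField (v y⁻¹) y) ∧
    LocallyIntegrable (fun y => f y⁻¹ ^ 2) volume ∧
    Integrable (fun y => ‖inversionField (v y⁻¹) y‖ ^ 2) := by
  have h0 : ∀ᵐ y : ℂ, y ≠ 0 := by simp [ae_iff, measure_singleton]
  have hloc : ∀ {p : ℂ → ℝ}, Integrable (fun x => p x * g x) →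
      LocallyIntegrable (fun y => p y⁻¹) volume := by
    intro p hp
    have h1 : Integrable fun y => p y⁻¹ * g y := by
      refine (integrable_inv_iff.2 hp).congr ?_
      filter_upwards [h0] with y hy
      rw [← g_inv hy]; ring
    exact locallyIntegrable_of_mul_g h1
  -- Conformal invariance of the Dirichlet energy: the squared norm carries exactly the Jacobian
  -- |y|⁻⁴.
  have hw2 : Integrable fun y => ‖inversionField (v y⁻¹) y‖ ^ 2 := by
    refine (integrable_inv_iff.2 hv).congr (ae_of_all _ fun y => ?_)
    simp only [norm_inversionField, mul_pow, inv_pow]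
    rw [← pow_mul]; ring
  have hwm : AEStronglyMeasurable (fun y => inversionField (v y⁻¹) y) := by
    have h1 := h.isWeakGrad.locallyIntegrable_grad.aestronglyMeasurable.comp_quasiMeasurePreserving
      quasiMeasurePreserving_inv
    have h2 : Measurable fun y : ℂ => ((starRingEnd ℂ) y ^ 2)⁻¹ :=
      (Complex.continuous_conj.measurable.pow_const 2).inv
    exact h1.neg.mul h2.aestronglyMeasurable
  refine ⟨⟨hloc h.integrable_mul_g, ?_, ?_⟩, hloc h.sq_integrable, hw2⟩
  · exact ((memLp_two_iff_integrable_sq_norm hwm).2 hw2).locallyIntegrable one_le_two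
  · intro ψ hψ hs e
    have h1 := h.integral_comp_inv hψ hs e
    have e1 : ∫ y, f y⁻¹ * fderiv ℝ ψ y e = ∫ y, f y * ((‖y‖ ^ 4)⁻¹ * fderiv ℝ ψ y⁻¹ e) := by
      rw [← integral_inv fun y => f y * ((‖y‖ ^ 4)⁻¹ * fderiv ℝ ψ y⁻¹ e)]
      refine integral_congr_ae ?_
      filter_upwards [h0] with y hy
      have : 0 < ‖y‖ := norm_pos_iff.2 hy
      simp only [inv_inv, norm_inv]
      field_simp
    have e2 : ∫ y, inner ℝ (inversionField (v y⁻¹) y) e * ψ y =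
        ∫ y, ψ y⁻¹ * inner ℝ (v y) (inversionField e y) := by
      rw [← integral_inv fun y => ψ y⁻¹ * inner ℝ (v y) (inversionField e y)]
      refine integral_congr_ae ?_
      filter_upwards [h0] with y hy
      have hy' : (starRingEnd ℂ) y ≠ 0 := by simpa using hy
      have : inner ℝ (inversionField (v y⁻¹) y) e =
          (‖y‖ ^ 4)⁻¹ * inner ℝ (v y⁻¹) (inversionField e y⁻¹) := by
        rw [Complex.inner, Complex.inner, ← Complex.re_ofReal_mul]
        congr 1
        have h4 : (‖y‖ : ℂ) ^ 4 = (starRingEnd ℂ) y ^ 2 * y ^ 2 := by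
          rw [show (‖y‖ : ℂ) ^ 4 = ((‖y‖ : ℂ) ^ 2) ^ 2 by ring, ← Complex.conj_mul' y]; ring
        simp only [inversionField]
        push_cast
        rw [h4]
        simp only [map_mul, map_neg, map_inv₀, map_pow, Complex.conj_conj]
        field_simp
      simp only [inv_inv, this]
      ring
    rw [e1, e2, h1]

/-- Exponential integrability on the sphere. -/
lemma Tame.integrable_exp {f : ℂ → ℝ} {v : ℂ → ℂ} (h : Tame f v)
    (hv : Integrable fun x => ‖v x‖ ^ 2) (q : ℝ) :
    Integrable fun x => Real.exp (q * |f x|) * g x := by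
  have hf2 : LocallyIntegrable (fun x => f x ^ 2) volume :=
    locallyIntegrable_of_mul_g h.sq_integrable
  -- The unit disc is treated directly and its exterior as the inverted unit disc, where the same
  -- local estimate applies and g is preserved.
  obtain ⟨k1, k2, k3⟩ := h.isWeakGrad_comp_inv hv
  have j1 := h.isWeakGrad.integrableOn_exp hf2 hv.locallyIntegrable q one_pos
  have j2 := k1.integrableOn_exp k2 k3.locallyIntegrable q one_pos
  have j1' := j1.mul_continuousOn continuous_g.continuousOn (isCompact_closedBall _ _)
  have j2' := j2.mul_continuousOn continuous_g.continuousOn (isCompact_closedBall _ _)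
  have hm : MeasurableSet (Metric.closedBall (0 : ℂ) 1 \ {0}) :=
    Metric.isClosed_closedBall.measurableSet.diff (measurableSet_singleton 0)
  have hout : IntegrableOn (fun x => Real.exp (q * |f x|) * g x)
      ((fun y : ℂ => y⁻¹) '' (Metric.closedBall 0 1 \ {0})) := by
    rw [integrableOn_inv_image_iff hm (by simp)]
    refine (j2'.mono_set Set.sdiff_subset).congr_fun (fun y hy => ?_) hm
    simp only
    rw [← g_inv hy.2]; ring
  rw [← integrableOn_univ]
  refine (j1'.union hout).mono_set fun x _ => ?_
  by_cases hx : ‖x‖ ≤ 1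
  · exact Or.inl (by simpa using hx)
  · have h0 : x ≠ 0 := by rintro rfl; simp at hx
    refine Or.inr ⟨x⁻¹, ⟨?_, inv_ne_zero h0⟩, inv_inv x⟩
    rw [mem_closedBall_zero_iff, norm_inv]
    exact inv_le_one_of_one_le₀ (not_le.1 hx).le

/-! ### The weight `w` -/

lemma G_eq (z x : ℂ) : G z x =
    (halfLog x - Real.log ‖x - z‖) + (κ - 1 / 4 * Real.log (g z) - 1 / 4 * Real.log 4) := by
  rw [G, log_g x, norm_sub_rev, one_div, Real.log_inv]
  ring

lemma continuousAt_log_norm_sub {c x : ℂ} (h : x ≠ c) :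
    ContinuousAt (fun y : ℂ => Real.log ‖y - c‖) x :=
  ContinuousAt.log (by fun_prop) (norm_ne_zero_iff.2 (sub_ne_zero.2 h))

lemma measurable_w {n : ℕ} (χ : Fin n → ℝ) (z : Fin n → ℂ) : Measurable (w χ z) := by
  have := continuous_halfLog.measurable
  unfold w
  simp only [G_eq]
  refine Real.measurable_exp.comp (Finset.measurable_fun_sum _ fun k _ => ?_)
  fun_prop

/-- Off c the function is |x - c|^(-a), and a is below the dimension. -/
lemma integrableAtFilter_exp_log {a : ℝ} (ha : a < 2) (c : ℂ) :
    IntegrableAtFilter (fun x : ℂ => Real.exp (-a * Real.log ‖x - c‖)) (𝓝 c) := by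
  have h1 : IntegrableOn (fun x : ℂ => Real.exp (-a * Real.log ‖x‖)) (Metric.ball 0 1) := by
    refine integrableOn_ball_of_norm_le_rpow (C := 1) (α := a)
      (by rw [Complex.finrank_real_complex]; norm_num)
      (by rw [Complex.finrank_real_complex]; exact_mod_cast ha) ?_
      (Measurable.aestronglyMeasurable (by fun_prop))
    refine ae_restrict_of_ae ?_
    have h0 : ∀ᵐ y : ℂ, y ≠ 0 := by simp [ae_iff, measure_singleton]
    filter_upwards [h0] with y hy
    rw [Real.norm_of_nonneg (Real.exp_pos _).le, one_mul,
      Real.rpow_def_of_pos (norm_pos_iff.2 hy), mul_comm]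
  refine ⟨Metric.ball c 1, Metric.ball_mem_nhds c one_pos, ?_⟩
  have h2 := ((integrable_indicator_iff Metric.isOpen_ball.measurableSet).2 h1).comp_sub_right c
  refine h2.integrableOn.congr_fun (fun x hx => ?_) Metric.isOpen_ball.measurableSet
  have : x - c ∈ Metric.ball (0 : ℂ) 1 := by
    rwa [mem_ball_zero_iff, ← dist_eq_norm]
  simp only [Set.indicator_of_mem this]

/-- In each G(z_k, x) the logarithmic growth at infinity cancels, so w has a finite limit there and
g provides integrability. Near a point c at most one z_k equals c, and the singularity |x -
c|^(-χ_k) is integrable because χ_k < 2. -/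
lemma integrable_w_mul_g {n : ℕ} {χ : Fin n → ℝ} {z : Fin n → ℂ} (hz : Function.Injective z)
    (hχ : ∀ k, χ k < 2) : Integrable (fun x => w χ z x * g x) := by
  have hm : AEStronglyMeasurable (fun x => w χ z x * g x) :=
    (measurable_w χ z).aestronglyMeasurable.mul continuous_g.aestronglyMeasurable
  rw [integrable_iff_integrableAtFilter_cocompact]
  constructor
  · have h1 : Tendsto (w χ z) (cocompact ℂ) (𝓝 (Real.exp (∑ k, χ k *
        (0 + (κ - 1 / 4 * Real.log (g (z k)) - 1 / 4 * Real.log 4))))) := by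
      refine (Real.continuous_exp.tendsto _).comp (tendsto_finsetSum _ fun k _ => ?_)
      simp only [G_eq]
      refine (Tendsto.add_const _ ?_).const_mul _
      have := tendsto_halfLog_sub_log.sub (tendsto_log_sub_log (z k))
      rw [sub_zero] at this
      exact this.congr fun x => by ring
    have h2 := (h1.isBigO_one ℝ).mul (Asymptotics.isBigO_refl g (cocompact ℂ))
    simp only [one_mul] at h2
    exact h2.integrableAtFilter hm.stronglyMeasurableAtFilter (integrable_g.integrableAtFilter _)
  · intro c
    classical
    set a : ℝ := ∑ k, if z k = c then χ k else 0 with ha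
    have ha2 : a < 2 := by
      by_cases h : ∃ k, z k = c
      · obtain ⟨k, rfl⟩ := h
        have : a = χ k := by simp [ha, hz.eq_iff]
        rw [this]; exact hχ k
      · simp only [not_exists] at h
        simp [ha, h]
    set E : ℂ → ℝ := fun x => Real.exp (∑ k, χ k * ((halfLog x - if z k = c then 0 else
      Real.log ‖x - z k‖) + (κ - 1 / 4 * Real.log (g (z k)) - 1 / 4 * Real.log 4))) with hE
    have hw : ∀ x, w χ z x * g x = Real.exp (-a * Real.log ‖x - c‖) * (E x * g x) := by
      intro x
      rw [← mul_assoc, hE, ← Real.exp_add, w, ha, ← Finset.sum_neg_distrib, Finset.sum_mul,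
        ← Finset.sum_add_distrib]
      congr 2
      refine Finset.sum_congr rfl fun k _ => ?_
      rw [G_eq]
      split_ifs with h
      · rw [h]; ring
      · ring
    have hc : ContinuousAt (fun x => E x * g x) c := by
      refine ContinuousAt.mul ?_ continuous_g.continuousAt
      refine ContinuousAt.rexp (f := fun x => ∑ k, χ k * ((halfLog x - if z k = c then 0 else
        Real.log ‖x - z k‖) + (κ - 1 / 4 * Real.log (g (z k)) - 1 / 4 * Real.log 4))) ?_
      refine tendsto_finsetSum _ fun k _ => ?_
      refine (Tendsto.add_const _ (Tendsto.sub (continuous_halfLog.tendsto c) ?_)).const_mul _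
      by_cases h : z k = c
      · simp only [h, if_true]; exact tendsto_const_nhds
      · simp only [h, if_false]; exact continuousAt_log_norm_sub (Ne.symm h)
    have h2 := (Asymptotics.isBigO_refl (fun x : ℂ => Real.exp (-a * Real.log ‖x - c‖)) (𝓝 c)).mul
      (hc.tendsto.isBigO_one ℝ)
    simp only [mul_one, ← hw] at h2
    exact h2.integrableAtFilter hm.stronglyMeasurableAtFilter (integrableAtFilter_exp_log ha2 c)

/-- A pointwise substitute for Hölder's inequality, separating e^h from w at the price of the
slightly larger exponent 1 + δ on w. -/
lemma exp_add_le {δ : ℝ} (hδ : 0 < δ) (a b : ℝ) :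
    Real.exp (a + b) ≤ Real.exp ((1 + δ) * a) + Real.exp ((1 + δ⁻¹) * b) := by
  rcases le_total b (δ * a) with h | h
  · refine le_trans (Real.exp_le_exp.2 ?_) (le_add_of_nonneg_right (Real.exp_pos _).le)
    linarith
  · refine le_trans (Real.exp_le_exp.2 ?_) (le_add_of_nonneg_left (Real.exp_pos _).le)
    have : a ≤ δ⁻¹ * b := by rwa [← div_eq_inv_mul, le_div_iff₀ hδ, mul_comm]
    linarith

/-- The finitely many strict inequalities χ_k < 2 survive multiplication by some 1 + δ, and w^(1+δ)
is the weight with charges (1+δ)χ_k. The conjugate factor is an exponential of a multiple of |f|,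
integrable against g for every multiple. -/
lemma Tame.integrable_exp_mul_w {f : ℂ → ℝ} {v : ℂ → ℂ} (h : Tame f v)
    (hv : Integrable fun x => ‖v x‖ ^ 2) {n : ℕ} {χ : Fin n → ℝ} {z : Fin n → ℂ}
    (hz : Function.Injective z) (hχ : ∀ k, χ k < 2) :
    Integrable (fun x => Real.exp (f x) * w χ z x * g x) := by
  obtain ⟨δ, hδ0, hδ⟩ : ∃ δ : ℝ, 0 < δ ∧ ∀ k, (1 + δ) * χ k < 2 := by
    have h1 : ∀ᶠ δ : ℝ in 𝓝[>] 0, ∀ k, (1 + δ) * χ k < 2 := by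
      rw [eventually_all]
      intro k
      have : Tendsto (fun δ : ℝ => (1 + δ) * χ k) (𝓝 0) (𝓝 ((1 + 0) * χ k)) :=
        Continuous.tendsto (by fun_prop) 0
      exact (this.mono_left nhdsWithin_le_nhds).eventually_lt_const (by simpa using hχ k)
    obtain ⟨δ, h2, h3⟩ := (h1.and self_mem_nhdsWithin).exists
    exact ⟨δ, h3, h2⟩
  have i1 := integrable_w_mul_g (χ := fun k => (1 + δ) * χ k) hz hδ
  have i2 := h.integrable_exp hv (1 + δ⁻¹)
  refine (i1.add i2).mono' (((Real.continuous_exp.comp_aestronglyMeasurable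
    h.isWeakGrad.locallyIntegrable.aestronglyMeasurable).mul
    (measurable_w χ z).aestronglyMeasurable).mul continuous_g.aestronglyMeasurable)
    (ae_of_all _ fun x => ?_)
  have hg := g_pos x
  rw [Real.norm_of_nonneg (by unfold w; positivity)]
  simp only [Pi.add_apply]
  rw [← add_mul]
  gcongr
  rw [w, w, mul_comm, ← Real.exp_add]
  refine (exp_add_le hδ0 _ _).trans (add_le_add ?_ ?_)
  · rw [Finset.mul_sum]
    simp only [mul_assoc]
    exact le_rfl
  · refine Real.exp_le_exp.2 ?_
    gcongr
    exact le_abs_self _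

/-! ### Functions in `H¹` of the sphere -/

lemma MemH1.integrable_grad {h : ℂ → ℝ} (hh : MemH1 h) :
    Integrable fun x => ‖weakGrad h x‖ ^ 2 := by
  refine hh.2.mono' (hh.1.isWeakGrad.locallyIntegrable_grad.aestronglyMeasurable.norm.pow 2)
    (ae_of_all _ fun x => ?_)
  have := g_pos x
  rw [Real.norm_of_nonneg (by positivity)]
  exact le_add_of_nonneg_right (by positivity)

lemma MemH1.tame {h : ℂ → ℝ} (hh : MemH1 h) : Tame h (weakGrad h) where
  isWeakGrad := hh.1.isWeakGrad
  sq_integrable := by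
    refine (hh.2.sub hh.integrable_grad).congr (ae_of_all _ fun x => ?_)
    simp only [Pi.sub_apply, sq_abs]; ring
  grad_integrable := by
    refine (hh.integrable_grad.add integrable_g).mono'
      (hh.1.isWeakGrad.locallyIntegrable_grad.aestronglyMeasurable.norm.mul
        (Continuous.inv₀ (by fun_prop) fun x => (one_add_normSq_pos x).ne').aestronglyMeasurable)
      (ae_of_all _ fun x => ?_)
    simp only [Pi.add_apply]
    rw [Real.norm_of_nonneg (by positivity), g_eq]
    nlinarith [sq_nonneg (‖weakGrad h x‖ - (1 + ‖x‖ ^ 2)⁻¹), sq_nonneg (1 + ‖x‖ ^ 2)⁻¹,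
      sq_nonneg ‖weakGrad h x‖]

/-! ### The background field `ln (g w)` -/

/-- The value at infinity of `ln (g w) + 4 ln |x|`. -/
def bgConst {n : ℕ} (χ : Fin n → ℝ) (z : Fin n → ℂ) : ℝ :=
  (1 - (∑ k, χ k) / 4) * Real.log 4 + ∑ k, χ k * (κ - 1 / 4 * Real.log (g (z k)))

/-- The background field `ln (g w)`. -/
def bg {n : ℕ} (χ : Fin n → ℝ) (z : Fin n → ℂ) (x : ℂ) : ℝ :=
  (∑ k, χ k - 4) * halfLog x + ∑ k, -χ k * Real.log ‖x - z k‖ + bgConst χ z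

def bgGrad {n : ℕ} (χ : Fin n → ℝ) (z : Fin n → ℂ) (x : ℂ) : ℂ :=
  (∑ k, χ k - 4) • roundField x + ∑ k, -χ k • poleField (z k) x

variable {n : ℕ} {χ : Fin n → ℝ} {z : Fin n → ℂ}

lemma w_pos (χ : Fin n → ℝ) (z : Fin n → ℂ) (x : ℂ) : 0 < w χ z x := Real.exp_pos _

/-- The identity also holds at x = z_k, because `Real.log 0 = 0` on both sides. As a result, `bg χ z
(z k)` is the regular part of ln(gw) at z_k, with -χ_k ln|x - z_k| removed. -/
lemma log_g_mul_w (χ : Fin n → ℝ) (z : Fin n → ℂ) (x : ℂ) :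
    Real.log (g x * w χ z x) = bg χ z x := by
  have h1 : ∑ k, χ k * G (z k) x = (∑ k, χ k) * (halfLog x - 1 / 4 * Real.log 4) +
      ∑ k, -χ k * Real.log ‖x - z k‖ + ∑ k, χ k * (κ - 1 / 4 * Real.log (g (z k))) := by
    rw [Finset.sum_mul, ← Finset.sum_add_distrib, ← Finset.sum_add_distrib]
    refine Finset.sum_congr rfl fun k _ => ?_
    rw [G_eq]; ring
  rw [Real.log_mul (g_pos x).ne' (w_pos χ z x).ne', w, Real.log_exp, log_g, h1, bg, bgConst]
  ring

lemma tame_bg (χ : Fin n → ℝ) (z : Fin n → ℂ) : Tame (bg χ z) (bgGrad χ z) := by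
  have h := ((tame_halfLog.const_mul (∑ k, χ k - 4)).add (tame_sum Finset.univ fun k =>
    (tame_log (z k)).const_mul (-χ k))).add (tame_const (bgConst χ z))
  simp only [add_zero] at h
  exact h

lemma circleMass_bg (χ : Fin n → ℝ) (z : Fin n → ℂ) (c : ℂ) {r : ℝ} (hr : 0 < r) :
    circleMass (bg χ z) (bgGrad χ z) c r =
      (∑ k, χ k - 4) * circleMass halfLog roundField c r +
      ∑ k, -χ k * circleMass (fun x => Real.log ‖x - z k‖) (poleField (z k)) c r +
      2 * Real.pi * bgConst χ z := by
  have t1 := tame_halfLog.const_mul (∑ k, χ k - 4)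
  have t2 : ∀ k, Tame (fun x => -χ k * Real.log ‖x - z k‖) (fun x => -χ k • poleField (z k) x) :=
    fun k => (tame_log (z k)).const_mul (-χ k)
  have h1 := circleMass_add (t1.add (tame_sum Finset.univ t2)).isWeakGrad
    (tame_const (bgConst χ z)).isWeakGrad c r
  rw [circleMass_add t1.isWeakGrad (tame_sum Finset.univ t2).isWeakGrad, circleMass_sum _ t2,
    circleMass_const _ _ hr, circleMass_const_mul] at h1
  simp only [circleMass_const_mul, add_zero] at h1
  exact h1

/-- All terms except the logarithm centred at z_k are continuous there together with their
gradients; that logarithm contributes exactly 2π ln ε times -χ_k. The convention for `Real.log 0`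
makes the limit a value of `bg`. -/
lemma tendsto_circleMass_bg_pole (hz : Function.Injective z) (χ : Fin n → ℝ) (k : Fin n) :
    Tendsto (fun ε => circleMass (bg χ z) (bgGrad χ z) (z k) ε + 2 * Real.pi * χ k * Real.log ε)
      (𝓝[>] 0) (𝓝 (2 * Real.pi * bg χ z (z k))) := by
  have h1 : Tendsto (circleMass halfLog roundField (z k)) (𝓝[>] 0)
      (𝓝 (2 * Real.pi * halfLog (z k))) :=
    tame_halfLog.isWeakGrad.tendsto_circleMass_small continuous_halfLog.continuousAt
      contDiff_roundField.continuous.continuousAt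
  have h2 : ∀ j, Tendsto (fun ε => -χ j * (circleMass (fun x => Real.log ‖x - z j‖)
      (poleField (z j)) (z k) ε - if j = k then 2 * Real.pi * Real.log ε else 0)) (𝓝[>] 0)
      (𝓝 (-χ j * (2 * Real.pi * Real.log ‖z k - z j‖))) := by
    intro j
    refine Tendsto.const_mul _ ?_
    by_cases hj : j = k
    · subst hj
      simp only [if_true, sub_self, norm_zero, Real.log_zero, mul_zero]
      refine tendsto_const_nhds.congr' ?_
      filter_upwards [self_mem_nhdsWithin] with ε hε
      rw [circleMass_log _ hε, sub_self]
    · have hne : z k ≠ z j := fun h => hj (hz h).symm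
      simp only [hj, if_false, sub_zero]
      refine (tame_log (z j)).isWeakGrad.tendsto_circleMass_small (continuousAt_log_norm_sub hne) ?_
      have : ‖z k - z j‖ ^ 2 ≠ 0 := pow_ne_zero 2 (norm_ne_zero_iff.2 (sub_ne_zero.2 hne))
      unfold poleField
      fun_prop (disch := exact this)
  have h3 := ((h1.const_mul (∑ k, χ k - 4)).add
    (tendsto_finsetSum Finset.univ fun j _ => h2 j)).add_const (2 * Real.pi * bgConst χ z)
  have e : (∑ k, χ k - 4) * (2 * Real.pi * halfLog (z k)) +
      ∑ j, -χ j * (2 * Real.pi * Real.log ‖z k - z j‖) + 2 * Real.pi * bgConst χ z =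
      2 * Real.pi * bg χ z (z k) := by
    rw [bg, mul_add, mul_add, Finset.mul_sum]
    congr 2
    · ring
    · exact Finset.sum_congr rfl fun j _ => by ring
  rw [e] at h3
  refine h3.congr' ?_
  filter_upwards [self_mem_nhdsWithin] with ε hε
  rw [circleMass_bg χ z _ hε]
  simp only [mul_sub, Finset.sum_sub_distrib, mul_ite, mul_zero, Finset.sum_ite_eq', Finset.mem_univ,
    if_true]
  ring

/-- After adding 4 ln|x|, the background field minus its constant is a combination of differences
ln|x - c| - `halfLog`, whose circle masses vanish at infinity. -/
lemma tendsto_circleMass_bg_infty (χ : Fin n → ℝ) (z : Fin n → ℂ) :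
    Tendsto (fun r => circleMass (bg χ z) (bgGrad χ z) 0 r + 8 * Real.pi * Real.log r)
      atTop (𝓝 (2 * Real.pi * bgConst χ z)) := by
  have hD := tendsto_circleMass_log_sub_halfLog
  have h1 := (((hD 0).const_mul 4).add (tendsto_finsetSum Finset.univ fun j _ =>
    (hD (z j)).const_mul (-χ j))).add_const (2 * Real.pi * bgConst χ z)
  simp only [mul_zero, Finset.sum_const_zero, zero_add] at h1
  refine h1.congr' ?_
  filter_upwards [eventually_gt_atTop 0] with r hr
  have hsub : ∀ c : ℂ, circleMass (fun x => Real.log ‖x - c‖ - halfLog x)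
      (fun x => poleField c x - roundField x) 0 r =
      circleMass (fun x => Real.log ‖x - c‖) (poleField c) 0 r -
        circleMass halfLog roundField 0 r := by
    intro c
    have := circleMass_add ((tame_log c).sub tame_halfLog).isWeakGrad tame_halfLog.isWeakGrad 0 r
    simp only [sub_add_cancel] at this
    linarith
  rw [circleMass_bg χ z _ hr]
  simp only [hsub, circleMass_log 0 hr, mul_sub, Finset.sum_sub_distrib, ← Finset.sum_mul,
    Finset.sum_neg_distrib]
  ring

/-- This says that ln w has vanishing mean, as each G(z_k, ·) does. Both sides are computed from the
potential and moments above, and the value of κ makes them agree. -/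
lemma integral_bg_mul_g (χ : Fin n → ℝ) (z : Fin n → ℂ) :
    ∫ x, bg χ z x * g x = ∫ x, g x * Real.log (g x) := by
  have i1 := tame_halfLog.integrable_mul_g
  have i2 : ∀ k, Integrable fun x => -χ k * (Real.log ‖x - z k‖ * g x) := fun k =>
    (tame_log (z k)).integrable_mul_g.const_mul _
  have e1 : ∫ x, bg χ z x * g x = (∑ k, χ k - 4) * (2 * Real.pi) +
      ∑ k, -χ k * (4 * Real.pi * halfLog (z k)) + bgConst χ z * (4 * Real.pi) := by
    have : ∀ x, bg χ z x * g x = ((∑ k, χ k - 4) * (halfLog x * g x) +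
        ∑ k, -χ k * (Real.log ‖x - z k‖ * g x)) + bgConst χ z * g x := by
      intro x
      simp only [bg, add_mul, Finset.sum_mul, mul_assoc]
    simp only [this]
    have i3 : Integrable fun x => ∑ k, -χ k * (Real.log ‖x - z k‖ * g x) :=
      integrable_finsetSum _ fun k _ => i2 k
    have i4 : Integrable fun x => (∑ k, χ k - 4) * (halfLog x * g x) +
        ∑ k, -χ k * (Real.log ‖x - z k‖ * g x) := (i1.const_mul _).add i3
    rw [integral_add i4 (integrable_g.const_mul _), integral_add (i1.const_mul _) i3,
      integral_finsetSum _ fun k _ => i2 k]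
    simp only [integral_const_mul, integral_halfLog_mul_g, integral_log_mul_g, integral_g]
  have e2 : ∫ x, g x * Real.log (g x) = Real.log 4 * (4 * Real.pi) - 4 * (2 * Real.pi) := by
    have : ∀ x, g x * Real.log (g x) = Real.log 4 * g x - 4 * (halfLog x * g x) := by
      intro x; rw [log_g]; ring
    simp only [this]
    rw [integral_sub (integrable_g.const_mul _) (i1.const_mul _)]
    simp only [integral_const_mul, integral_halfLog_mul_g, integral_g]
  have e3 : bgConst χ z = (1 - (∑ k, χ k) / 4) * Real.log 4 + (∑ k, χ k) * (κ - 1 / 4 * Real.log 4) +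
      ∑ k, χ k * halfLog (z k) := by
    rw [bgConst, Finset.sum_mul, add_assoc, ← Finset.sum_add_distrib]
    congr 1
    refine Finset.sum_congr rfl fun k _ => ?_
    rw [log_g]; ring
  have e4 : ∑ k, -χ k * (4 * Real.pi * halfLog (z k)) =
      -(4 * Real.pi) * ∑ k, χ k * halfLog (z k) := by
    rw [Finset.mul_sum]
    exact Finset.sum_congr rfl fun k _ => by ring
  have e5 : Real.log 4 = 2 * Real.log 2 := by
    rw [show (4 : ℝ) = 2 ^ 2 by norm_num, Real.log_pow]; norm_num
  rw [e1, e2, e3, e4, e5, κ]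
  ring

/-! ### The flux field -/

/-- A vector field on the plane which equals the gradient of the background field on the perforated
plane and is bounded elsewhere. -/
def fluxField (χ : Fin n → ℝ) (z : Fin n → ℂ) (ε : ℝ) (x : ℂ) : ℂ :=
  ∑ k, -χ k • ((Metric.ball (z k) ε)ᶜ.indicator (poleField (z k)) x - roundField x) +
    (4 : ℝ) • ((Metric.ball 0 (1 / ε))ᶜ.indicator (poleField 0) x - roundField x)

/-- The singular part of the flux of a tame function. -/
def fluxTerm (χ : Fin n → ℝ) (z : Fin n → ℂ) (f : ℂ → ℝ) (v : ℂ → ℂ) (ε : ℝ) : ℝ :=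
  ∑ k, χ k * circleMass f v (z k) ε - 4 * circleMass f v 0 (1 / ε)

/-- The coefficient of ∫ f g is half the sum 4 - ∑χ of the weights of the truncated poles. -/
lemma Tame.integral_fluxField {f : ℂ → ℝ} {v : ℂ → ℂ} (h : Tame f v) (χ : Fin n → ℝ)
    (z : Fin n → ℂ) {ε : ℝ} (hε : 0 < ε) :
    Integrable (fun x => inner ℝ (v x) (fluxField χ z ε x)) ∧
    ∫ x, inner ℝ (v x) (fluxField χ z ε x) =
      (4 - ∑ k, χ k) / 2 * (∫ x, f x * g x) + fluxTerm χ z f v ε := by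
  have h1 := fun k => h.integral_flux (z k) hε
  have h2 := h.integral_flux 0 (one_div_pos.2 hε)
  have i1 : Integrable fun x => ∑ k, -χ k * inner ℝ (v x)
      ((Metric.ball (z k) ε)ᶜ.indicator (poleField (z k)) x - roundField x) :=
    integrable_finsetSum _ fun k _ => (h1 k).1.const_mul _
  have e : ∀ x, inner ℝ (v x) (fluxField χ z ε x) = ∑ k, -χ k * inner ℝ (v x)
      ((Metric.ball (z k) ε)ᶜ.indicator (poleField (z k)) x - roundField x) + 4 * inner ℝ (v x)
      ((Metric.ball 0 (1 / ε))ᶜ.indicator (poleField 0) x - roundField x) := by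
    intro x
    rw [fluxField, inner_add_right, inner_sum, real_inner_smul_right]
    simp only [real_inner_smul_right]
  simp only [e]
  refine ⟨i1.add (h2.1.const_mul 4), ?_⟩
  rw [integral_add i1 (h2.1.const_mul 4), integral_finsetSum _ fun k _ => (h1 k).1.const_mul _]
  simp only [integral_const_mul, (h1 _).2, h2.2]
  simp only [mul_sub, Finset.sum_sub_distrib, ← Finset.sum_mul, Finset.sum_neg_distrib, fluxTerm,
    neg_mul]
  ring

lemma measurableSet_perforated (z : Fin n → ℂ) (ε : ℝ) : MeasurableSet (perforated z ε) :=
  ((MeasurableSet.iUnion fun _ => Metric.isOpen_ball.measurableSet).union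
    (measurableSet_lt measurable_const measurable_norm)).compl

lemma mem_perforated {ε : ℝ} {x : ℂ} :
    x ∈ perforated z ε ↔ (∀ k, ε ≤ ‖x - z k‖) ∧ ‖x‖ ≤ 1 / ε := by
  simp [perforated, dist_eq_norm]

/-- On the perforated plane every pole z_k is active and the one at 0 is not, which leaves ∑χ - 4
copies of the round field. The circle |x| = 1/ε belongs to the perforated plane but the pole at 0 is
active on it, so it is excluded. -/
lemma fluxField_eq {ε : ℝ} {x : ℂ} (hx : x ∈ perforated z ε) (hx' : ‖x‖ ≠ 1 / ε) (χ : Fin n → ℝ) :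
    fluxField χ z ε x = bgGrad χ z x := by
  rw [mem_perforated] at hx
  have h1 : ∀ k, x ∈ (Metric.ball (z k) ε)ᶜ := fun k => by
    simpa [dist_eq_norm] using hx.1 k
  have h2 : x ∉ (Metric.ball (0 : ℂ) (1 / ε))ᶜ := by
    rw [Set.notMem_compl_iff, mem_ball_zero_iff]
    exact lt_of_le_of_ne hx.2 hx'
  simp only [fluxField, bgGrad, Set.indicator_of_mem (h1 _), Set.indicator_of_notMem h2, smul_sub,
    Finset.sum_sub_distrib, ← Finset.sum_smul, Finset.sum_neg_distrib]
  module

lemma ae_norm_ne (r : ℝ) : ∀ᵐ x : ℂ, ‖x‖ ≠ r := by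
  have : volume (Metric.sphere (0 : ℂ) r) = 0 := Measure.addHaar_sphere _ _ _
  rw [ae_iff]
  refine measure_mono_null (fun x hx => ?_) this
  simpa using hx

lemma eventually_mem_perforated {x : ℂ} (hx : ∀ k, x ≠ z k) :
    ∀ᶠ ε in 𝓝[>] (0 : ℝ), x ∈ perforated z ε ∧ ‖x‖ ≠ 1 / ε := by
  have h1 : ∀ᶠ ε in 𝓝[>] (0 : ℝ), ∀ k, ε ≤ ‖x - z k‖ := by
    rw [eventually_all]
    intro k
    have : ∀ᶠ ε : ℝ in 𝓝 0, ε < ‖x - z k‖ :=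
      eventually_lt_nhds (norm_pos_iff.2 (sub_ne_zero.2 (hx k)))
    filter_upwards [this.filter_mono nhdsWithin_le_nhds] with ε h using h.le
  filter_upwards [h1, tendsto_inv_nhdsGT_zero.eventually_gt_atTop ‖x‖] with ε h h'
  rw [← one_div] at h'
  exact ⟨mem_perforated.2 ⟨h, h'.le⟩, h'.ne⟩

lemma ae_ne_points (z : Fin n → ℂ) : ∀ᵐ x : ℂ, ∀ k, x ≠ z k := by
  rw [ae_all_iff]
  intro k
  simp [ae_iff, measure_singleton]

lemma tendsto_integral_perforated {q : ℂ → ℝ} (hq : Integrable q) (z : Fin n → ℂ) :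
    Tendsto (fun ε => ∫ x in perforated z ε, q x) (𝓝[>] 0) (𝓝 (∫ x, q x)) := by
  simp only [← integral_indicator (measurableSet_perforated z _)]
  refine tendsto_integral_filter_of_dominated_convergence (fun x => ‖q x‖)
    (Eventually.of_forall fun ε => hq.aestronglyMeasurable.indicator
      (measurableSet_perforated z ε)) (Eventually.of_forall fun ε => ae_of_all _ fun x =>
      norm_indicator_le_norm_self _ _) hq.norm ?_
  filter_upwards [ae_ne_points z] with x hx
  refine tendsto_const_nhds.congr' ?_
  filter_upwards [eventually_mem_perforated hx] with ε h
  rw [Set.indicator_of_mem h.1]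

/-- A point removed by the perforation lies in one small disc or far out. Each truncated pole is
then either switched off, with x in a fixed bounded region, or at distance at least r from x; in
both cases it minus the round field is bounded by the weight, uniformly in ε. -/
lemma exists_bound_fluxField (hz : Function.Injective z) (χ : Fin n → ℝ) :
    ∃ C, ∀ᶠ ε in 𝓝[>] (0 : ℝ), ∀ x ∉ perforated z ε,
      ‖fluxField χ z ε x‖ ≤ C * (1 + ‖x‖ ^ 2)⁻¹ := by
  -- With separation 2r, a point within ε < r of z_k is at distance at least r from every other z_j.
  obtain ⟨r, hr0, hr1, hr⟩ : ∃ r : ℝ, 0 < r ∧ r ≤ 1 ∧ ∀ k j, k ≠ j → 2 * r ≤ ‖z k - z j‖ := by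
    have h1 : ∀ᶠ r : ℝ in 𝓝[>] 0, ∀ k j, k ≠ j → 2 * r ≤ ‖z k - z j‖ := by
      rw [eventually_all]; intro k
      rw [eventually_all]; intro j
      by_cases hkj : k = j
      · simp [hkj]
      · have h2 : 0 < ‖z k - z j‖ := norm_pos_iff.2 (sub_ne_zero.2 (hz.ne hkj))
        filter_upwards [(eventually_lt_nhds (half_pos h2)).filter_mono nhdsWithin_le_nhds]
          with r h3 _
        linarith
    obtain ⟨r, ⟨h2, h3⟩, h4⟩ := ((h1.and ((eventually_lt_nhds one_pos).filter_mono
      nhdsWithin_le_nhds)).and self_mem_nhdsWithin).exists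
    exact ⟨r, h4, h3.le, h2⟩
  obtain ⟨ρ, hρ⟩ : ∃ ρ : ℝ, ∀ k, ‖z k‖ + 1 ≤ ρ := by
    obtain ⟨ρ, hρ⟩ := (Set.finite_range fun k => ‖z k‖ + 1).bddAbove
    exact ⟨ρ, fun k => hρ ⟨k, rfl⟩⟩
  set K : ℂ → ℝ := fun c => ((1 + ‖c‖ ^ 2) / r + ‖c‖) + (1 + ρ ^ 2) with hK
  have hterm : ∀ (c x : ℂ) (s : ℝ), (r ≤ ‖x - c‖ ∧ s ≤ ‖x - c‖) ∨ (‖x‖ ≤ ρ ∧ ‖x - c‖ < s) →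
      ‖(Metric.ball c s)ᶜ.indicator (poleField c) x - roundField x‖ ≤
        K c * (1 + ‖x‖ ^ 2)⁻¹ := by
    rintro c x s (⟨h1, h2⟩ | ⟨h1, h2⟩)
    · rw [Set.indicator_of_mem (by simpa [dist_eq_norm] using h2)]
      refine (norm_poleField_sub_roundField hr0 h1).trans ?_
      gcongr
      exact le_add_of_nonneg_right (by positivity)
    · rw [Set.indicator_of_notMem (by simpa [dist_eq_norm] using h2), zero_sub, norm_neg]
      refine (norm_roundField_le_one x).trans ?_
      have h3 : ‖x‖ ^ 2 ≤ ρ ^ 2 := pow_le_pow_left₀ (norm_nonneg _) h1 2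
      rw [← div_eq_mul_inv, le_div_iff₀ (one_add_normSq_pos x), one_mul, hK]
      have : 0 ≤ (1 + ‖c‖ ^ 2) / r + ‖c‖ := by positivity
      simp only
      linarith
  refine ⟨∑ k, |χ k| * K (z k) + 4 * K 0, ?_⟩
  filter_upwards [self_mem_nhdsWithin, (eventually_lt_nhds hr0).filter_mono nhdsWithin_le_nhds,
    tendsto_inv_nhdsGT_zero.eventually_gt_atTop (max (ρ + 1) 1)] with ε hε0 hεr hεR x hx
  rw [← one_div, max_lt_iff] at hεR
  have hcase : (∀ k, (r ≤ ‖x - z k‖ ∧ ε ≤ ‖x - z k‖) ∨ (‖x‖ ≤ ρ ∧ ‖x - z k‖ < ε)) ∧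
      ((r ≤ ‖x - 0‖ ∧ 1 / ε ≤ ‖x - 0‖) ∨ (‖x‖ ≤ ρ ∧ ‖x - 0‖ < 1 / ε)) := by
    rw [mem_perforated, not_and_or] at hx
    rw [sub_zero]
    rcases hx with hx | hx
    · push Not at hx
      obtain ⟨k, hk⟩ := hx
      have h1 : ‖x‖ ≤ ρ := by
        have h2 := norm_add_le (x - z k) (z k)
        rw [sub_add_cancel] at h2
        linarith [hρ k]
      refine ⟨fun j => ?_, Or.inr ⟨h1, by linarith⟩⟩
      by_cases hkj : k = j
      · exact Or.inr ⟨h1, hkj ▸ hk⟩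
      · have h2 := hr k j hkj
        have h3 := norm_add_le (x - z j) (z k - x)
        rw [show x - z j + (z k - x) = z k - z j by ring, norm_sub_rev (z k) x] at h3
        exact Or.inl ⟨by linarith, by linarith⟩
    · push Not at hx
      refine ⟨fun j => ?_, Or.inl ⟨by linarith, hx.le⟩⟩
      have h2 := norm_sub_norm_le x (z j)
      have h3 := hρ j
      exact Or.inl ⟨by linarith, by linarith⟩
  calc ‖fluxField χ z ε x‖ ≤ ∑ k, |χ k| * (K (z k) * (1 + ‖x‖ ^ 2)⁻¹) +
        4 * (K 0 * (1 + ‖x‖ ^ 2)⁻¹) := by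
        refine (norm_add_le _ _).trans (add_le_add ((norm_sum_le _ _).trans
          (Finset.sum_le_sum fun k _ => ?_)) ?_)
        · rw [norm_smul, Real.norm_eq_abs, abs_neg]
          gcongr
          exact hterm _ _ _ (hcase.1 k)
        · rw [norm_smul, Real.norm_of_nonneg (by norm_num)]
          gcongr
          exact hterm _ _ _ hcase.2
    _ = _ := by
        rw [add_mul (∑ k, |χ k| * K (z k)), Finset.sum_mul, mul_assoc 4]
        simp only [mul_assoc]

lemma Tame.integrableOn_inner_bgGrad {f : ℂ → ℝ} {v : ℂ → ℂ} (h : Tame f v) (χ : Fin n → ℝ)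
    (z : Fin n → ℂ) {ε : ℝ} (hε : 0 < ε) :
    IntegrableOn (fun x => inner ℝ (v x) (bgGrad χ z x)) (perforated z ε) := by
  refine (h.integral_fluxField χ z hε).1.integrableOn.congr ?_
  filter_upwards [ae_restrict_mem (measurableSet_perforated z ε),
    ae_restrict_of_ae (ae_norm_ne (1 / ε))] with x h1 h2
  rw [fluxField_eq h1 h2]

/-- The flux over the whole plane is known exactly for each ε. What separates it from the perforated
integral is an integral over the removed set, dominated by a multiple of |v|(1+|x|²)⁻¹ and vanishing
pointwise almost everywhere. -/
lemma Tame.tendsto_integral_inner_bgGrad {f : ℂ → ℝ} {v : ℂ → ℂ} (h : Tame f v)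
    (hz : Function.Injective z) (χ : Fin n → ℝ) :
    Tendsto (fun ε => (∫ x in perforated z ε, inner ℝ (v x) (bgGrad χ z x)) - fluxTerm χ z f v ε)
      (𝓝[>] 0) (𝓝 ((4 - ∑ k, χ k) / 2 * ∫ x, f x * g x)) := by
  obtain ⟨C, hC⟩ := exists_bound_fluxField hz χ
  have hm : ∀ ε, MeasurableSet (perforated z ε)ᶜ := fun ε => (measurableSet_perforated z ε).compl
  have h1 : Tendsto (fun ε => ∫ x, (perforated z ε)ᶜ.indicator
      (fun x => inner ℝ (v x) (fluxField χ z ε x)) x) (𝓝[>] 0) (𝓝 (∫ _ : ℂ, (0 : ℝ))) := by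
    refine tendsto_integral_filter_of_dominated_convergence
      (fun x => |C| * (‖v x‖ * (1 + ‖x‖ ^ 2)⁻¹)) ?_ ?_ (h.grad_integrable.const_mul _) ?_
    · filter_upwards [self_mem_nhdsWithin] with ε hε
      exact (h.integral_fluxField χ z hε).1.aestronglyMeasurable.indicator (hm ε)
    · filter_upwards [hC] with ε hε
      refine ae_of_all _ fun x => ?_
      by_cases hx : x ∈ perforated z ε
      · rw [Set.indicator_of_notMem (by simpa using hx), norm_zero]; positivity
      · rw [Set.indicator_of_mem hx]
        calc ‖inner ℝ (v x) (fluxField χ z ε x)‖ ≤ ‖v x‖ * ‖fluxField χ z ε x‖ :=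
              norm_inner_le_norm _ _
          _ ≤ ‖v x‖ * (|C| * (1 + ‖x‖ ^ 2)⁻¹) := by
              gcongr
              refine (hε x hx).trans ?_
              gcongr
              exact le_abs_self C
          _ = _ := by ring
    · filter_upwards [ae_ne_points z] with x hx
      refine tendsto_const_nhds.congr' ?_
      filter_upwards [eventually_mem_perforated hx] with ε h
      rw [Set.indicator_of_notMem (by simpa using h.1)]
  rw [integral_zero] at h1
  have h2 := (tendsto_const_nhds (x := (4 - ∑ k, χ k) / 2 * ∫ x, f x * g x)).sub h1
  rw [sub_zero] at h2
  refine h2.congr' ?_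
  filter_upwards [self_mem_nhdsWithin] with ε hε
  obtain ⟨i1, e1⟩ := h.integral_fluxField χ z hε
  have e2 := integral_add_compl (measurableSet_perforated z ε) i1
  have e3 : ∫ x in perforated z ε, inner ℝ (v x) (bgGrad χ z x) =
      ∫ x in perforated z ε, inner ℝ (v x) (fluxField χ z ε x) := by
    refine integral_congr_ae ?_
    filter_upwards [ae_restrict_mem (measurableSet_perforated z ε),
      ae_restrict_of_ae (ae_norm_ne (1 / ε))] with x h1 h2
    rw [fluxField_eq h1 h2]
  rw [integral_indicator (hm ε), e3]
  linarith

/-! ### The Liouville action -/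


/-- Everything is expanded in ∑χ, ∑χ², ∑χ ln g(z_k), ∑χ² ln g(z_k) and the double sum of χ_kχ_j
ln|z_k - z_j|. The diagonal may be included in the latter since `Real.log 0 = 0`; its other
contributions are subtracted explicitly. -/
lemma constants_eq (χ : Fin n → ℝ) (z : Fin n → ℂ) :
    (4 - ∑ k, χ k) / (8 * Real.pi) * (∫ x, g x * Real.log (g x)) -
      1 / 2 * ∑ k, χ k * bg χ z (z k) + 2 * bgConst χ z = l χ z + Cstar χ := by
  have hl : ∑ k, ∑ j, (if k ≠ j then χ k * χ j * G (z j) (z k) else 0) =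
      ∑ k, χ k * (∑ j, -χ j * Real.log ‖z k - z j‖) -
        1 / 2 * (∑ k, χ k) * (∑ k, χ k * Real.log (g (z k))) + κ * (∑ k, χ k) ^ 2 -
        (κ * ∑ k, χ k ^ 2 - 1 / 2 * ∑ k, χ k ^ 2 * Real.log (g (z k))) := by
    have h1 : ∀ k j, (if k ≠ j then χ k * χ j * G (z j) (z k) else 0) =
        (χ k * (-χ j * Real.log ‖z k - z j‖) - 1 / 4 * (χ k * Real.log (g (z k))) * χ j -
          1 / 4 * χ k * (χ j * Real.log (g (z j))) + κ * χ k * χ j) -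
        if k = j then κ * χ k ^ 2 - 1 / 2 * (χ k ^ 2 * Real.log (g (z k))) else 0 := by
      intro k j
      by_cases h : k = j
      · subst h
        simp only [ne_eq, not_true, if_false, if_true, sub_self, norm_zero, Real.log_zero]
        ring
      · simp only [ne_eq, h, not_false_iff, if_true, if_false, G, one_div, Real.log_inv,
          norm_sub_rev (z j)]
        ring
    simp only [h1, Finset.sum_sub_distrib, Finset.sum_add_distrib, Finset.sum_ite_eq,
      Finset.mem_univ, if_true, ← Finset.mul_sum, ← Finset.sum_mul]
    ring
  have hb : ∑ k, χ k * bg χ z (z k) = (∑ k, χ k - 4) / 4 * ((∑ k, χ k) * Real.log 4 -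
      ∑ k, χ k * Real.log (g (z k))) + ∑ k, χ k * (∑ j, -χ j * Real.log ‖z k - z j‖) +
      (∑ k, χ k) * bgConst χ z := by
    have h1 : ∀ k, χ k * bg χ z (z k) = (∑ k, χ k - 4) / 4 * (χ k * Real.log 4 -
        χ k * Real.log (g (z k))) + χ k * (∑ j, -χ j * Real.log ‖z k - z j‖) +
        χ k * bgConst χ z := by
      intro k
      rw [bg, log_g]; ring
    simp only [h1, Finset.sum_add_distrib, ← Finset.mul_sum, ← Finset.sum_mul,
      Finset.sum_sub_distrib]
  have hc : bgConst χ z = (1 - (∑ k, χ k) / 4) * Real.log 4 + κ * (∑ k, χ k) -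
      1 / 4 * ∑ k, χ k * Real.log (g (z k)) := by
    simp only [bgConst, mul_sub, Finset.sum_sub_distrib, mul_left_comm _ (1 / 4 : ℝ),
      ← Finset.mul_sum, ← Finset.sum_mul]
    ring
  have hl1 : ∑ k, χ k * (1 - χ k / 4) * Real.log (g (z k)) = ∑ k, χ k * Real.log (g (z k)) -
      1 / 4 * ∑ k, χ k ^ 2 * Real.log (g (z k)) := by
    rw [Finset.mul_sum, ← Finset.sum_sub_distrib]
    exact Finset.sum_congr rfl fun k _ => by ring
  have hlog : Real.log 4 = 2 * Real.log 2 := by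
    rw [show (4 : ℝ) = 2 ^ 2 by norm_num, Real.log_pow]; norm_num
  rw [l, hl, hl1, hb, hc, Cstar, ← Finset.sum_mul, hlog]
  ring

/-- The factors -2i and 8i meet the -i of `boundaryTerm_eq`, so R is real and its contour part is -2
times the flux of φ. -/
lemma R_eq {φ : ℂ → ℝ} {v : ℂ → ℂ} (hφ : IsWeakGrad φ v) (χ : Fin n → ℝ) (z : Fin n → ℂ) {ε : ℝ}
    (hε : 0 < ε) : R χ z ε φ = ((-2 * fluxTerm χ z φ v ε +
      2 * Real.pi * (∑ k, χ k ^ 2) * Real.log (1 / ε) + 32 * Real.pi * Real.log (1 / ε) : ℝ) : ℂ) := by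
  have h1 : ∀ k, (χ k : ℂ) * boundaryTerm φ (z k) ε =
      -Complex.I * ((χ k * circleMass φ v (z k) ε : ℝ) : ℂ) := by
    intro k
    rw [hφ.boundaryTerm_eq (z k) hε]
    push_cast; ring
  rw [R, fluxTerm]
  simp only [h1, ← Finset.mul_sum, hφ.boundaryTerm_eq 0 (one_div_pos.2 hε)]
  push_cast
  linear_combination (2 * ∑ k, (χ k : ℂ) * (circleMass φ v (z k) ε : ℂ) -
    8 * (circleMass φ v 0 (1 / ε) : ℂ)) * Complex.I_sq

lemma fluxTerm_add {f₁ f₂ : ℂ → ℝ} {v₁ v₂ : ℂ → ℂ} (h₁ : IsWeakGrad f₁ v₁)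
    (h₂ : IsWeakGrad f₂ v₂) (χ : Fin n → ℝ) (z : Fin n → ℂ) (ε : ℝ) :
    fluxTerm χ z (fun x => f₁ x + f₂ x) (fun x => v₁ x + v₂ x) ε =
      fluxTerm χ z f₁ v₁ ε + fluxTerm χ z f₂ v₂ ε := by
  simp only [fluxTerm, circleMass_add h₁ h₂, mul_add, Finset.sum_add_distrib]
  ring

/-- The circle around z_k contributes χ_k · 2πχ_k ln(1/ε) and the large circle 4 · 8π ln(1/ε): these
divergences are exactly the counterterms of R. -/
lemma tendsto_fluxTerm_bg (hz : Function.Injective z) (χ : Fin n → ℝ) :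
    Tendsto (fun ε => fluxTerm χ z (bg χ z) (bgGrad χ z) ε -
        2 * Real.pi * (∑ k, χ k ^ 2) * Real.log (1 / ε) - 32 * Real.pi * Real.log (1 / ε))
      (𝓝[>] 0) (𝓝 (2 * Real.pi * (∑ k, χ k * bg χ z (z k)) - 8 * Real.pi * bgConst χ z)) := by
  have h1 := tendsto_finsetSum Finset.univ fun k _ =>
    (tendsto_circleMass_bg_pole hz χ k).const_mul (χ k)
  have h2 := ((tendsto_circleMass_bg_infty χ z).comp
    (tendsto_inv_nhdsGT_zero (𝕜 := ℝ))).const_mul 4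
  have h3 := h1.sub h2
  have e : ∑ k, χ k * (2 * Real.pi * bg χ z (z k)) - 4 * (2 * Real.pi * bgConst χ z) =
      2 * Real.pi * (∑ k, χ k * bg χ z (z k)) - 8 * Real.pi * bgConst χ z := by
    rw [Finset.mul_sum]
    congr 1
    · exact Finset.sum_congr rfl fun k _ => by ring
    · ring
  rw [e] at h3
  refine h3.congr fun ε => ?_
  have e2 : ∑ k, χ k * (circleMass (bg χ z) (bgGrad χ z) (z k) ε + 2 * Real.pi * χ k * Real.log ε) =
      ∑ k, χ k * circleMass (bg χ z) (bgGrad χ z) (z k) ε +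
        2 * Real.pi * (∑ k, χ k ^ 2) * Real.log ε := by
    rw [Finset.mul_sum, Finset.sum_mul, ← Finset.sum_add_distrib]
    exact Finset.sum_congr rfl fun k _ => by ring
  simp only [Function.comp_apply, e2, fluxTerm, one_div, Real.log_inv]
  ring

lemma norm_add_sq_eq_inner (a b : ℂ) :
    ‖a + b‖ ^ 2 = ‖a‖ ^ 2 + (2 * inner ℝ a b + inner ℝ b b) := by
  rw [norm_add_sq_real, real_inner_self_eq_norm_sq]; ring

lemma integrable_centeredAction (hz : Function.Injective z) (hχ : ∀ k, χ k < 2) (Λ : ℝ)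
    {h : ℂ → ℝ} (hh : MemH1 h) : Integrable (fun x =>
      ‖weakGrad h x‖ ^ 2 + 4 * Real.pi * Λ * Real.exp (h x) * w χ z x * g x) := by
  refine hh.integrable_grad.add (((hh.tame.integrable_exp_mul_w hh.integrable_grad hz hχ).const_mul
    (4 * Real.pi * Λ)).congr (ae_of_all _ fun x => ?_))
  simp only [mul_assoc]

/-- The regularized actions of `h + ln (g w)` are defined and converge. -/
lemma liouville_limit (hz : Function.Injective z) (hχ : ∀ k, χ k < 2) (Λ : ℝ) {h : ℂ → ℝ}
    (hh : MemH1 h) :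
    (∀ᶠ ε in 𝓝[>] (0 : ℝ), RegularizedActionDefined z Λ (fun x => h x + bg χ z x) ε) ∧
    Tendsto (regularizedAction χ z Λ fun x => h x + bg χ z x) (𝓝[>] 0)
      (𝓝 ((centeredAction χ z Λ h + l χ z + Cstar χ : ℝ) : ℂ)) := by
  set v := weakGrad h
  set U := bgGrad χ z
  set φ : ℂ → ℝ := fun x => h x + bg χ z x with hφ
  have th := hh.tame
  have tu := tame_bg χ z
  have hwφ : IsWeakGrad φ (fun x => v x + U x) := (th.add tu).isWeakGrad
  have hexp : ∀ x, Real.exp (φ x) = Real.exp (h x) * w χ z x * g x := by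
    intro x
    rw [hφ, Real.exp_add, ← log_g_mul_w, Real.exp_log (mul_pos (g_pos x) (w_pos χ z x))]
    ring
  set q : ℂ → ℝ := fun x =>
    ‖v x‖ ^ 2 + 4 * Real.pi * Λ * Real.exp (h x) * w χ z x * g x with hq
  have iq : Integrable q := integrable_centeredAction hz hχ Λ hh
  have hdens : (fun x => ‖weakGrad φ x‖ ^ 2 + 4 * Real.pi * Λ * Real.exp (φ x)) =ᵐ[volume]
      fun x => q x + (2 * inner ℝ (v x) (U x) + inner ℝ (U x) (U x)) := by
    filter_upwards [hwφ.weakGrad_ae_eq] with x hx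
    rw [hx, norm_add_sq_eq_inner, hexp, hq]
    ring
  have j1 : ∀ ε : ℝ, 0 < ε → IntegrableOn (fun x => 2 * inner ℝ (v x) (U x)) (perforated z ε) :=
    fun ε hε => (th.integrableOn_inner_bgGrad χ z hε).const_mul 2
  have j2 : ∀ ε : ℝ, 0 < ε → IntegrableOn (fun x => inner ℝ (U x) (U x)) (perforated z ε) :=
    fun ε hε => tu.integrableOn_inner_bgGrad χ z hε
  have j3 : ∀ ε : ℝ, 0 < ε → IntegrableOn
      (fun x => 2 * inner ℝ (v x) (U x) + inner ℝ (U x) (U x)) (perforated z ε) :=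
    fun ε hε => (j1 ε hε).add (j2 ε hε)
  constructor
  · filter_upwards [self_mem_nhdsWithin] with ε hε
    refine ⟨⟨_, hwφ⟩, ?_, fun k => HasWeakGrad.hasCircleTrace ⟨_, hwφ⟩ _ hε,
      HasWeakGrad.hasCircleTrace ⟨_, hwφ⟩ _ (one_div_pos.2 hε)⟩
    exact (iq.integrableOn.add (j3 ε hε)).congr (ae_restrict_of_ae hdens.symm)
  · have l1 := tendsto_integral_perforated iq z
    have l2 := th.tendsto_integral_inner_bgGrad hz χ
    have l3 := tu.tendsto_integral_inner_bgGrad hz χ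
    have l4 := tendsto_fluxTerm_bg hz χ
    -- The terms -2 `fluxTerm` of h + U are distributed: both copies for h go with the cross term,
    -- one copy for U with |∇U|², and the last copy for U with the logarithmic counterterms.
    have l5 := (((l1.add (l2.const_mul 2)).add l3).sub l4).const_mul (1 / (4 * Real.pi))
    have hπ := Real.pi_ne_zero
    have e : 1 / (4 * Real.pi) * ((∫ x, q x) +
        2 * ((4 - ∑ k, χ k) / 2 * ∫ x, h x * g x) + (4 - ∑ k, χ k) / 2 * (∫ x, bg χ z x * g x) -
        (2 * Real.pi * (∑ k, χ k * bg χ z (z k)) - 8 * Real.pi * bgConst χ z)) =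
        centeredAction χ z Λ h + l χ z + Cstar χ := by
      rw [add_assoc (centeredAction χ z Λ h), ← constants_eq, centeredAction, integral_bg_mul_g]
      field_simp
      ring
    rw [e] at l5
    refine ((Complex.continuous_ofReal.tendsto _).comp l5).congr' ?_
    filter_upwards [self_mem_nhdsWithin] with ε hε
    rw [regularizedAction, R_eq hwφ χ z hε, integral_congr_ae (ae_restrict_of_ae hdens),
      integral_add iq.integrableOn (j3 ε hε), integral_add (j1 ε hε) (j2 ε hε), integral_const_mul,
      fluxTerm_add th.isWeakGrad tu.isWeakGrad]
    simp only [Function.comp_apply]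
    push_cast
    ring

end SphereLiouville

end

/-! ### The action identity -/

theorem lemma3p1 {n : ℕ} (χ : Fin n → ℝ) (z : Fin n → ℂ) (Λ : ℝ)
    (hz : Function.Injective z) (hχ : ∀ k, χ k < 2) (hsum : 4 < ∑ k, χ k) (hΛ : 0 < Λ)
    (h φ : ℂ → ℝ) (hh : SphereLiouville.MemH1 h)
    (hφ : ∀ x, φ x = h x + Real.log (SphereLiouville.g x * SphereLiouville.w χ z x)) :
    -- the centered action of `h` makes sense
    MeasureTheory.Integrable (fun x => ‖SphereLiouville.weakGrad h x‖ ^ 2 +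
      4 * Real.pi * Λ * Real.exp (h x) * SphereLiouville.w χ z x * SphereLiouville.g x)
      MeasureTheory.volume ∧
    MeasureTheory.Integrable (fun x => h x * SphereLiouville.g x) MeasureTheory.volume ∧
    -- the regularized actions of `φ` make sense and converge to the action of `φ`
    (∀ᶠ ε in 𝓝[>] (0 : ℝ), SphereLiouville.RegularizedActionDefined z Λ φ ε) ∧
    Filter.Tendsto (SphereLiouville.regularizedAction χ z Λ φ) (𝓝[>] (0 : ℝ))
      (𝓝 (SphereLiouville.liouvilleAction χ z Λ φ)) ∧
    -- the identity
    SphereLiouville.liouvilleAction χ z Λ φ =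
      ((SphereLiouville.centeredAction χ z Λ h + SphereLiouville.l χ z +
        SphereLiouville.Cstar χ : ℝ) : ℂ) := by
  obtain rfl : φ = fun x => h x + SphereLiouville.bg χ z x :=
    funext fun x => by rw [hφ, SphereLiouville.log_g_mul_w]
  obtain ⟨hdef, hlim⟩ := SphereLiouville.liouville_limit hz hχ Λ hh
  -- `limUnder` is meaningful only once convergence is known; it then equals the limit found above.
  have heq := hlim.limUnder_eq
  refine ⟨SphereLiouville.integrable_centeredAction hz hχ Λ hh, hh.tame.integrable_mul_g, hdef, ?_,
    heq⟩
  rw [SphereLiouville.liouvilleAction, heq]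
  exact hlim
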